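/- Let $0<\gamma<1$, let $\Omega\subset\mathbb C$ be a bounded domain (open, connected, non-empty) with boundary of class $C^{1,\gamma}$, i.e. in a neighbourhood of $\partial\Omega$ the set $\Omega$ is $\{\rho<0\}$ for a real $C^1$ function $\rho$ with $\gamma$-Hölder gradient that does not vanish on $\partial\Omega$. Let $R_0>0$, $U_{R_0}=\bigcup_{\zeta\in\partial\Omega}B_{R_0}(\zeta)$ and $\delta(z)=\max\{\operatorname{dist}(z,\partial\Omega),R_0/2\}$. For a function $f$ on $\mathbb C$ let $$B[f](z)=\lim_{\varepsilon\to0^+}\int_{\mathbb C\setminus B_\varepsilon(z)}\frac{f(\zeta)}{(\bar\zeta-\bar z)^2}\,dm(\zeta)$$ be its (conjugate, unnormalized) Beurling transform. For a complex function $f$ on a set $S\subset\mathbb C$ put $$\|f\|_\gamma=\sup_{S}|f|+\sup_{z\ne w\in S}\frac{|f(z)-f(w)|}{|z-w|^\gamma},$$ and identify $f$ with its extension by $0$ to $\mathbb C$. There is a constant $K$, depending only on $\gamma$, $\Omega$ and $R_0$, such that the following holds for $f=\phi$ on $S=\overline\Omega$ and for $f=\psi$ on $S=\mathbb C\setminus\Omega$,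 whenever $\phi$ is $\gamma$-Hölder on $\overline\Omega$, and $\psi$ is $\gamma$-Hölder on $\mathbb C\setminus\Omega$ and satisfies, for some constant $C(\psi)$, $|\psi(z)|\le C(\psi)/\delta(z)^2$ for all $z\notin\Omega\cup U_{R_0}$. 1. For every $z\notin\partial\Omega$ the truncated integrals converge absolutely and the limit $B[f](z)$ exists. 2. If $z,w\in\Omega$, or if $z,w\in\mathbb C\setminus\overline\Omega$, then $|B[f](z)-B[f](w)|\le K\,\|f\|_\gamma\,|z-w|^\gamma$. 3. $B[f]|_{\Omega}$ and $B[f]|_{\mathbb C\setminus\overline\Omega}$ extend to functions $F_i$ on $\overline\Omega$ and $F_e$ on $\mathbb C\setminus\Omega$ that are $\gamma$-Hölder with the same constant $K\|f\|_\gamma$, and these extensions differ by a jump along $\partial\Omega$: $|F_i(z)-F_e(z)|=\pi|f(z)|$ for every $z\in\partial\Omega$. -/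

import Mathlib

open scoped NNReal Topology ComplexConjugate
open Set Filter MeasureTheory

noncomputable section

/-- `Ω` has boundary of class `C^{1,γ}`: near `∂Ω` it is the sublevel set `{ρ < 0}` of a `C¹`
function `ρ` with `γ`-Hölder derivative, which does not vanish on `∂Ω`. -/
def HasC1HolderBoundary (γ : ℝ≥0) (Ω : Set ℂ) : Prop :=
  ∃ (ρ : ℂ → ℝ) (U : Set ℂ), IsOpen U ∧ frontier Ω ⊆ U ∧
    ContDiffOn ℝ 1 ρ U ∧
    (∃ C : ℝ≥0, HolderOnWith C γ (fderiv ℝ ρ) U) ∧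
    Ω ∩ U = {z ∈ U | ρ z < 0} ∧
    ∀ z ∈ frontier Ω, fderiv ℝ ρ z ≠ 0

/-- The full Hölder norm `‖f‖_γ = sup_S |f| + sup_{z ≠ w ∈ S} |f z - f w| / |z - w|^γ` on `S`
(used for bounded `γ`-Hölder functions, for which both terms are finite). -/
def holderNorm (γ : ℝ≥0) (S : Set ℂ) (f : ℂ → ℂ) : ℝ≥0 :=
  (⨆ z : S, ‖f z‖₊) + nnHolderNorm γ (S.domRestrict f)

/-- The kernel `1 / (conj ζ - conj z)²` of the (conjugate) Beurling transform, times `f`. -/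
def beurlingIntegrand (f : ℂ → ℂ) (z ζ : ℂ) : ℂ :=
  f ζ / (conj ζ - conj z) ^ 2

/-- The truncated transform `B_ε[f](z)`, the integral over the complement of `B_ε(z)`. -/
def truncBeurling (f : ℂ → ℂ) (ε : ℝ) (z : ℂ) : ℂ :=
  ∫ ζ in (Metric.ball z ε)ᶜ, beurlingIntegrand f z ζ

/-- `B[f](z)`, the principal value `lim_{ε → 0+} B_ε[f](z)`. -/
def beurling (f : ℂ → ℂ) (z : ℂ) : ℂ :=
  limUnder (𝓝[>] (0 : ℝ)) (fun ε => truncBeurling f ε z)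

/-- The principal value defining `B[f](z)` exists: all truncated integrals converge absolutely,
and they converge to `B[f](z)` as `ε → 0+`. -/
def BeurlingExists (f : ℂ → ℂ) (z : ℂ) : Prop :=
  (∀ ε : ℝ, 0 < ε → IntegrableOn (beurlingIntegrand f z) (Metric.ball z ε)ᶜ) ∧
    Tendsto (fun ε => truncBeurling f ε z) (𝓝[>] (0 : ℝ)) (𝓝 (beurling f z))

/-- `δ(z) = max {d(z, ∂Ω), R₀ / 2}`. -/
def bdryDelta (Ω : Set ℂ) (R₀ : ℝ) (z : ℂ) : ℝ :=
  max (Metric.infDist z (frontier Ω)) (R₀ / 2)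

/-- The decay condition `|ψ(z)| ≤ C / δ(z)²` for `z` outside `Ω ∪ U_{R₀}`, where `U_{R₀}` is the
union of the balls `B_{R₀}(ζ)`, `ζ ∈ ∂Ω`. -/
def DecaysOutside (Ω : Set ℂ) (R₀ : ℝ) (ψ : ℂ → ℂ) (C : ℝ) : Prop :=
  ∀ z ∈ (Ω ∪ ⋃ ζ ∈ frontier Ω, Metric.ball ζ R₀)ᶜ, ‖ψ z‖ ≤ C / bdryDelta Ω R₀ z ^ 2

/-- The two-sided Hölder property of `B[f]`, where `f` is given on `S` (the closure of `Ω`, or the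
complement of `Ω`) and is extended by `0`: the principal value exists off `∂Ω`; `B[f]` is
`γ`-Hölder with constant `M` on `Ω` and on `ℂ ∖ closure Ω`; it extends to each closed side with
the same Hölder constant; and the two extensions have a jump of size `π |f|` along `∂Ω`. -/
def TwoSidedHolder (γ : ℝ≥0) (Ω S : Set ℂ) (f : ℂ → ℂ) (M : ℝ≥0) : Prop :=
  (∀ z ∉ frontier Ω, BeurlingExists (S.indicator f) z) ∧
  HolderOnWith M γ (beurling (S.indicator f)) Ω ∧
  HolderOnWith M γ (beurling (S.indicator f)) (closure Ω)ᶜ ∧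
  ∃ Fi Fe : ℂ → ℂ,
    EqOn Fi (beurling (S.indicator f)) Ω ∧ HolderOnWith M γ Fi (closure Ω) ∧
    EqOn Fe (beurling (S.indicator f)) (closure Ω)ᶜ ∧ HolderOnWith M γ Fe Ωᶜ ∧
    ∀ z ∈ frontier Ω, ‖Fi z - Fe z‖ = Real.pi * ‖f z‖

end

noncomputable section

/-! Both cases reduce to a bounded Hölder function `f` on the whole plane, restricted to a set `S`
between `Ω` and its closure, or to `Sᶜ`. The given function is extended across `∂Ω` by an
inf-convolution. The norm grows only by a factor depending on `γ` and the diameter scale of `Ω`. The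
decay of `ψ` is used only qualitatively: it makes the supremum finite and the truncated integrals
absolutely convergent. It does not enter the constant.

On the plane the classical argument applies (`norm_beurling_sub_le`). The kernel has mean zero on
annuli, and a difference of two truncated kernels has integral zero, so `f` may be replaced by its
increments. All resulting integrals are controlled by a single one: `∫ |ζ|^g tailKernel t |ζ|`
equals a constant times `t^g`.

Where the density lives, `B[1_S f] = B[f] - B[1_{Sᶜ} f]`. So it remains to estimate a transform at
points off its support, up to the boundary (`norm_offTransform_sub_le`). A `C^{1,γ}` boundary is
uniformly flat: near `p` it deviates from its tangent by `O(|ζ - p|^(1+γ))`. Hence, for points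
approaching `p` nontangentially, `f` can be frozen at `p` and `S` replaced by a rectangle tangent at
`p`, with error `O(t^γ)` (`norm_setIntegral_sub_tangentRect_le`). The transform of the rectangle is
explicit and Lipschitz up to the middle of its flat side, because a primitive along that side leaves
only contributions from the far edges. Two arbitrary nearby points are then joined by a chain of
three steps, each inside the cone of a single boundary point.

The jump comes from the same replacement, applied to the points `p ± t n` (`norm_beurling_jump_le`).
For the rectangle an arctangent integral gives exactly `-π`, up to `O(t)`, and the rotation to the
normal `n` contributes the unimodular factor `n²`. As `B[f]` is continuous, the complementary piece
has the opposite jump. `twoSidedHolder_of_plane` assembles the two sides. -/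

/-- The kernel `1 / (conj ζ - conj z)²` of the conjugate Beurling transform. -/
def beurlingKernel (z ζ : ℂ) : ℂ := 1 / (conj ζ - conj z) ^ 2

/-- The radial majorant `t / (ρ² (t + ρ))`, comparable to `min (ρ⁻²) (t ρ⁻³)`. -/
def tailKernel (t ρ : ℝ) : ℝ := t / (ρ ^ 2 * (t + ρ))

/-! ### Pointwise bounds for the kernel and its differences. -/

lemma beurlingIntegrand_eq (f : ℂ → ℂ) (z ζ : ℂ) :
    beurlingIntegrand f z ζ = f ζ * beurlingKernel z ζ := by
  simp [beurlingIntegrand, beurlingKernel, div_eq_mul_inv]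

lemma norm_conj_sub_conj (z ζ : ℂ) : ‖conj ζ - conj z‖ = ‖ζ - z‖ := by
  rw [← map_sub, RCLike.norm_conj]

lemma norm_beurlingKernel (z ζ : ℂ) : ‖beurlingKernel z ζ‖ = 1 / ‖ζ - z‖ ^ 2 := by
  rw [beurlingKernel, norm_div, norm_pow, norm_conj_sub_conj, norm_one]

lemma measurable_beurlingKernel (z : ℂ) : Measurable (beurlingKernel z) := by
  unfold beurlingKernel
  have : Measurable (fun ζ : ℂ => conj ζ) := Complex.continuous_conj.measurable
  fun_prop

lemma tailKernel_nonneg {t ρ : ℝ} (ht : 0 ≤ t) (hρ : 0 ≤ ρ) : 0 ≤ tailKernel t ρ := by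
  unfold tailKernel; positivity

lemma measurable_tailKernel (t : ℝ) : Measurable (tailKernel t) := by
  unfold tailKernel; fun_prop

lemma tailKernel_anti {t a b : ℝ} (ht : 0 ≤ t) (ha : 0 < a) (hab : a ≤ b) :
    tailKernel t b ≤ tailKernel t a := by
  unfold tailKernel; gcongr

/-- Dilating the radius by a factor `c ≥ 1` changes `tailKernel` by at most `c³`. -/
lemma tailKernel_le_of_le_mul {t a ρ c : ℝ} (ht : 0 < t) (hρ : 0 < ρ) (hc : 1 ≤ c)
    (h : ρ ≤ c * a) : tailKernel t a ≤ c ^ 3 * tailKernel t ρ := by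
  have hc0 : 0 < c := by linarith
  have ha : 0 < a := by
    by_contra hh
    nlinarith [mul_nonneg hc0.le (by linarith : 0 ≤ -a)]
  unfold tailKernel
  rw [← mul_div_assoc, div_le_div_iff₀ (by positivity) (by positivity)]
  have h1 : ρ ^ 2 ≤ c ^ 2 * a ^ 2 := by rw [← mul_pow]; gcongr
  have h2 : t + ρ ≤ c * (t + a) := by nlinarith
  calc t * (ρ ^ 2 * (t + ρ)) ≤ t * ((c ^ 2 * a ^ 2) * (c * (t + a))) := by gcongr
    _ = c ^ 3 * t * (a ^ 2 * (t + a)) := by ring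

/-- At distances at most a multiple of `t` no cancellation between kernels is needed: the size of a
single kernel is already absorbed by the majorant, since `t + a ≤ (1 + c) t`. -/
lemma inv_sq_le_tailKernel {t a : ℝ} (ht : 0 < t) (ha : 0 < a) {c : ℝ} (hac : a ≤ c * t) :
    1 / a ^ 2 ≤ (1 + c) * tailKernel t a := by
  unfold tailKernel
  rw [← mul_div_assoc, div_le_div_iff₀ (by positivity) (by positivity)]
  nlinarith [mul_le_mul_of_nonneg_left hac (sq_nonneg a)]

/-- If the smaller distance is at most `|z - w|`, the triangle inequality suffices. Otherwise the
difference of squares factors out `conj z - conj w` and gains one power of decay. -/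
lemma norm_beurlingKernel_sub_le_aux {z w ζ : ℂ} (hz : 0 < ‖ζ - z‖)
    (h : ‖ζ - z‖ ≤ ‖ζ - w‖) :
    ‖beurlingKernel z ζ - beurlingKernel w ζ‖ ≤ 4 * tailKernel ‖z - w‖ ‖ζ - z‖ := by
  have hw : 0 < ‖ζ - w‖ := hz.trans_le h
  rcases le_or_gt ‖ζ - z‖ ‖z - w‖ with h1 | h1
  · have hr : 0 < ‖z - w‖ := hz.trans_le h1
    have := inv_sq_le_tailKernel (c := 1) hr hz (by linarith)
    calc _ ≤ ‖beurlingKernel z ζ‖ + ‖beurlingKernel w ζ‖ := norm_sub_le _ _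
      _ = 1 / ‖ζ - z‖ ^ 2 + 1 / ‖ζ - w‖ ^ 2 := by simp only [norm_beurlingKernel]
      _ ≤ 1 / ‖ζ - z‖ ^ 2 + 1 / ‖ζ - z‖ ^ 2 := by gcongr
      _ ≤ _ := by linarith
  · have hA : conj ζ - conj z ≠ 0 := by
      rw [← norm_pos_iff, norm_conj_sub_conj]; exact hz
    have hB : conj ζ - conj w ≠ 0 := by
      rw [← norm_pos_iff, norm_conj_sub_conj]; exact hw
    have key : beurlingKernel z ζ - beurlingKernel w ζ =
        ((conj z - conj w) * ((conj ζ - conj z) + (conj ζ - conj w))) /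
          ((conj ζ - conj z) ^ 2 * (conj ζ - conj w) ^ 2) := by
      unfold beurlingKernel
      field_simp
      ring
    rw [key, norm_div, norm_mul, norm_mul, norm_pow, norm_pow, norm_conj_sub_conj,
      norm_conj_sub_conj, norm_conj_sub_conj]
    have h2 : ‖(conj ζ - conj z) + (conj ζ - conj w)‖ ≤ 2 * ‖ζ - w‖ := by
      refine (norm_add_le _ _).trans ?_
      rw [norm_conj_sub_conj, norm_conj_sub_conj]; linarith
    set a := ‖ζ - z‖
    set b := ‖ζ - w‖
    set r := ‖z - w‖
    have hr : 0 ≤ r := norm_nonneg _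
    calc _ ≤ r * (2 * b) / (a ^ 2 * b ^ 2) := by gcongr
      _ = 2 * r / (a ^ 2 * b) := by field_simp
      _ ≤ 2 * r / (a ^ 2 * a) := by gcongr
      _ ≤ 4 * tailKernel r a := by
        unfold tailKernel
        rw [← mul_div_assoc, div_le_div_iff₀ (by positivity) (by positivity)]
        nlinarith [mul_nonneg (mul_nonneg hr (sq_nonneg a)) (sub_nonneg.2 h1.le)]

lemma norm_beurlingKernel_sub_le {z w ζ : ℂ} (hz : 0 < ‖ζ - z‖) (hw : 0 < ‖ζ - w‖) :
    ‖beurlingKernel z ζ - beurlingKernel w ζ‖ ≤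
      4 * (tailKernel ‖z - w‖ ‖ζ - z‖ + tailKernel ‖z - w‖ ‖ζ - w‖) := by
  have h1 := tailKernel_nonneg (norm_nonneg (z - w)) hz.le
  have h2 := tailKernel_nonneg (norm_nonneg (z - w)) hw.le
  rcases le_total ‖ζ - z‖ ‖ζ - w‖ with h | h
  · linarith [norm_beurlingKernel_sub_le_aux hz h]
  · have := norm_beurlingKernel_sub_le_aux hw h
    rw [norm_sub_rev w z, norm_sub_rev] at this
    linarith

/-! ### Radial integrals -/

/-- The integrand behaves like `y^(g-1)` at `0` and like `t y^(g-2)` at infinity; this is where both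
`0 < g` and `g < 1` are needed. -/
lemma integrableOn_rpow_mul_div {g t : ℝ} (hg0 : 0 < g) (hg1 : g < 1) (ht : 0 < t) :
    IntegrableOn (fun y : ℝ => y ^ (g - 1) * (t / (t + y))) (Ioi 0) := by
  have hm : Measurable (fun y : ℝ => y ^ (g - 1) * (t / (t + y))) := by fun_prop
  rw [← Ioc_union_Ioi_eq_Ioi zero_le_one]
  refine IntegrableOn.union ?_ ?_
  · have h : IntegrableOn (fun y : ℝ => y ^ (g - 1)) (Ioc 0 1) := by
      rw [← intervalIntegrable_iff_integrableOn_Ioc_of_le zero_le_one]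
      exact intervalIntegral.intervalIntegrable_rpow' (by linarith)
    refine h.mono' hm.aestronglyMeasurable ?_
    filter_upwards [ae_restrict_mem measurableSet_Ioc] with y hy
    have hy0 := hy.1
    have h1 : t / (t + y) ≤ 1 := by rw [div_le_one (by positivity)]; linarith
    have h2 : 0 ≤ y ^ (g - 1) := Real.rpow_nonneg hy0.le _
    rw [Real.norm_of_nonneg (by positivity)]
    nlinarith
  · have h : IntegrableOn (fun y : ℝ => t * y ^ (g - 2)) (Ioi 1) :=
      (integrableOn_Ioi_rpow_of_lt (by linarith) zero_lt_one).const_mul t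
    refine h.mono' hm.aestronglyMeasurable ?_
    filter_upwards [ae_restrict_mem measurableSet_Ioi] with y hy
    have hy0 : 0 < y := zero_lt_one.trans hy
    have h2 : 0 ≤ y ^ (g - 1) := Real.rpow_nonneg hy0.le _
    rw [Real.norm_of_nonneg (by positivity)]
    have h3 : y ^ (g - 2) = y ^ (g - 1) * y⁻¹ := by
      rw [← Real.rpow_neg_one, ← Real.rpow_add hy0]; ring_nf
    rw [h3]
    calc y ^ (g - 1) * (t / (t + y)) ≤ y ^ (g - 1) * (t / y) := by
          gcongr; linarith
      _ = _ := by ring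

/-- The constant `∫₀^∞ y^(g-1) / (1 + y) dy`. -/
def radialConst (g : ℝ) : ℝ := ∫ y in Ioi (0 : ℝ), y ^ (g - 1) * (1 / (1 + y))

lemma radialConst_nonneg (g : ℝ) : 0 ≤ radialConst g :=
  setIntegral_nonneg measurableSet_Ioi fun y hy => by
    have : 0 < y := hy
    positivity

lemma integral_rpow_mul_div {g t : ℝ} (ht : 0 < t) :
    ∫ y in Ioi (0 : ℝ), y ^ (g - 1) * (t / (t + y)) = t ^ g * radialConst g := by
  have h := integral_comp_mul_left_Ioi (fun y : ℝ => y ^ (g - 1) * (t / (t + y))) 0 ht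
  rw [mul_zero, smul_eq_mul] at h
  have h2 : ∫ x in Ioi (0 : ℝ), (t * x) ^ (g - 1) * (t / (t + t * x)) =
      t ^ (g - 1) * radialConst g := by
    rw [radialConst, ← integral_const_mul]
    refine setIntegral_congr_fun measurableSet_Ioi fun x hx => ?_
    have hx0 : 0 < x := hx
    rw [Real.mul_rpow ht.le hx0.le]
    field_simp
  rw [h2] at h
  have h3 : t ^ g = t * t ^ (g - 1) := by
    rw [Real.rpow_sub_one ht.ne']; field_simp
  rw [h3, mul_assoc, h, ← mul_assoc, mul_inv_cancel₀ ht.ne', one_mul]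

lemma rpow_mul_tailKernel {g t y : ℝ} (hy : 0 < y) :
    y * (y ^ g * tailKernel t y) = y ^ (g - 1) * (t / (t + y)) := by
  unfold tailKernel
  rw [Real.rpow_sub_one hy.ne']
  rcases eq_or_ne (t + y) 0 with h | h
  · simp [h]
  · field_simp

lemma integrable_radial {g t : ℝ} (hg0 : 0 < g) (hg1 : g < 1) (ht : 0 < t) (c : ℂ) :
    Integrable (fun ζ : ℂ => ‖ζ - c‖ ^ g * tailKernel t ‖ζ - c‖) := by
  have h : Integrable (fun ζ : ℂ => ‖ζ‖ ^ g * tailKernel t ‖ζ‖) := by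
    refine (integrable_fun_norm_addHaar volume
      (f := fun y : ℝ => y ^ g * tailKernel t y)).2 ?_
    rw [Complex.finrank_real_complex]
    refine (integrableOn_rpow_mul_div hg0 hg1 ht).congr_fun (fun y hy => ?_) measurableSet_Ioi
    simp only [smul_eq_mul, Nat.add_one_sub_one, pow_one]
    exact (rpow_mul_tailKernel hy).symm
  exact h.comp_sub_right c

lemma integral_radial {g t : ℝ} (ht : 0 < t) (c : ℂ) :
    ∫ ζ : ℂ, ‖ζ - c‖ ^ g * tailKernel t ‖ζ - c‖ = 2 * Real.pi * radialConst g * t ^ g := by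
  rw [integral_sub_right_eq_self (fun ζ : ℂ => ‖ζ‖ ^ g * tailKernel t ‖ζ‖) c,
    integral_fun_norm_addHaar volume (fun y : ℝ => y ^ g * tailKernel t y),
    Complex.finrank_real_complex]
  have : ∫ y in Ioi (0 : ℝ), y ^ (2 - 1) • (y ^ g * tailKernel t y) =
      t ^ g * radialConst g := by
    rw [← integral_rpow_mul_div ht]
    refine setIntegral_congr_fun measurableSet_Ioi fun y hy => ?_
    simp only [smul_eq_mul, Nat.add_one_sub_one, pow_one]
    exact rpow_mul_tailKernel hy
  rw [this]
  simp [Measure.real, Complex.volume_ball]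
  ring

/-- The region `|Re ξ| ≤ A |Im ξ|^(1+g)` between two tangent curves. -/
def thinRegion (g A : ℝ) : Set ℂ := {ξ | |ξ.re| ≤ A * |ξ.im| ^ (1 + g)}

lemma measurableSet_thinRegion (g A : ℝ) : MeasurableSet (thinRegion g A) := by
  unfold thinRegion
  exact measurableSet_le (by fun_prop) (by fun_prop)

/-- The slice at height `y` has length `2A|y|^(1+g)`, and the majorant there is at most its value at
`|y|`. The extra power `|y|^(1+g)` turns the one-dimensional integral into the same radial integral
as before. Without it the majorant would not be integrable at the origin. -/
lemma lintegral_thinRegion_le {g t A : ℝ} (hg0 : 0 < g) (hg1 : g < 1) (ht : 0 < t)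
    (hA : 0 ≤ A) :
    ∫⁻ ξ in thinRegion g A, ENNReal.ofReal (tailKernel t ‖ξ‖) ≤
      ENNReal.ofReal (4 * A * radialConst g * t ^ g) := by
  have hmeas := measurableSet_thinRegion g A
  set H : ℝ × ℝ → ENNReal := fun q =>
    ({q : ℝ × ℝ | |q.1| ≤ A * |q.2| ^ (1 + g)}).indicator
      (fun q => ENNReal.ofReal (tailKernel t |q.2|)) q with hH
  have hHm : Measurable H := by
    refine Measurable.indicator ?_ (measurableSet_le (by fun_prop) (by fun_prop))
    exact ((measurable_tailKernel t).comp (by fun_prop)).ennreal_ofReal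
  calc ∫⁻ ξ in thinRegion g A, ENNReal.ofReal (tailKernel t ‖ξ‖)
      ≤ ∫⁻ ξ : ℂ, H (Complex.measurableEquivRealProd ξ) := by
        rw [← lintegral_indicator hmeas]
        refine lintegral_mono fun ξ => ?_
        by_cases h : ξ ∈ thinRegion g A
        · rw [indicator_of_mem h]
          have h' : |ξ.re| ≤ A * |ξ.im| ^ (1 + g) := h
          simp only [hH, Complex.measurableEquivRealProd_apply]
          rw [indicator_of_mem (by exact h')]
          refine ENNReal.ofReal_le_ofReal ?_
          by_cases h0 : ξ.im = 0
          · have : ξ.re = 0 := by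
              rw [h0, abs_zero, Real.zero_rpow (by linarith), mul_zero] at h'
              exact abs_eq_zero.1 (le_antisymm h' (abs_nonneg _))
            have : ξ = 0 := Complex.ext this h0
            simp [this]
          · exact tailKernel_anti ht.le (abs_pos.2 h0) (Complex.abs_im_le_norm ξ)
        · rw [indicator_of_notMem h]; exact zero_le
    _ = ∫⁻ q : ℝ × ℝ, H q :=
        Complex.volume_preserving_equiv_real_prod.lintegral_comp hHm
    _ = ∫⁻ y : ℝ, ∫⁻ x : ℝ, H (x, y) := by
        rw [Measure.volume_eq_prod, lintegral_prod_symm' _ hHm]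
    _ = ∫⁻ y : ℝ, ENNReal.ofReal (2 * A * (|y| ^ (1 + g) * tailKernel t |y|)) := by
        refine lintegral_congr fun y => ?_
        have : ∀ x, H (x, y) = (Icc (-(A * |y| ^ (1 + g))) (A * |y| ^ (1 + g))).indicator
            (fun _ => ENNReal.ofReal (tailKernel t |y|)) x := by
          intro x
          simp only [hH, indicator, mem_ofPred_eq, mem_Icc, abs_le]
        simp only [this]
        rw [lintegral_indicator measurableSet_Icc, setLIntegral_const, Real.volume_Icc,
          ← ENNReal.ofReal_mul (tailKernel_nonneg ht.le (abs_nonneg _))]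
        congr 1; ring
    _ = ENNReal.ofReal (∫ y : ℝ, 2 * A * (|y| ^ (1 + g) * tailKernel t |y|)) := by
        rw [ofReal_integral_eq_lintegral_ofReal]
        · refine Integrable.const_mul ?_ _
          refine (integrable_fun_norm_addHaar (E := ℝ) volume
            (f := fun y : ℝ => y ^ (1 + g) * tailKernel t y)).2 ?_
          rw [Module.finrank_self]
          refine (integrableOn_rpow_mul_div hg0 hg1 ht).congr_fun (fun y hy => ?_)
            measurableSet_Ioi
          have hy0 : 0 < y := hy
          simp only [smul_eq_mul, tsub_self, pow_zero, one_mul]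
          rw [← rpow_mul_tailKernel hy, Real.rpow_add hy0, Real.rpow_one, mul_assoc]
        · refine Eventually.of_forall fun y => ?_
          have := tailKernel_nonneg ht.le (abs_nonneg y)
          simp only [Pi.zero_apply]; positivity
    _ ≤ _ := by
        refine ENNReal.ofReal_le_ofReal (le_of_eq ?_)
        rw [integral_const_mul]
        have h := integral_fun_norm_addHaar (E := ℝ) volume
          (fun y : ℝ => y ^ (1 + g) * tailKernel t y)
        rw [Module.finrank_self] at h
        have h2 : ∫ y in Ioi (0 : ℝ), y ^ (1 - 1) • (y ^ (1 + g) * tailKernel t y) =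
            t ^ g * radialConst g := by
          rw [← integral_rpow_mul_div ht]
          refine setIntegral_congr_fun measurableSet_Ioi fun y hy => ?_
          have hy0 : 0 < y := hy
          simp only [smul_eq_mul, tsub_self, pow_zero, one_mul]
          rw [← rpow_mul_tailKernel hy, Real.rpow_add hy0, Real.rpow_one, mul_assoc]
        rw [h2] at h
        simp only [Real.norm_eq_abs] at h
        rw [h]
        simp [Measure.real]
        ring

/-! ### Rigid motions -/

lemma measurePreserving_rigid (p : ℂ) {n : ℂ} (hn : ‖n‖ = 1) :
    MeasurePreserving (fun ξ : ℂ => p + n * ξ) := by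
  have h := (rotation (⟨n, by simpa [Submonoid.unitSphere] using hn⟩ : Circle)).measurePreserving
  exact (measurePreserving_add_left volume p).comp h

lemma measurableEmbedding_rigid (p : ℂ) {n : ℂ} (hn : ‖n‖ = 1) :
    MeasurableEmbedding (fun ξ : ℂ => p + n * ξ) := by
  have hn0 : n ≠ 0 := by rintro rfl; simp at hn
  exact ((Homeomorph.mulLeft₀ n hn0).trans (Homeomorph.addLeft p)).measurableEmbedding

lemma integral_rigid (p : ℂ) {n : ℂ} (hn : ‖n‖ = 1) (F : ℂ → ℂ) :
    ∫ ξ, F (p + n * ξ) = ∫ ζ, F ζ :=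
  (measurePreserving_rigid p hn).integral_comp (measurableEmbedding_rigid p hn) F

lemma setIntegral_rigid (p : ℂ) {n : ℂ} (hn : ‖n‖ = 1) (F : ℂ → ℂ) (E : Set ℂ) :
    ∫ ξ in (fun ξ : ℂ => p + n * ξ) ⁻¹' E, F (p + n * ξ) = ∫ ζ in E, F ζ :=
  (measurePreserving_rigid p hn).setIntegral_preimage_emb (measurableEmbedding_rigid p hn) F E

lemma conj_mul_self_of_norm_one {n : ℂ} (hn : ‖n‖ = 1) : conj n * n = 1 := by
  rw [Complex.conj_mul', hn]; simp

/-- For unimodular `n` one has `(conj n)⁻² = n²`. This factor gives the sign change under a quarter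
turn and the phase of the jump. -/
lemma beurlingKernel_rigid (p : ℂ) {n : ℂ} (hn : ‖n‖ = 1) (z ξ : ℂ) :
    beurlingKernel (p + n * z) (p + n * ξ) = n ^ 2 * beurlingKernel z ξ := by
  have h2 : (conj n)⁻¹ = n := inv_eq_of_mul_eq_one_right (conj_mul_self_of_norm_one hn)
  unfold beurlingKernel
  have : (conj (p + n * ξ) - conj (p + n * z)) = conj n * (conj ξ - conj z) := by
    simp only [map_add, map_mul]; ring
  rw [this, mul_pow, one_div, mul_inv, ← inv_pow, h2, one_div]

/-- The kernel has mean zero over sets that are invariant under the quarter turn about `z`. -/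
lemma setIntegral_beurlingKernel_eq_zero {z : ℂ} {E : Set ℂ}
    (hE : ∀ ξ, z + Complex.I * ξ ∈ E ↔ z + ξ ∈ E) :
    ∫ ζ in E, beurlingKernel z ζ = 0 := by
  have hI : ‖Complex.I‖ = 1 := by simp
  have h1 := setIntegral_rigid z hI (beurlingKernel z) E
  have h2 := setIntegral_rigid z (n := 1) (by simp) (beurlingKernel z) E
  have h3 : (fun ξ : ℂ => z + Complex.I * ξ) ⁻¹' E = (fun ξ : ℂ => z + 1 * ξ) ⁻¹' E := by
    ext ξ; simp [hE ξ]
  -- Since `i² = -1`, the integral equals its own negative. The change of variables requires no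
  -- integrability, so none is assumed on `E`.
  have h4 : ∀ ξ, beurlingKernel z (z + Complex.I * ξ) = - beurlingKernel z (z + 1 * ξ) := by
    intro ξ
    have h5 := beurlingKernel_rigid z hI 0 ξ
    have h6 := beurlingKernel_rigid z (n := 1) (by simp) 0 ξ
    simp only [mul_zero, add_zero, Complex.I_sq] at h5 h6
    rw [h5, h6]; ring
  rw [h3] at h1
  simp only [h4, integral_neg] at h1
  rw [h2] at h1
  have := congrArg (fun x => x / 2) (eq_neg_iff_add_eq_zero.1 h1.symm)
  simpa using this

lemma setIntegral_beurlingKernel_annulus (z : ℂ) (ε ρ : ℝ) :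
    ∫ ζ in Metric.ball z ρ \ Metric.ball z ε, beurlingKernel z ζ = 0 :=
  setIntegral_beurlingKernel_eq_zero fun ξ => by simp

/-! ### Principal values -/

lemma norm_sub_mul_beurlingKernel_le {u : ℂ → ℂ} {z ζ : ℂ} {N ρ g : ℝ} (hg : 0 < g)
    (hρ : 0 < ρ) (hN : ∀ ζ ∈ Metric.ball z ρ, ‖u ζ - u z‖ ≤ N * ‖ζ - z‖ ^ g)
    (hζ : ζ ∈ Metric.ball z ρ) :
    ‖(u ζ - u z) * beurlingKernel z ζ‖ ≤
      (2 * N) * (‖ζ - z‖ ^ g * tailKernel ρ ‖ζ - z‖) := by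
  rw [norm_mul, norm_beurlingKernel]
  rcases eq_or_ne ζ z with rfl | hne
  · simp [Real.zero_rpow hg.ne']
  · have h0 : 0 < ‖ζ - z‖ := norm_pos_iff.2 (sub_ne_zero.2 hne)
    have h1 : ‖ζ - z‖ < ρ := by simpa [dist_eq_norm] using hζ
    have h2 := inv_sq_le_tailKernel (c := 1) hρ h0 (by linarith)
    have h3 := hN ζ hζ
    calc _ ≤ (N * ‖ζ - z‖ ^ g) * ((1 + 1) * tailKernel ρ ‖ζ - z‖) :=
          mul_le_mul h3 h2 (by positivity) ((norm_nonneg _).trans h3)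
      _ = _ := by ring

lemma integrableOn_sub_mul_beurlingKernel {u : ℂ → ℂ} {z : ℂ} {N ρ g : ℝ} (hu : Measurable u)
    (hg0 : 0 < g) (hg1 : g < 1) (hρ : 0 < ρ)
    (hN : ∀ ζ ∈ Metric.ball z ρ, ‖u ζ - u z‖ ≤ N * ‖ζ - z‖ ^ g) :
    IntegrableOn (fun ζ => (u ζ - u z) * beurlingKernel z ζ) (Metric.ball z ρ) := by
  refine Integrable.mono' (((integrable_radial hg0 hg1 hρ z).const_mul (2 * N)).integrableOn)
    ((hu.sub_const _).mul (measurable_beurlingKernel z)).aestronglyMeasurable ?_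
  filter_upwards [ae_restrict_mem measurableSet_ball] with ζ hζ
  exact norm_sub_mul_beurlingKernel_le hg0 hρ hN hζ

lemma norm_setIntegral_sub_mul_beurlingKernel_le {u : ℂ → ℂ} {z : ℂ} {N ρ g : ℝ}
    (hg0 : 0 < g) (hg1 : g < 1) (hρ : 0 < ρ) (hN0 : 0 ≤ N)
    (hN : ∀ ζ ∈ Metric.ball z ρ, ‖u ζ - u z‖ ≤ N * ‖ζ - z‖ ^ g) :
    ‖∫ ζ in Metric.ball z ρ, (u ζ - u z) * beurlingKernel z ζ‖ ≤
      (4 * Real.pi * radialConst g) * N * ρ ^ g := by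
  have hI := (integrable_radial hg0 hg1 hρ z).const_mul (2 * N)
  calc _ ≤ ∫ ζ in Metric.ball z ρ, (2 * N) * (‖ζ - z‖ ^ g * tailKernel ρ ‖ζ - z‖) := by
        refine norm_integral_le_of_norm_le hI.integrableOn ?_
        filter_upwards [ae_restrict_mem measurableSet_ball] with ζ hζ
        exact norm_sub_mul_beurlingKernel_le hg0 hρ hN hζ
    _ ≤ ∫ ζ, (2 * N) * (‖ζ - z‖ ^ g * tailKernel ρ ‖ζ - z‖) := by
        refine setIntegral_le_integral hI (Eventually.of_forall fun ζ => ?_)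
        have := tailKernel_nonneg hρ.le (norm_nonneg (ζ - z))
        simp only [Pi.zero_apply]; positivity
    _ = _ := by rw [integral_const_mul, integral_radial hρ]; ring

/-- If `u` is Hölder at `z`, the principal value exists and is given by an absolutely convergent
integral. -/
lemma beurling_eq_of_holder {u : ℂ → ℂ} {z : ℂ} {N ρ g : ℝ} (hu : Measurable u)
    (hintg : ∀ ε > 0, IntegrableOn (fun ζ => u ζ * beurlingKernel z ζ) (Metric.ball z ε)ᶜ)
    (hg0 : 0 < g) (hg1 : g < 1) (hρ : 0 < ρ) (hN0 : 0 ≤ N)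
    (hN : ∀ ζ ∈ Metric.ball z ρ, ‖u ζ - u z‖ ≤ N * ‖ζ - z‖ ^ g) :
    BeurlingExists u z ∧ beurling u z =
      (∫ ζ in Metric.ball z ρ, (u ζ - u z) * beurlingKernel z ζ) +
        ∫ ζ in (Metric.ball z ρ)ᶜ, u ζ * beurlingKernel z ζ := by
  have hsub := integrableOn_sub_mul_beurlingKernel hu hg0 hg1 hρ hN
  set L := (∫ ζ in Metric.ball z ρ, (u ζ - u z) * beurlingKernel z ζ) +
        ∫ ζ in (Metric.ball z ρ)ᶜ, u ζ * beurlingKernel z ζ with hL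
  -- On the annulus between `ε` and `ρ` the constant `u z` may be subtracted for free. What is
  -- missing from the limit is then an absolutely convergent integral over the small ball, of size
  -- `O(ε^g)`.
  have key : ∀ ε, 0 < ε → ε < ρ → truncBeurling u ε z =
      L - ∫ ζ in Metric.ball z ε, (u ζ - u z) * beurlingKernel z ζ := by
    intro ε hε hερ
    have hbb : Metric.ball z ε ⊆ Metric.ball z ρ := Metric.ball_subset_ball hερ.le
    have hdec : (Metric.ball z ε)ᶜ = (Metric.ball z ρ \ Metric.ball z ε) ∪ (Metric.ball z ρ)ᶜ := by
      ext ζ; constructor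
      · intro h
        by_cases h' : ζ ∈ Metric.ball z ρ
        · exact Or.inl ⟨h', h⟩
        · exact Or.inr h'
      · rintro (h | h)
        · exact h.2
        · exact fun h' => h (hbb h')
    have hdisj : Disjoint (Metric.ball z ρ \ Metric.ball z ε) (Metric.ball z ρ)ᶜ :=
      disjoint_left.2 fun ζ h h' => h' h.1
    have hA : IntegrableOn (fun ζ => u ζ * beurlingKernel z ζ)
        (Metric.ball z ρ \ Metric.ball z ε) :=
      (hintg ε hε).mono_set fun ζ h => h.2
    have hAs : IntegrableOn (fun ζ => (u ζ - u z) * beurlingKernel z ζ)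
        (Metric.ball z ρ \ Metric.ball z ε) := hsub.mono_set sdiff_subset
    have hAK : IntegrableOn (fun ζ => u z * beurlingKernel z ζ)
        (Metric.ball z ρ \ Metric.ball z ε) := by
      refine (hA.sub hAs).congr_fun (fun ζ _ => ?_) (measurableSet_ball.diff measurableSet_ball)
      simp only [Pi.sub_apply]; ring
    have h1 : ∫ ζ in Metric.ball z ρ \ Metric.ball z ε, u ζ * beurlingKernel z ζ =
        ∫ ζ in Metric.ball z ρ \ Metric.ball z ε, (u ζ - u z) * beurlingKernel z ζ := by
      have : ∀ ζ, u ζ * beurlingKernel z ζ =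
          (u ζ - u z) * beurlingKernel z ζ + u z * beurlingKernel z ζ := fun ζ => by ring
      simp only [this]
      rw [integral_add hAs hAK, integral_const_mul, setIntegral_beurlingKernel_annulus]
      simp
    unfold truncBeurling
    simp only [beurlingIntegrand_eq]
    rw [hdec, setIntegral_union hdisj measurableSet_ball.compl hA (hintg ρ hρ), h1,
      setIntegral_sdiff measurableSet_ball hsub hbb]
    rw [hL]; ring
  have htend : Tendsto (fun ε => truncBeurling u ε z) (𝓝[>] (0 : ℝ)) (𝓝 L) := by
    rw [tendsto_iff_norm_sub_tendsto_zero]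
    have hlim : Tendsto (fun ε : ℝ => (4 * Real.pi * radialConst g) * N * ε ^ g) (𝓝[>] (0 : ℝ))
        (𝓝 0) := by
      have : Tendsto (fun ε : ℝ => (4 * Real.pi * radialConst g) * N * ε ^ g) (𝓝 (0 : ℝ))
          (𝓝 ((4 * Real.pi * radialConst g) * N * 0 ^ g)) :=
        ((Real.continuous_rpow_const hg0.le).const_mul _).tendsto 0
      rw [Real.zero_rpow hg0.ne', mul_zero] at this
      exact this.mono_left nhdsWithin_le_nhds
    refine squeeze_zero' (Eventually.of_forall fun _ => norm_nonneg _) ?_ hlim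
    filter_upwards [Ioo_mem_nhdsGT hρ] with ε hε
    rw [key ε hε.1 hε.2, sub_sub_cancel_left, norm_neg]
    exact norm_setIntegral_sub_mul_beurlingKernel_le hg0 hg1 hε.1 hN0
      fun ζ hζ => hN ζ (Metric.ball_subset_ball hε.2.le hζ)
  have hlim : beurling u z = L := htend.limUnder_eq
  refine ⟨⟨fun ε hε => ?_, ?_⟩, hlim⟩
  · have := hintg ε hε
    exact this.congr_fun (fun ζ _ => (beurlingIntegrand_eq u z ζ).symm) measurableSet_ball.compl
  · rw [hlim]; exact htend

/-- Where `S` is at positive distance, no principal value is needed. -/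
lemma beurling_indicator_eq_of_disjoint {f : ℂ → ℂ} {S : Set ℂ} {z : ℂ} {ρ : ℝ}
    (hf : Measurable f) (hS : MeasurableSet S)
    (hintg : ∀ ε > 0, IntegrableOn (fun ζ => f ζ * beurlingKernel z ζ) (Metric.ball z ε)ᶜ)
    (hρ : 0 < ρ) (hd : Disjoint (Metric.ball z ρ) S) :
    BeurlingExists (S.indicator f) z ∧
      beurling (S.indicator f) z = ∫ ζ in S, f ζ * beurlingKernel z ζ := by
  have h0 : ∀ ζ ∈ Metric.ball z ρ, S.indicator f ζ = 0 := fun ζ hζ =>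
    indicator_of_notMem (disjoint_left.1 hd hζ) f
  have hz := h0 z (Metric.mem_ball_self hρ)
  have hmul : ∀ ζ, S.indicator f ζ * beurlingKernel z ζ =
      S.indicator (fun ζ => f ζ * beurlingKernel z ζ) ζ := fun ζ => by
    by_cases h : ζ ∈ S <;> simp [h]
  -- The density vanishes on the ball, so it is Hölder there with constant `0`; the exponent is
  -- arbitrary.
  obtain ⟨h1, h2⟩ := beurling_eq_of_holder (u := S.indicator f) (z := z) (N := 0) (g := 1 / 2)
    (hf.indicator hS)
    (fun ε hε => by
      simp only [hmul]
      exact (hintg ε hε).indicator hS)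
    (by norm_num) (by norm_num) hρ le_rfl
    (fun ζ hζ => by rw [h0 ζ hζ, hz]; simp)
  refine ⟨h1, ?_⟩
  rw [h2]
  have h3 : ∫ ζ in Metric.ball z ρ,
      (S.indicator f ζ - S.indicator f z) * beurlingKernel z ζ = 0 := by
    rw [setIntegral_congr_fun measurableSet_ball (g := fun _ => (0 : ℂ))
      (fun ζ hζ => by simp [h0 ζ hζ, hz])]
    simp
  rw [h3, zero_add]
  simp only [hmul]
  rw [setIntegral_indicator hS]
  congr 2
  ext ζ
  exact ⟨fun h => h.2, fun h => ⟨fun hb => disjoint_left.1 hd hb h, h⟩⟩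

/-! ### Hölder estimate on the whole plane -/

/-- Outside both balls this is the bound for kernel differences. In exactly one of the balls, the
surviving kernel is evaluated at a distance of at most `2‖z - w‖`, hence is at most `3` times the
majorant. -/
lemma norm_truncated_kernel_sub_le {z w : ℂ} (hr : 0 < ‖z - w‖) (ζ : ℂ) :
    ‖(Metric.ball z ‖z - w‖)ᶜ.indicator (beurlingKernel z) ζ -
      (Metric.ball w ‖z - w‖)ᶜ.indicator (beurlingKernel w) ζ‖ ≤
    4 * ((Metric.ball z ‖z - w‖)ᶜ.indicator (fun ζ => tailKernel ‖z - w‖ ‖ζ - z‖) ζ +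
      (Metric.ball w ‖z - w‖)ᶜ.indicator (fun ζ => tailKernel ‖z - w‖ ‖ζ - w‖) ζ) := by
  have hza := tailKernel_nonneg hr.le (norm_nonneg (ζ - z))
  have hwa := tailKernel_nonneg hr.le (norm_nonneg (ζ - w))
  have t1 : ‖ζ - w‖ ≤ ‖ζ - z‖ + ‖z - w‖ := by
    have := norm_add_le (ζ - z) (z - w); simpa using this
  have t2 : ‖ζ - z‖ ≤ ‖ζ - w‖ + ‖z - w‖ := by
    have := norm_add_le (ζ - w) (w - z); rw [norm_sub_rev w z] at this; simpa using this
  by_cases h1 : ζ ∈ Metric.ball z ‖z - w‖ <;> by_cases h2 : ζ ∈ Metric.ball w ‖z - w‖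
  · simp [h1, h2]
  · have h1' : ‖ζ - z‖ < ‖z - w‖ := by simpa [dist_eq_norm] using h1
    have h2' : ‖z - w‖ ≤ ‖ζ - w‖ := by simpa [dist_eq_norm] using h2
    have := inv_sq_le_tailKernel (c := 2) hr (hr.trans_le h2') (by linarith)
    simp only [mem_compl_iff, h1, h2, not_true_eq_false, not_false_eq_true,
      indicator_of_notMem, indicator_of_mem, zero_sub, norm_neg, norm_beurlingKernel, zero_add]
    linarith
  · have h2' : ‖ζ - w‖ < ‖z - w‖ := by simpa [dist_eq_norm] using h2
    have h1' : ‖z - w‖ ≤ ‖ζ - z‖ := by simpa [dist_eq_norm] using h1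
    have := inv_sq_le_tailKernel (c := 2) hr (hr.trans_le h1') (by linarith)
    simp only [mem_compl_iff, h1, h2, not_true_eq_false, not_false_eq_true,
      indicator_of_notMem, indicator_of_mem, sub_zero, norm_beurlingKernel, add_zero]
    linarith
  · have h1' : ‖z - w‖ ≤ ‖ζ - z‖ := by simpa [dist_eq_norm] using h1
    have h2' : ‖z - w‖ ≤ ‖ζ - w‖ := by simpa [dist_eq_norm] using h2
    simp only [mem_compl_iff, h1, h2, not_false_eq_true, indicator_of_mem]
    exact norm_beurlingKernel_sub_le (hr.trans_le h1') (hr.trans_le h2')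

/-- The reflection `ζ ↦ z + w - ζ` exchanges the two balls and the two kernels, so the integrand is
odd about the midpoint of `z` and `w`. -/
lemma integral_truncated_kernel_sub (z w : ℂ) (r : ℝ) :
    ∫ ζ, ((Metric.ball z r)ᶜ.indicator (beurlingKernel z) ζ -
      (Metric.ball w r)ᶜ.indicator (beurlingKernel w) ζ) = 0 := by
  have h := integral_rigid (z + w) (n := -1) (by simp) (fun ζ =>
    (Metric.ball z r)ᶜ.indicator (beurlingKernel z) ζ -
      (Metric.ball w r)ᶜ.indicator (beurlingKernel w) ζ)
  have key : ∀ z w ζ : ℂ, (Metric.ball z r)ᶜ.indicator (beurlingKernel z) (z + w + -1 * ζ) =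
      (Metric.ball w r)ᶜ.indicator (beurlingKernel w) ζ := by
    intro z w ζ
    have h1 : (z + w + -1 * ζ ∈ (Metric.ball z r)ᶜ) ↔ ζ ∈ (Metric.ball w r)ᶜ := by
      have : z + w + -1 * ζ - z = -(ζ - w) := by ring
      simp only [mem_compl_iff, Metric.mem_ball, dist_eq_norm, this, norm_neg]
    have h2 : beurlingKernel z (z + w + -1 * ζ) = beurlingKernel w ζ := by
      unfold beurlingKernel
      congr 1
      simp only [map_add, map_mul, map_neg, map_one]
      ring
    by_cases h3 : ζ ∈ (Metric.ball w r)ᶜ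
    · rw [indicator_of_mem h3, indicator_of_mem (h1.2 h3), h2]
    · rw [indicator_of_notMem h3, indicator_of_notMem (fun h4 => h3 (h1.1 h4))]
  have key2 : ∀ ζ, (Metric.ball w r)ᶜ.indicator (beurlingKernel w) (z + w + -1 * ζ) =
      (Metric.ball z r)ᶜ.indicator (beurlingKernel z) ζ := by
    intro ζ; rw [add_comm z w]; exact key w z ζ
  simp only [key, key2] at h
  have h' := integral_neg (μ := volume) (fun ζ =>
    (Metric.ball z r)ᶜ.indicator (beurlingKernel z) ζ -
      (Metric.ball w r)ᶜ.indicator (beurlingKernel w) ζ)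
  simp only [neg_sub] at h'
  rw [h] at h'
  have := congrArg (fun x => x / 2) (eq_neg_iff_add_eq_zero.1 h')
  simpa using this

lemma two_mul_rpow_le {g a : ℝ} (hg1 : g < 1) (ha : 0 ≤ a) :
    (2 * a) ^ g ≤ 2 * a ^ g := by
  rw [Real.mul_rpow (by norm_num) ha]
  gcongr
  exact (Real.rpow_le_rpow_of_exponent_le (by norm_num) hg1.le).trans (by simp)

/-- The constant in the Hölder estimate for the Beurling transform on the plane. -/
def planeConst (g : ℝ) : ℝ := 40 * Real.pi * radialConst g

/-- The Beurling transform of a Hölder function on the plane is Hölder. -/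
lemma norm_beurling_sub_le {f : ℂ → ℂ} {N g : ℝ} (hf : Measurable f)
    (hintg : ∀ z, ∀ ε > 0, IntegrableOn (fun ζ => f ζ * beurlingKernel z ζ) (Metric.ball z ε)ᶜ)
    (hg0 : 0 < g) (hg1 : g < 1) (hN0 : 0 ≤ N)
    (hN : ∀ x y, ‖f x - f y‖ ≤ N * ‖x - y‖ ^ g) (z w : ℂ) :
    ‖beurling f z - beurling f w‖ ≤ planeConst g * N * ‖z - w‖ ^ g := by
  rcases eq_or_ne z w with rfl | hne
  · simp [Real.zero_rpow hg0.ne']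
  have hr : 0 < ‖z - w‖ := norm_pos_iff.2 (sub_ne_zero.2 hne)
  set r := ‖z - w‖ with hrdef
  obtain ⟨-, hz⟩ := beurling_eq_of_holder hf (hintg z) hg0 hg1 hr hN0 (fun ζ _ => hN ζ z)
  obtain ⟨-, hw⟩ := beurling_eq_of_holder hf (hintg w) hg0 hg1 hr hN0 (fun ζ _ => hN ζ w)
  have bz := norm_setIntegral_sub_mul_beurlingKernel_le (u := f) (z := z) hg0 hg1 hr hN0
    (fun ζ _ => hN ζ z)
  have bw := norm_setIntegral_sub_mul_beurlingKernel_le (u := f) (z := w) hg0 hg1 hr hN0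
    (fun ζ _ => hN ζ w)
  set k : ℂ → ℂ := fun ζ => (Metric.ball z r)ᶜ.indicator (beurlingKernel z) ζ -
      (Metric.ball w r)ᶜ.indicator (beurlingKernel w) ζ with hk
  -- `f` is frozen at the midpoint: outside the ball about `c = z` or `c = w` one has `|ζ - m| ≤ 2|ζ
  -- - c|`, so the increment of `f` is controlled by either radial weight.
  set m := (z + w) / 2 with hm
  have iz : Integrable ((Metric.ball z r)ᶜ.indicator (fun ζ => f ζ * beurlingKernel z ζ)) :=
    (hintg z r hr).integrable_indicator measurableSet_ball.compl
  have iw : Integrable ((Metric.ball w r)ᶜ.indicator (fun ζ => f ζ * beurlingKernel w ζ)) :=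
    (hintg w r hr).integrable_indicator measurableSet_ball.compl
  have hfk : ∀ ζ, f ζ * k ζ = (Metric.ball z r)ᶜ.indicator (fun ζ => f ζ * beurlingKernel z ζ) ζ -
      (Metric.ball w r)ᶜ.indicator (fun ζ => f ζ * beurlingKernel w ζ) ζ := by
    intro ζ
    simp only [hk, indicator]
    split_ifs <;> ring
  have ifk : Integrable (fun ζ => f ζ * k ζ) := by
    simp only [hfk]; exact iz.sub iw
  have hfar : (∫ ζ in (Metric.ball z r)ᶜ, f ζ * beurlingKernel z ζ) -
      (∫ ζ in (Metric.ball w r)ᶜ, f ζ * beurlingKernel w ζ) = ∫ ζ, f ζ * k ζ := by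
    simp only [hfk]
    rw [integral_sub iz iw, integral_indicator measurableSet_ball.compl,
      integral_indicator measurableSet_ball.compl]
  have hkm : Measurable k :=
    ((measurable_beurlingKernel z).indicator measurableSet_ball.compl).sub
      ((measurable_beurlingKernel w).indicator measurableSet_ball.compl)
  have Iz := integrable_radial hg0 hg1 hr z
  have Iw := integrable_radial hg0 hg1 hr w
  have hind : ∀ c ζ : ℂ, ∀ M : ℝ, 0 ≤ M → (r ≤ ‖ζ - c‖ → M ≤ 2 * ‖ζ - c‖ ^ g) →
      M * (Metric.ball c r)ᶜ.indicator (fun ζ => tailKernel r ‖ζ - c‖) ζ ≤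
        2 * (‖ζ - c‖ ^ g * tailKernel r ‖ζ - c‖) := by
    intro c ζ M hM h
    have h0 := tailKernel_nonneg hr.le (norm_nonneg (ζ - c))
    by_cases h1 : ζ ∈ (Metric.ball c r)ᶜ
    · rw [indicator_of_mem h1]
      have h2 : r ≤ ‖ζ - c‖ := by simpa [dist_eq_norm] using h1
      have := mul_le_mul_of_nonneg_right (h h2) h0
      linarith
    · rw [indicator_of_notMem h1, mul_zero]; positivity
  have ik : Integrable k := by
    refine ((Iz.add Iw).const_mul (8 / r ^ g)).mono' hkm.aestronglyMeasurable
      (Eventually.of_forall fun ζ => ?_)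
    have hrg : 0 < r ^ g := Real.rpow_pos_of_pos hr g
    have h0 := norm_truncated_kernel_sub_le hr ζ
    have hb : ∀ c : ℂ, r ≤ ‖ζ - c‖ → r ^ g ≤ 2 * ‖ζ - c‖ ^ g := fun c hc => by
      have h1 : r ^ g ≤ ‖ζ - c‖ ^ g := by gcongr
      linarith [Real.rpow_nonneg (norm_nonneg (ζ - c)) g]
    have h1 := hind z ζ _ hrg.le (hb z)
    have h2 := hind w ζ _ hrg.le (hb w)
    rw [div_mul_eq_mul_div, le_div_iff₀ hrg]
    have h3 := mul_le_mul_of_nonneg_right h0 hrg.le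
    simp only [Pi.add_apply]
    linarith
  have hbound : ∀ ζ, ‖(f ζ - f m) * k ζ‖ ≤ (8 * N) * (‖ζ - z‖ ^ g * tailKernel r ‖ζ - z‖ +
      ‖ζ - w‖ ^ g * tailKernel r ‖ζ - w‖) := by
    intro ζ
    have h0 := norm_truncated_kernel_sub_le hr ζ
    have hmz : ‖z - m‖ = r / 2 := by
      rw [hm, show z - (z + w) / 2 = (z - w) / 2 by ring, norm_div]; simp [hrdef]
    have hmw : ‖w - m‖ = r / 2 := by
      rw [hm, show w - (z + w) / 2 = (w - z) / 2 by ring, norm_div, norm_sub_rev]; simp [hrdef]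
    have hb : ∀ c : ℂ, ‖c - m‖ = r / 2 → r ≤ ‖ζ - c‖ → ‖ζ - m‖ ^ g ≤ 2 * ‖ζ - c‖ ^ g := by
      intro c hc h
      refine le_trans ?_ (two_mul_rpow_le hg1 (norm_nonneg _))
      have : ‖ζ - m‖ ≤ ‖ζ - c‖ + ‖c - m‖ := by
        have := norm_add_le (ζ - c) (c - m); simpa using this
      have h5 : ‖ζ - m‖ ≤ 2 * ‖ζ - c‖ := by linarith
      gcongr
    have hnn : 0 ≤ ‖ζ - m‖ ^ g := by positivity
    have h1 := hind z ζ _ hnn (hb z hmz)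
    have h2 := hind w ζ _ hnn (hb w hmw)
    rw [norm_mul]
    calc ‖f ζ - f m‖ * ‖k ζ‖ ≤ (N * ‖ζ - m‖ ^ g) * (4 * (_ + _)) :=
          mul_le_mul (hN ζ m) h0 (norm_nonneg _) (by positivity)
      _ = (4 * N) * (‖ζ - m‖ ^ g * _ + ‖ζ - m‖ ^ g * _) := by ring
      _ ≤ (4 * N) * (2 * (‖ζ - z‖ ^ g * tailKernel r ‖ζ - z‖) +
          2 * (‖ζ - w‖ ^ g * tailKernel r ‖ζ - w‖)) :=
          mul_le_mul_of_nonneg_left (add_le_add h1 h2) (by positivity)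
      _ = _ := by ring
  have hsplit : ∫ ζ, f ζ * k ζ = ∫ ζ, (f ζ - f m) * k ζ := by
    have h1 : ∫ ζ, (f ζ - f m) * k ζ = (∫ ζ, f ζ * k ζ) - ∫ ζ, f m * k ζ := by
      rw [← integral_sub ifk (ik.const_mul _)]
      congr 1; ext ζ; ring
    rw [h1, integral_const_mul, integral_truncated_kernel_sub]
    simp
  have bfar : ‖∫ ζ, f ζ * k ζ‖ ≤ 32 * Real.pi * radialConst g * N * r ^ g := by
    rw [hsplit]
    refine (norm_integral_le_of_norm_le ((Iz.add Iw).const_mul (8 * N))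
      (Eventually.of_forall hbound)).trans (le_of_eq ?_)
    rw [integral_const_mul]
    simp only [Pi.add_apply]
    rw [integral_add Iz Iw, integral_radial hr, integral_radial hr]
    ring
  rw [hz, hw, add_sub_add_comm, hfar]
  refine (norm_add_le _ _).trans ?_
  have := norm_sub_le (∫ ζ in Metric.ball z r, (f ζ - f z) * beurlingKernel z ζ)
    (∫ ζ in Metric.ball w r, (f ζ - f w) * beurlingKernel w ζ)
  unfold planeConst
  linarith

/-- Difference estimate at points at distance at least `h` from the support. -/
lemma norm_setIntegral_kernel_sub_le_far {f : ℂ → ℂ} {S : Set ℂ} {N g h : ℝ}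
    (hS : MeasurableSet S) (hg0 : 0 < g) (hg1 : g < 1) (hN0 : 0 ≤ N) (hh : 0 < h)
    (hN : ∀ x, ‖f x‖ ≤ N) {z w : ℂ} (hz : Disjoint (Metric.ball z h) S)
    (hw : Disjoint (Metric.ball w h) S) :
    ‖∫ ζ in S, f ζ * (beurlingKernel z ζ - beurlingKernel w ζ)‖ ≤
      (16 * Real.pi * radialConst g / h ^ g) * N * ‖z - w‖ ^ g := by
  rcases eq_or_ne z w with rfl | hne
  · simp [Real.zero_rpow hg0.ne']
  have hr : 0 < ‖z - w‖ := norm_pos_iff.2 (sub_ne_zero.2 hne)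
  set r := ‖z - w‖ with hrdef
  have Iz := integrable_radial hg0 hg1 hr z
  have Iw := integrable_radial hg0 hg1 hr w
  have hhg : 0 < h ^ g := Real.rpow_pos_of_pos hh g
  have hI := (Iz.add Iw).const_mul (4 * N / h ^ g)
  have hdist : ∀ c : ℂ, Disjoint (Metric.ball c h) S → ∀ ζ ∈ S, h ≤ ‖ζ - c‖ := by
    intro c hc ζ hζ
    have := disjoint_right.1 hc hζ
    simpa [dist_eq_norm] using this
  calc _ ≤ ∫ ζ in S, (4 * N / h ^ g) * (‖ζ - z‖ ^ g * tailKernel r ‖ζ - z‖ +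
      ‖ζ - w‖ ^ g * tailKernel r ‖ζ - w‖) := by
        refine norm_integral_le_of_norm_le hI.integrableOn ?_
        filter_upwards [ae_restrict_mem hS] with ζ hζ
        have h1 := hdist z hz ζ hζ
        have h2 := hdist w hw ζ hζ
        have h3 := norm_beurlingKernel_sub_le (hh.trans_le h1) (hh.trans_le h2)
        have t1 := tailKernel_nonneg hr.le (norm_nonneg (ζ - z))
        have t2 := tailKernel_nonneg hr.le (norm_nonneg (ζ - w))
        -- On `S` the weight `(|ζ - c|/h)^g` is at least `1` for `c = z` and `c = w`; inserting it
        -- makes the majorant integrable without any smoothness of `f`.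
        have h4 : h ^ g ≤ ‖ζ - z‖ ^ g := by gcongr
        have h5 : h ^ g ≤ ‖ζ - w‖ ^ g := by gcongr
        rw [norm_mul, div_mul_eq_mul_div, le_div_iff₀ hhg]
        calc _ ≤ (N * (4 * (tailKernel r ‖ζ - z‖ + tailKernel r ‖ζ - w‖))) * h ^ g := by
              gcongr; exact hN ζ
          _ = 4 * N * (h ^ g * tailKernel r ‖ζ - z‖ + h ^ g * tailKernel r ‖ζ - w‖) := by ring
          _ ≤ _ := by gcongr
    _ ≤ ∫ ζ, (4 * N / h ^ g) * (‖ζ - z‖ ^ g * tailKernel r ‖ζ - z‖ +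
      ‖ζ - w‖ ^ g * tailKernel r ‖ζ - w‖) := by
        refine setIntegral_le_integral hI (Eventually.of_forall fun ζ => ?_)
        have t1 := tailKernel_nonneg hr.le (norm_nonneg (ζ - z))
        have t2 := tailKernel_nonneg hr.le (norm_nonneg (ζ - w))
        simp only [Pi.zero_apply]; positivity
    _ = _ := by
        rw [integral_const_mul, integral_add Iz Iw, integral_radial hr, integral_radial hr]
        ring

/-! ### The kernel on rectangles -/

/-- A primitive of `y ↦ beurlingKernel z (x + i y)`. -/
def kernelPrimitive (z : ℂ) (x y : ℝ) : ℂ := -Complex.I / (x - y * Complex.I - conj z)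

lemma conj_re_add_im (x y : ℝ) : conj ((x : ℂ) + y * Complex.I) = x - y * Complex.I := by
  simp [sub_eq_add_neg]

lemma sub_mul_I_sub_conj_ne_zero {z : ℂ} {x y : ℝ} (h : (x : ℂ) + y * Complex.I ≠ z) :
    (x : ℂ) - y * Complex.I - conj z ≠ 0 := by
  rw [← conj_re_add_im, sub_ne_zero]
  exact fun h' => h (star_injective h')

lemma hasDerivAt_kernelPrimitive {z : ℂ} {x y : ℝ} (h : (x : ℂ) + y * Complex.I ≠ z) :
    HasDerivAt (kernelPrimitive z x) (beurlingKernel z (x + y * Complex.I)) y := by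
  have h0 := sub_mul_I_sub_conj_ne_zero h
  have h1 : HasDerivAt (fun y : ℝ => (x : ℂ) - y * Complex.I - conj z) (-Complex.I) y := by
    have h2 : HasDerivAt (fun y : ℝ => (y : ℂ)) 1 y := Complex.ofRealCLM.hasDerivAt
    have := ((h2.mul_const Complex.I).const_sub (x : ℂ)).sub_const (conj z)
    simpa using this
  have h3 := (hasDerivAt_const y (-Complex.I)).div h1 h0
  refine h3.congr_deriv ?_
  rw [beurlingKernel, conj_re_add_im]
  congr 1
  simp

lemma setIntegral_reProdIm (F : ℂ → ℂ) (s t : Set ℝ) :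
    ∫ ζ in s ×ℂ t, F ζ = ∫ q in s ×ˢ t, F (q.1 + q.2 * Complex.I) := by
  have h := Complex.volume_preserving_equiv_real_prod.symm.setIntegral_preimage_emb
    Complex.measurableEquivRealProd.symm.measurableEmbedding F (s ×ℂ t)
  rw [← h]
  have h2 : (Complex.measurableEquivRealProd.symm : ℝ × ℝ → ℂ) ⁻¹' (s ×ℂ t) = s ×ˢ t := by
    ext q; simp [Complex.mem_reProdIm]
  rw [h2]
  refine integral_congr_ae (Eventually.of_forall fun q => ?_)
  simp only [Complex.measurableEquivRealProd_symm_apply]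
  rw [Complex.mk_eq_add_mul_I]

lemma setIntegral_rect_beurlingKernel {z : ℂ} {a b c d : ℝ} (hab : a ≤ b) (hcd : c ≤ d)
    (h : ∀ x ∈ Icc a b, ∀ y ∈ Icc c d, (x : ℂ) + y * Complex.I ≠ z) :
    ∫ ζ in Ioc a b ×ℂ Ioc c d, beurlingKernel z ζ =
      ∫ x in a..b, (kernelPrimitive z x d - kernelPrimitive z x c) := by
  have hcont : ContinuousOn (fun q : ℝ × ℝ => beurlingKernel z (q.1 + q.2 * Complex.I))
      (Icc a b ×ˢ Icc c d) := by
    unfold beurlingKernel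
    refine ContinuousOn.div continuousOn_const (Continuous.continuousOn ?_) fun q hq => ?_
    · have := Complex.continuous_conj
      fun_prop
    · rw [conj_re_add_im]
      exact pow_ne_zero 2 (sub_mul_I_sub_conj_ne_zero (h q.1 hq.1 q.2 hq.2))
  have hintg : IntegrableOn (fun q : ℝ × ℝ => beurlingKernel z (q.1 + q.2 * Complex.I))
      (Ioc a b ×ˢ Ioc c d) (volume.prod volume) :=
    (hcont.integrableOn_compact (isCompact_Icc.prod isCompact_Icc)).mono_set
      (prod_mono Ioc_subset_Icc_self Ioc_subset_Icc_self)
  rw [setIntegral_reProdIm, Measure.volume_eq_prod, setIntegral_prod _ hintg,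
    intervalIntegral.integral_of_le hab]
  refine setIntegral_congr_fun measurableSet_Ioc fun x hx => ?_
  have hx' := Ioc_subset_Icc_self hx
  simp only
  rw [← intervalIntegral.integral_of_le hcd]
  refine intervalIntegral.integral_eq_sub_of_hasDerivAt (fun y hy => ?_) ?_
  · rw [uIcc_of_le hcd] at hy
    exact hasDerivAt_kernelPrimitive (h x hx' y hy)
  · refine ContinuousOn.intervalIntegrable ?_
    rw [uIcc_of_le hcd]
    exact hcont.comp (f := fun y : ℝ => (x, y)) (by fun_prop) fun y hy => ⟨hx', hy⟩

lemma measurableSet_reProdIm {s t : Set ℝ} (hs : MeasurableSet s) (ht : MeasurableSet t) :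
    MeasurableSet (s ×ℂ t) :=
  (Complex.measurable_re hs).inter (Complex.measurable_im ht)

/-! ### The model rectangle: Lipschitz bound and jump at the flat side. -/

/-- The model rectangle `(0, 1] × (-1, 1]`, tangent to the imaginary axis at the origin. -/
def unitRect : Set ℂ := Ioc 0 1 ×ℂ Ioc (-1) 1

lemma measurableSet_unitRect : MeasurableSet unitRect :=
  measurableSet_reProdIm measurableSet_Ioc measurableSet_Ioc

lemma mem_unitRect {ξ : ℂ} : ξ ∈ unitRect ↔ (0 < ξ.re ∧ ξ.re ≤ 1) ∧ -1 < ξ.im ∧ ξ.im ≤ 1 := by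
  simp [unitRect, Complex.mem_reProdIm]

lemma half_le_norm_primitive_denom {z : ℂ} (hz : ‖z‖ ≤ 1 / 2) (x : ℝ) {y : ℝ} (hy : |y| = 1) :
    1 / 2 ≤ ‖(x : ℂ) - y * Complex.I - conj z‖ := by
  have h1 := Complex.abs_im_le_norm ((x : ℂ) - y * Complex.I - conj z)
  have h2 : ((x : ℂ) - y * Complex.I - conj z).im = -y + z.im := by simp
  rw [h2] at h1
  have h3 := Complex.abs_im_le_norm z
  have h4 : |y| ≤ |-y + z.im| + |z.im| := by
    have := abs_sub (-y + z.im) z.im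
    simpa using this
  linarith

lemma norm_kernelPrimitive_sub_le {z w : ℂ} (hz : ‖z‖ ≤ 1 / 2) (hw : ‖w‖ ≤ 1 / 2) (x : ℝ)
    {y : ℝ} (hy : |y| = 1) :
    ‖kernelPrimitive z x y - kernelPrimitive w x y‖ ≤ 4 * ‖z - w‖ := by
  have h1 := half_le_norm_primitive_denom hz x hy
  have h2 := half_le_norm_primitive_denom hw x hy
  have h1' : (x : ℂ) - y * Complex.I - conj z ≠ 0 := by
    rw [← norm_pos_iff]; linarith
  have h2' : (x : ℂ) - y * Complex.I - conj w ≠ 0 := by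
    rw [← norm_pos_iff]; linarith
  unfold kernelPrimitive
  rw [div_sub_div _ _ h1' h2', norm_div, norm_mul]
  have h3 : -Complex.I * ((x : ℂ) - y * Complex.I - conj w) -
      ((x : ℂ) - y * Complex.I - conj z) * -Complex.I = -Complex.I * (conj z - conj w) := by ring
  rw [h3, norm_mul, norm_neg, Complex.norm_I, one_mul, norm_conj_sub_conj,
    div_le_iff₀ (by positivity)]
  have h4 : 1 / 4 ≤ ‖(x : ℂ) - y * Complex.I - conj z‖ * ‖(x : ℂ) - y * Complex.I - conj w‖ := by
    nlinarith
  nlinarith [norm_nonneg (z - w)]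

lemma continuous_kernelPrimitive_of_abs_eq_one {z : ℂ} (hz : ‖z‖ ≤ 1 / 2) {y : ℝ}
    (hy : |y| = 1) : Continuous (fun x : ℝ => kernelPrimitive z x y) := by
  unfold kernelPrimitive
  refine Continuous.div continuous_const (by fun_prop) fun x => ?_
  have := half_le_norm_primitive_denom hz x hy
  rw [← norm_pos_iff]; linarith

lemma norm_integral_primitive_sub_le {z w : ℂ} (hz : ‖z‖ ≤ 1 / 2) (hw : ‖w‖ ≤ 1 / 2) :
    ‖(∫ x in (0 : ℝ)..1, (kernelPrimitive z x 1 - kernelPrimitive z x (-1))) -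
      ∫ x in (0 : ℝ)..1, (kernelPrimitive w x 1 - kernelPrimitive w x (-1))‖ ≤
      8 * ‖z - w‖ := by
  have hc : ∀ v : ℂ, ‖v‖ ≤ 1 / 2 → IntervalIntegrable
      (fun x : ℝ => kernelPrimitive v x 1 - kernelPrimitive v x (-1)) volume 0 1 := fun v hv =>
    ((continuous_kernelPrimitive_of_abs_eq_one hv (by simp)).sub
      (continuous_kernelPrimitive_of_abs_eq_one hv (by simp))).intervalIntegrable _ _
  rw [← intervalIntegral.integral_sub (hc z hz) (hc w hw)]
  refine (intervalIntegral.norm_integral_le_of_norm_le_const (C := 8 * ‖z - w‖)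
    fun x _ => ?_).trans (by simp)
  have h1 := norm_kernelPrimitive_sub_le hz hw x (y := 1) (by simp)
  have h2 := norm_kernelPrimitive_sub_le hz hw x (y := -1) (by simp)
  rw [sub_sub_sub_comm]
  exact (norm_sub_le _ _).trans (by linarith)

/-- Integrating first along the flat side leaves only the edges `Im = ±1`. For `|z| ≤ 1/2` these
stay at distance at least `1/2`, so the right-hand side makes sense and is Lipschitz across the flat
side too. It is the smooth part common to both sides. -/
lemma setIntegral_unitRect_beurlingKernel {z : ℂ} (hz : z.re < 0) :
    ∫ ζ in unitRect, beurlingKernel z ζ =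
      ∫ x in (0 : ℝ)..1, (kernelPrimitive z x 1 - kernelPrimitive z x (-1)) := by
  refine setIntegral_rect_beurlingKernel zero_le_one (by norm_num) fun x hx y _ h => ?_
  have := congrArg Complex.re h
  simp at this
  linarith [hx.1]

lemma integrableOn_beurlingKernel {z : ℂ} {h : ℝ} {E : Set ℂ} (hE : MeasurableSet E)
    (hEb : Bornology.IsBounded E) (hh : 0 < h) (hd : Disjoint (Metric.ball z h) E) :
    IntegrableOn (beurlingKernel z) E := by
  refine Measure.integrableOn_of_bounded (M := 1 / h ^ 2) hEb.measure_lt_top.ne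
    (measurable_beurlingKernel z).aestronglyMeasurable ?_
  filter_upwards [ae_restrict_mem hE] with ζ hζ
  have h1 : h ≤ ‖ζ - z‖ := by simpa [dist_eq_norm] using disjoint_right.1 hd hζ
  rw [norm_beurlingKernel]
  gcongr

lemma isBounded_unitRect : Bornology.IsBounded unitRect :=
  (Metric.isBounded_Ioc 0 1).reProdIm (Metric.isBounded_Ioc (-1) 1)

lemma reProdIm_ae_eq {s s' t t' : Set ℝ} (hs : s =ᵐ[volume] s') (ht : t =ᵐ[volume] t') :
    (s ×ℂ t : Set ℂ) =ᵐ[volume] (s' ×ℂ t' : Set ℂ) := by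
  have h := Measure.set_prod_ae_eq hs ht
  exact Complex.volume_preserving_equiv_real_prod.quasiMeasurePreserving.preimage_ae_eq h

lemma kernelPrimitive_sub_eq {t : ℝ} (ht : 0 < t) (x : ℝ) :
    kernelPrimitive t x t - kernelPrimitive t x (-t) =
      ((2 * t / ((x - t) ^ 2 + t ^ 2) : ℝ) : ℂ) := by
  have h1 : (x : ℂ) - t * Complex.I - t ≠ 0 := by
    intro h; have := congrArg Complex.im h; simp at this; exact ht.ne' this
  have h2 : (x : ℂ) - (-t) * Complex.I - t ≠ 0 := by
    intro h; have := congrArg Complex.im h; simp at this; exact ht.ne' this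
  have h3 : (((x - t) ^ 2 + t ^ 2 : ℝ) : ℂ) =
      ((x : ℂ) - t * Complex.I - t) * ((x : ℂ) - (-t) * Complex.I - t) := by
    push_cast
    linear_combination ((t : ℂ) ^ 2) * Complex.I_sq
  unfold kernelPrimitive
  rw [Complex.ofReal_div, h3, Complex.conj_ofReal, Complex.ofReal_neg, div_sub_div _ _ h1 h2]
  congr 1
  push_cast
  linear_combination (-2 * (t : ℂ)) * Complex.I_sq

/-- This is the source of the constant `π`: the primitive is `2 arctan((x - t)/t)`, which runs from
`-π/2` to `π/2`, independently of `t`. -/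
lemma integral_kernelPrimitive_sub_eq {t : ℝ} (ht : 0 < t) :
    ∫ x in (0 : ℝ)..(2 * t), (kernelPrimitive t x t - kernelPrimitive t x (-t)) = Real.pi := by
  simp only [kernelPrimitive_sub_eq ht]
  rw [intervalIntegral.integral_ofReal]
  congr 1
  have hd : ∀ x : ℝ, HasDerivAt (fun x => 2 * Real.arctan ((x - t) / t))
      (2 * t / ((x - t) ^ 2 + t ^ 2)) x := by
    intro x
    have h1 : HasDerivAt (fun x : ℝ => (x - t) / t) (1 / t) x :=
      ((hasDerivAt_id x).sub_const t).div_const t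
    refine (h1.arctan.const_mul 2).congr_deriv ?_
    have : (x - t) ^ 2 + t ^ 2 ≠ 0 := by positivity
    have h2 : 1 + ((x - t) / t) ^ 2 ≠ 0 := by positivity
    field_simp
    ring
  rw [intervalIntegral.integral_eq_sub_of_hasDerivAt (fun x _ => hd x)]
  · have h1 : (2 * t - t) / t = 1 := by field_simp; ring
    have h2 : (0 - t) / t = -1 := by field_simp; ring
    rw [h1, h2, Real.arctan_neg, Real.arctan_one]; ring
  · refine Continuous.intervalIntegrable ?_ _ _
    refine Continuous.div (by fun_prop) (by fun_prop) fun x => ?_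
    positivity

/-- The jump of the Beurling transform of the model rectangle at the origin. -/
lemma norm_setIntegral_unitRect_jump {t : ℝ} (ht : 0 < t) (ht4 : t ≤ 1 / 4) :
    ‖(∫ ξ in unitRect, ((Metric.ball (t : ℂ) (t / 2))ᶜ.indicator (beurlingKernel t) ξ -
      beurlingKernel (-t) ξ)) + Real.pi‖ ≤ 16 * t := by
  set B := Metric.ball (t : ℂ) (t / 2) with hB
  have hBm : MeasurableSet B := measurableSet_ball
  have hnt : ‖(t : ℂ)‖ ≤ 1 / 2 := by
    rw [Complex.norm_real, Real.norm_of_nonneg ht.le]; linarith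
  have hnt' : ‖(-t : ℂ)‖ ≤ 1 / 2 := by rwa [norm_neg]
  have hBre : ∀ ξ ∈ B, |ξ.re - t| < t / 2 ∧ |ξ.im| < t / 2 := by
    intro ξ hξ
    have h0 : ‖ξ - t‖ < t / 2 := by simpa [hB, dist_eq_norm] using hξ
    have h1 := (Complex.abs_re_le_norm (ξ - t)).trans_lt h0
    have h2 := (Complex.abs_im_le_norm (ξ - t)).trans_lt h0
    simp at h1 h2
    exact ⟨h1, h2⟩
  set Q₁ : Set ℂ := Ioc 0 1 ×ℂ Ioc t 1 with hQ₁
  set Q₂ : Set ℂ := Ioc 0 1 ×ℂ Ioc (-1) (-t) with hQ₂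
  set Q₃ : Set ℂ := Ioc (2 * t) 1 ×ℂ Ioc (-t) t with hQ₃
  set Q₄ : Set ℂ := Ioc 0 (2 * t) ×ℂ Ioc (-t) t with hQ₄
  have m₁ : MeasurableSet Q₁ := measurableSet_reProdIm measurableSet_Ioc measurableSet_Ioc
  have m₂ : MeasurableSet Q₂ := measurableSet_reProdIm measurableSet_Ioc measurableSet_Ioc
  have m₃ : MeasurableSet Q₃ := measurableSet_reProdIm measurableSet_Ioc measurableSet_Ioc
  have m₄ : MeasurableSet Q₄ := measurableSet_reProdIm measurableSet_Ioc measurableSet_Ioc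
  -- `Q₄` is a square centred at the singularity `t`, so with `B` removed it contributes nothing.
  -- The other three rectangles avoid `t` and can be integrated by the primitive.
  have hdec : unitRect ∩ Bᶜ = ((Q₁ ∪ Q₂) ∪ Q₃) ∪ (Q₄ \ B) := by
    ext ξ
    simp only [mem_inter_iff, mem_unitRect, mem_compl_iff, mem_union, hQ₁, hQ₂, hQ₃, hQ₄,
      Complex.mem_reProdIm, mem_Ioc, Set.mem_sdiff]
    have := hBre ξ
    by_cases hξ : ξ ∈ B
    · obtain ⟨h1, h2⟩ := this hξ
      rw [abs_lt] at h1 h2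
      simp only [hξ, not_true_eq_false, and_false, or_false, false_iff]
      rintro ((h | h) | h) <;> linarith [h.1.1, h.1.2, h.2.1, h.2.2]
    · simp only [hξ, not_false_eq_true, and_true]
      constructor
      · rintro ⟨⟨h1, h2⟩, h3, h4⟩
        rcases lt_or_ge t ξ.im with h5 | h5
        · exact Or.inl (Or.inl (Or.inl ⟨⟨h1, h2⟩, h5, h4⟩))
        rcases le_or_gt ξ.im (-t) with h6 | h6
        · exact Or.inl (Or.inl (Or.inr ⟨⟨h1, h2⟩, h3, h6⟩))
        rcases lt_or_ge (2 * t) ξ.re with h7 | h7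
        · exact Or.inl (Or.inr ⟨⟨h7, h2⟩, h6, h5⟩)
        · exact Or.inr ⟨⟨h1, h7⟩, h6, h5⟩
      · rintro (((h | h) | h) | h) <;> obtain ⟨⟨h1, h2⟩, h3, h4⟩ := h <;>
          exact ⟨⟨by linarith, by linarith⟩, by linarith, by linarith⟩
  have hintg : IntegrableOn (beurlingKernel t) (unitRect ∩ Bᶜ) :=
    integrableOn_beurlingKernel (measurableSet_unitRect.inter hBm.compl)
      (isBounded_unitRect.subset inter_subset_left) (half_pos ht)
      (disjoint_left.2 fun ξ h h' => h'.2 h)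
  have hintg' : IntegrableOn (beurlingKernel (-t)) unitRect := by
    refine integrableOn_beurlingKernel measurableSet_unitRect isBounded_unitRect ht
      (disjoint_left.2 fun ξ h h' => ?_)
    have h0 : ‖ξ - (-t)‖ < t := by simpa [dist_eq_norm] using h
    have h1 := (Complex.abs_re_le_norm (ξ - (-t))).trans_lt h0
    have h2 := (mem_unitRect.1 h').1.1
    simp at h1
    rw [abs_lt] at h1
    linarith [h1.2]
  have i₁ : IntegrableOn (beurlingKernel t) Q₁ := hintg.mono_set (by rw [hdec]; intro ξ h; simp [h])
  have i₂ : IntegrableOn (beurlingKernel t) Q₂ := hintg.mono_set (by rw [hdec]; intro ξ h; simp [h])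
  have i₃ : IntegrableOn (beurlingKernel t) Q₃ := hintg.mono_set (by rw [hdec]; intro ξ h; simp [h])
  have i₄ : IntegrableOn (beurlingKernel t) (Q₄ \ B) :=
    hintg.mono_set (by rw [hdec]; exact subset_union_right)
  have d₁ : Disjoint Q₁ Q₂ := disjoint_left.2 fun ξ h h' => by
    simp only [hQ₁, hQ₂, Complex.mem_reProdIm, mem_Ioc] at h h'
    linarith [h.2.1, h'.2.2]
  have d₂ : Disjoint (Q₁ ∪ Q₂) Q₃ := disjoint_left.2 fun ξ h h' => by
    simp only [hQ₁, hQ₂, hQ₃, Complex.mem_reProdIm, mem_Ioc, mem_union] at h h'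
    rcases h with h | h <;> linarith [h.2.1, h.2.2, h'.2.2, h'.2.1]
  have d₃ : Disjoint ((Q₁ ∪ Q₂) ∪ Q₃) (Q₄ \ B) := disjoint_left.2 fun ξ h h' => by
    simp only [hQ₁, hQ₂, hQ₃, hQ₄, Complex.mem_reProdIm, mem_Ioc, mem_union, Set.mem_sdiff] at h h'
    obtain ⟨h', -⟩ := h'
    rcases h with (h | h) | h <;> linarith [h.1.1, h.2.1, h.2.2, h'.1.2, h'.2.2, h'.2.1]
  have z₄ : ∫ ξ in Q₄ \ B, beurlingKernel t ξ = 0 := by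
    -- The half-open square is not invariant under the quarter turn; the open one is.
    have h1 : (Q₄ \ B : Set ℂ) =ᵐ[volume] ((Ioo 0 (2 * t) ×ℂ Ioo (-t) t) \ B : Set ℂ) :=
      ae_eq_set_sdiff (reProdIm_ae_eq Ioo_ae_eq_Ioc.symm Ioo_ae_eq_Ioc.symm) (ae_eq_refl _)
    rw [setIntegral_congr_set h1]
    refine setIntegral_beurlingKernel_eq_zero fun ξ => ?_
    have hb : ((t : ℂ) + Complex.I * ξ ∈ B) ↔ ((t : ℂ) + ξ ∈ B) := by
      simp [hB]
    simp only [Set.mem_sdiff, hb, Complex.mem_reProdIm, mem_Ioo]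
    simp only [Complex.add_re, Complex.ofReal_re, Complex.mul_re, Complex.I_re, Complex.I_im,
      Complex.add_im, Complex.ofReal_im, Complex.mul_im, zero_mul, one_mul, zero_sub, zero_add]
    refine and_congr_left fun _ => ?_
    constructor <;> rintro ⟨⟨h1, h2⟩, h3, h4⟩ <;>
      exact ⟨⟨by linarith, by linarith⟩, by linarith, by linarith⟩
  have hne : ∀ x y : ℝ, (x - t ≠ 0 ∨ y ≠ 0) → (x : ℂ) + y * Complex.I ≠ (t : ℂ) := by
    intro x y h h'
    have h1 := congrArg Complex.re h'
    have h2 := congrArg Complex.im h'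
    simp at h1 h2
    rcases h with h | h
    · exact h (by linarith)
    · exact h h2
  have e₁ := setIntegral_rect_beurlingKernel (z := (t : ℂ)) (a := 0) (b := 1) (c := t) (d := 1)
    zero_le_one (by linarith) (fun x _ y hy => hne x y (Or.inr (by linarith [hy.1])))
  have e₂ := setIntegral_rect_beurlingKernel (z := (t : ℂ)) (a := 0) (b := 1) (c := -1) (d := -t)
    zero_le_one (by linarith) (fun x _ y hy => hne x y (Or.inr (by linarith [hy.2])))
  have e₃ := setIntegral_rect_beurlingKernel (z := (t : ℂ)) (a := 2 * t) (b := 1) (c := -t)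
    (d := t) (by linarith) (by linarith)
    (fun x hx y _ => hne x y (Or.inl (by linarith [hx.1])))
  have c1 : ∀ a b : ℝ, IntervalIntegrable (fun x => kernelPrimitive t x 1) volume a b :=
    fun a b => (continuous_kernelPrimitive_of_abs_eq_one hnt (by simp)).intervalIntegrable a b
  have c2 : ∀ a b : ℝ, IntervalIntegrable (fun x => kernelPrimitive t x (-1)) volume a b :=
    fun a b => (continuous_kernelPrimitive_of_abs_eq_one hnt (by simp)).intervalIntegrable a b
  have hct : ∀ y : ℝ, y ≠ 0 → Continuous (fun x : ℝ => kernelPrimitive t x y) := by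
    intro y hy
    unfold kernelPrimitive
    exact Continuous.div continuous_const (by fun_prop) fun x =>
      sub_mul_I_sub_conj_ne_zero (hne x y (Or.inr hy))
  have c3 : ∀ a b : ℝ, IntervalIntegrable (fun x => kernelPrimitive t x t) volume a b :=
    fun a b => (hct t ht.ne').intervalIntegrable a b
  have c4 : ∀ a b : ℝ, IntervalIntegrable (fun x => kernelPrimitive t x (-t)) volume a b :=
    fun a b => (hct (-t) (by linarith)).intervalIntegrable a b
  -- The edge terms on `Im = ±t` cancel for `x > 2t`. What survives is the edge integral over `[0,
  -- 2t]`, which equals `π`.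
  have hsum : ∫ ξ in unitRect ∩ Bᶜ, beurlingKernel t ξ =
      (∫ x in (0 : ℝ)..1, (kernelPrimitive t x 1 - kernelPrimitive t x (-1))) - Real.pi := by
    rw [hdec, setIntegral_union d₃ (m₄.diff hBm) ((i₁.union i₂).union i₃) i₄,
      setIntegral_union d₂ m₃ (i₁.union i₂) i₃, setIntegral_union d₁ m₂ i₁ i₂, z₄, e₁, e₂, e₃,
      ← integral_kernelPrimitive_sub_eq ht]
    have h1 := intervalIntegral.integral_add_adjacent_intervals (c3 0 (2 * t)) (c3 (2 * t) 1)
    have h2 := intervalIntegral.integral_add_adjacent_intervals (c4 0 (2 * t)) (c4 (2 * t) 1)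
    rw [intervalIntegral.integral_sub (c1 _ _) (c3 _ _),
      intervalIntegral.integral_sub (c4 _ _) (c2 _ _),
      intervalIntegral.integral_sub (c3 _ _) (c4 _ _),
      intervalIntegral.integral_sub (c1 _ _) (c2 _ _),
      intervalIntegral.integral_sub (c3 _ _) (c4 _ _), ← h1, ← h2]
    ring
  have hneg : ∫ ξ in unitRect, beurlingKernel (-t) ξ =
      ∫ x in (0 : ℝ)..1, (kernelPrimitive (-t) x 1 - kernelPrimitive (-t) x (-1)) :=
    setIntegral_unitRect_beurlingKernel (by simpa using ht)
  have hind : IntegrableOn (Bᶜ.indicator (beurlingKernel t)) unitRect := by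
    rw [integrableOn_indicator_iff hBm.compl, inter_comm]; exact hintg
  rw [integral_sub hind hintg', setIntegral_indicator hBm.compl, hsum, hneg]
  have h := norm_integral_primitive_sub_le hnt hnt'
  have h2 : ‖(t : ℂ) - -t‖ = 2 * t := by
    rw [show (t : ℂ) - -t = ((2 * t : ℝ) : ℂ) by push_cast; ring, Complex.norm_real,
      Real.norm_of_nonneg (by linarith)]
  rw [h2] at h
  refine le_trans (le_of_eq ?_) (h.trans (by linarith))
  congr 1
  ring

/-! ### Flat boundary points -/

/-- Within distance `s` of `p`, the set `S` agrees with the half-plane through `p` with inner unit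
normal `n`, up to an error of size `A ‖ζ - p‖^(1+g)`. -/
structure IsFlatAt (g A s : ℝ) (S : Set ℂ) (p n : ℂ) : Prop where
  norm_eq : ‖n‖ = 1
  mem : ∀ ζ, ‖ζ - p‖ ≤ s → A * ‖ζ - p‖ ^ (1 + g) < (conj n * (ζ - p)).re → ζ ∈ S
  notMem : ∀ ζ, ‖ζ - p‖ ≤ s → A * ‖ζ - p‖ ^ (1 + g) < -(conj n * (ζ - p)).re → ζ ∉ S

lemma IsFlatAt.compl {g A s : ℝ} {S : Set ℂ} {p n : ℂ} (h : IsFlatAt g A s S p n) :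
    IsFlatAt g A s Sᶜ p (-n) where
  norm_eq := by rw [norm_neg, h.norm_eq]
  mem ζ h1 h2 := h.notMem ζ h1 (by simpa using h2)
  notMem ζ h1 h2 := fun h3 => h3 (h.mem ζ h1 (by simpa using h2))

/-- Admissible flatness parameters. -/
structure FlatParams (g A s : ℝ) : Prop where
  g_pos : 0 < g
  g_lt : g < 1
  A_nonneg : 0 ≤ A
  s_pos : 0 < s
  s_le : s ≤ 1 / 2
  small : A * s ^ g ≤ 1 / 16

lemma FlatParams.mul_rpow_le {g A s ρ : ℝ} (h : FlatParams g A s) (h0 : 0 ≤ ρ) (hs : ρ ≤ s) :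
    A * ρ ^ (1 + g) ≤ ρ / 16 := by
  have hA := h.A_nonneg
  have hg := h.g_pos
  rcases h0.eq_or_lt with rfl | h1
  · rw [Real.zero_rpow (by linarith)]; simp
  rw [Real.rpow_add h1, Real.rpow_one]
  have h2 : A * ρ ^ g ≤ 1 / 16 := le_trans (by gcongr) h.small
  nlinarith

lemma norm_conj_mul {n : ℂ} (hn : ‖n‖ = 1) (v : ℂ) : ‖conj n * v‖ = ‖v‖ := by
  rw [norm_mul, RCLike.norm_conj, hn, one_mul]

/-- The unit rectangle tangent at `p` to the line orthogonal to `n`. -/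
def tangentRect (p n : ℂ) : Set ℂ := {ζ | conj n * (ζ - p) ∈ unitRect}

lemma measurableSet_tangentRect (p n : ℂ) : MeasurableSet (tangentRect p n) :=
  measurableSet_unitRect.preimage (by fun_prop)

lemma conj_mul_rigid_sub {n : ℂ} (hn : ‖n‖ = 1) (p ξ : ℂ) : conj n * (p + n * ξ - p) = ξ := by
  rw [add_sub_cancel_left, ← mul_assoc, conj_mul_self_of_norm_one hn, one_mul]

lemma rigid_conj_mul_sub {n : ℂ} (hn : ‖n‖ = 1) (p z : ℂ) : p + n * (conj n * (z - p)) = z := by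
  rw [← mul_assoc, mul_comm n, conj_mul_self_of_norm_one hn, one_mul, add_sub_cancel]

lemma preimage_tangentRect {n : ℂ} (hn : ‖n‖ = 1) (p : ℂ) :
    (fun ξ : ℂ => p + n * ξ) ⁻¹' tangentRect p n = unitRect := by
  ext ξ
  simp only [mem_preimage, tangentRect, mem_ofPred_eq, conj_mul_rigid_sub hn]

lemma setIntegral_tangentRect {n : ℂ} (hn : ‖n‖ = 1) (p : ℂ) (F : ℂ → ℂ) :
    ∫ ζ in tangentRect p n, F ζ = ∫ ξ in unitRect, F (p + n * ξ) := by
  rw [← setIntegral_rigid p hn, preimage_tangentRect hn]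

lemma setIntegral_tangentRect_beurlingKernel {n : ℂ} (hn : ‖n‖ = 1) (p z : ℂ) :
    ∫ ζ in tangentRect p n, beurlingKernel z ζ =
      n ^ 2 * ∫ ξ in unitRect, beurlingKernel (conj n * (z - p)) ξ := by
  rw [setIntegral_tangentRect hn, ← integral_const_mul]
  congr 1; ext ξ
  rw [← beurlingKernel_rigid p hn, rigid_conj_mul_sub hn]

lemma isBounded_tangentRect {n : ℂ} (hn : ‖n‖ = 1) (p : ℂ) :
    Bornology.IsBounded (tangentRect p n) := by
  refine (Metric.isBounded_ball (x := p) (r := 3)).subset fun ζ hζ => ?_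
  have h := mem_unitRect.1 hζ
  rw [Metric.mem_ball, dist_eq_norm, ← norm_conj_mul hn]
  refine (Complex.norm_le_abs_re_add_abs_im _).trans_lt ?_
  have h1 := abs_le.2 ⟨by linarith [h.1.1] , h.1.2⟩
  have h2 := abs_le.2 ⟨h.2.1.le , h.2.2⟩
  linarith

lemma thinRegion_rigid {g t A : ℝ} (hg0 : 0 < g) (hg1 : g < 1) (ht : 0 < t) (hA : 0 ≤ A)
    (p : ℂ) {n : ℂ} (hn : ‖n‖ = 1) :
    IntegrableOn (fun ζ => tailKernel t ‖ζ - p‖) {ζ | conj n * (ζ - p) ∈ thinRegion g A} ∧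
      ∫ ζ in {ζ | conj n * (ζ - p) ∈ thinRegion g A}, tailKernel t ‖ζ - p‖ ≤
        4 * A * radialConst g * t ^ g := by
  set E : Set ℂ := {ζ | conj n * (ζ - p) ∈ thinRegion g A} with hE
  have hpre : (fun ξ : ℂ => p + n * ξ) ⁻¹' E = thinRegion g A := by
    ext ξ; simp only [hE, mem_preimage, mem_ofPred_eq, conj_mul_rigid_sub hn]
  have hEm : MeasurableSet E := (measurableSet_thinRegion g A).preimage (by fun_prop)
  have hm : Measurable (fun ζ : ℂ => tailKernel t ‖ζ - p‖) :=
    (measurable_tailKernel t).comp (by fun_prop)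
  have h0 : 0 ≤ᵐ[volume.restrict E] fun ζ : ℂ => tailKernel t ‖ζ - p‖ :=
    Eventually.of_forall fun ζ => tailKernel_nonneg ht.le (norm_nonneg _)
  have hl : ∫⁻ ζ in E, ENNReal.ofReal (tailKernel t ‖ζ - p‖) ≤
      ENNReal.ofReal (4 * A * radialConst g * t ^ g) := by
    refine le_trans (le_of_eq ?_) (lintegral_thinRegion_le hg0 hg1 ht hA)
    rw [← (measurePreserving_rigid p hn).setLIntegral_comp_preimage_emb
      (measurableEmbedding_rigid p hn) _ E, hpre]
    simp [hn]
  have hC : 0 ≤ 4 * A * radialConst g * t ^ g := by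
    have := radialConst_nonneg g
    positivity
  refine ⟨⟨hm.aestronglyMeasurable, ?_⟩, ?_⟩
  · rw [hasFiniteIntegral_iff_ofReal h0]
    exact hl.trans_lt ENNReal.ofReal_lt_top
  · rw [integral_eq_lintegral_of_nonneg_ae h0 hm.aestronglyMeasurable]
    exact ENNReal.toReal_le_of_le_ofReal hC hl

/-- The constant in the comparison of a flat set with its tangent rectangle. -/
def flatConst (g A s : ℝ) : ℝ :=
  2 * Real.pi * radialConst g + 16 * A * radialConst g + 2 * Real.pi * radialConst g / s ^ g

lemma flatConst_nonneg {g A s : ℝ} (h : FlatParams g A s) : 0 ≤ flatConst g A s := by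
  have h1 := radialConst_nonneg g
  have h2 := h.A_nonneg
  have h3 := h.s_pos
  unfold flatConst; positivity

/-- Flatness bounds the normal coordinate by `A|ζ - p|^(1+g) ≤ |ζ - p|/16`. Hence `|ζ - p|` is at
most twice the tangential coordinate, and `2^(1+g) ≤ 4` gives the factor `4`. -/
lemma mem_thinRegion_of_mem_symmDiff {g A s : ℝ} (hP : FlatParams g A s) {S : Set ℂ} {p n ζ : ℂ}
    (hflat : IsFlatAt g A s S p n) (hζ : ‖ζ - p‖ ≤ s)
    (h : (ζ ∈ S ∧ ζ ∉ tangentRect p n) ∨ (ζ ∉ S ∧ ζ ∈ tangentRect p n)) :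
    conj n * (ζ - p) ∈ thinRegion g (4 * A) := by
  have hnorm := norm_conj_mul hflat.norm_eq (ζ - p)
  set ξ := conj n * (ζ - p) with hξ
  have hre := Complex.abs_re_le_norm ξ
  have him := Complex.abs_im_le_norm ξ
  rw [hnorm] at hre him
  have hs := hP.s_le
  have key : |ξ.re| ≤ A * ‖ζ - p‖ ^ (1 + g) := by
    rcases h with ⟨h1, h2⟩ | ⟨h1, h2⟩
    · have h3 : ξ.re ≤ 0 := by
        by_contra hpos
        refine h2 (mem_unitRect.2 ?_)
        have h4 := abs_le.1 hre
        have h5 := abs_le.1 him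
        exact ⟨⟨not_le.1 hpos, by linarith [h4.2]⟩, by linarith [h5.1], by linarith [h5.2]⟩
      have h4 : ¬ (A * ‖ζ - p‖ ^ (1 + g) < -ξ.re) := fun h5 => hflat.notMem ζ hζ h5 h1
      rw [abs_of_nonpos h3]
      exact not_lt.1 h4
    · have h3 := (mem_unitRect.1 h2).1.1
      have h4 : ¬ (A * ‖ζ - p‖ ^ (1 + g) < ξ.re) := fun h5 => h1 (hflat.mem ζ hζ h5)
      rw [abs_of_pos h3]
      exact not_lt.1 h4
  have h1 := hP.mul_rpow_le (norm_nonneg _) hζ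
  have h2 := Complex.norm_le_abs_re_add_abs_im ξ
  rw [hnorm] at h2
  have h3 : ‖ζ - p‖ ≤ 2 * |ξ.im| := by linarith [norm_nonneg (ζ - p)]
  have hA := hP.A_nonneg
  have hg := hP.g_pos
  have hg1 := hP.g_lt
  show |ξ.re| ≤ 4 * A * |ξ.im| ^ (1 + g)
  calc |ξ.re| ≤ A * ‖ζ - p‖ ^ (1 + g) := key
    _ ≤ A * (2 * |ξ.im|) ^ (1 + g) := by gcongr
    _ = A * (2 ^ (1 + g) * |ξ.im| ^ (1 + g)) := by
        rw [Real.mul_rpow (by norm_num) (abs_nonneg _)]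
    _ ≤ A * (4 * |ξ.im| ^ (1 + g)) := by
        gcongr
        calc (2 : ℝ) ^ (1 + g) ≤ 2 ^ (2 : ℝ) :=
              Real.rpow_le_rpow_of_exponent_le (by norm_num) (by linarith)
          _ = 4 := by norm_num
    _ = _ := by ring

/-- Integrals against a kernel that is critical at a flat boundary point `p` of `S` may be computed
by freezing `f` at `p` and replacing `S` by the tangent rectangle. -/
lemma norm_setIntegral_sub_tangentRect_le {g A s : ℝ} (hP : FlatParams g A s) {S : Set ℂ}
    (hS : MeasurableSet S) {p n : ℂ} (hflat : IsFlatAt g A s S p n) {f k : ℂ → ℂ}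
    (hf : Measurable f) (hk : Measurable k) {N C t : ℝ} (hN0 : 0 ≤ N) (hC : 0 ≤ C) (ht : 0 < t)
    (hN : ∀ x, ‖f x - f p‖ ≤ N * ‖x - p‖ ^ g) (hfp : ‖f p‖ ≤ N)
    (hkb : ∀ ζ ∈ S ∪ tangentRect p n, ζ ≠ p → ‖k ζ‖ ≤ C * tailKernel t ‖ζ - p‖)
    (hkS : IntegrableOn k S) (hkR : IntegrableOn k (tangentRect p n)) :
    ‖(∫ ζ in S, f ζ * k ζ) - f p * ∫ ζ in tangentRect p n, k ζ‖ ≤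
      flatConst g A s * C * N * t ^ g := by
  have hg0 := hP.g_pos
  have hg1 := hP.g_lt
  have hs := hP.s_pos
  have hR := measurableSet_tangentRect p n
  have hne : ∀ᵐ ζ : ℂ, ζ ≠ p := by simp [ae_iff]
  have hI := integrable_radial hg0 hg1 ht p
  have hb1 : ∀ᵐ ζ ∂(volume.restrict S), ‖(f ζ - f p) * k ζ‖ ≤
      (C * N) * (‖ζ - p‖ ^ g * tailKernel t ‖ζ - p‖) := by
    filter_upwards [ae_restrict_mem hS, ae_restrict_of_ae hne] with ζ h1 h2
    rw [norm_mul]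
    calc _ ≤ (N * ‖ζ - p‖ ^ g) * (C * tailKernel t ‖ζ - p‖) :=
          mul_le_mul (hN ζ) (hkb ζ (Or.inl h1) h2) (norm_nonneg _) (by positivity)
      _ = _ := by ring
  have hi1 : IntegrableOn (fun ζ => (f ζ - f p) * k ζ) S :=
    Integrable.mono' (hI.const_mul (C * N)).integrableOn
      ((hf.sub_const _).mul hk).aestronglyMeasurable hb1
  have hsplit : ∫ ζ in S, f ζ * k ζ = (∫ ζ in S, (f ζ - f p) * k ζ) + f p * ∫ ζ in S, k ζ := by
    rw [← integral_const_mul, ← integral_add hi1 (hkS.const_mul _)]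
    congr 1; ext ζ; ring
  have hnn : ∀ ζ : ℂ, 0 ≤ ‖ζ - p‖ ^ g * tailKernel t ‖ζ - p‖ := fun ζ => by
    have := tailKernel_nonneg ht.le (norm_nonneg (ζ - p)); positivity
  -- Error from freezing `f` at `p`.
  have e1 : ‖∫ ζ in S, (f ζ - f p) * k ζ‖ ≤ 2 * Real.pi * radialConst g * C * N * t ^ g := by
    refine (norm_integral_le_of_norm_le (hI.const_mul (C * N)).integrableOn hb1).trans ?_
    refine (setIntegral_le_integral (hI.const_mul (C * N)) (Eventually.of_forall fun ζ => ?_)).trans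
      (le_of_eq ?_)
    · have := hnn ζ
      simp only [Pi.zero_apply]; positivity
    · rw [integral_const_mul, integral_radial ht]; ring
  set E : Set ℂ := {ζ | conj n * (ζ - p) ∈ thinRegion g (4 * A)} with hE
  have hEm : MeasurableSet E := (measurableSet_thinRegion g (4 * A)).preimage (by fun_prop)
  obtain ⟨hth1, hth2⟩ := thinRegion_rigid hg0 hg1 ht (by linarith [hP.A_nonneg] : 0 ≤ 4 * A) p
    hflat.norm_eq
  have hth3 := hth1.integrable_indicator hEm
  -- Error from replacing `S` by the rectangle. Within distance `s` of `p` the symmetric difference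
  -- lies in a thin region. Farther away nothing is known about it, but there `(|ζ - p|/s)^g ≥ 1`,
  -- and the radial integral bounds the whole contribution.
  have e2 : ‖(∫ ζ in S, k ζ) - ∫ ζ in tangentRect p n, k ζ‖ ≤
      (16 * A * radialConst g + 2 * Real.pi * radialConst g / s ^ g) * C * t ^ g := by
    rw [← integral_indicator hS, ← integral_indicator hR,
      ← integral_sub (hkS.integrable_indicator hS) (hkR.integrable_indicator hR)]
    have hdom : Integrable (fun ζ => C * (E.indicator (fun ζ => tailKernel t ‖ζ - p‖) ζ +
        (1 / s ^ g) * (‖ζ - p‖ ^ g * tailKernel t ‖ζ - p‖))) :=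
      (hth3.add (hI.const_mul (1 / s ^ g))).const_mul C
    refine (norm_integral_le_of_norm_le hdom ?_).trans ?_
    · filter_upwards [hne] with ζ hζ
      have hsg : 0 < s ^ g := Real.rpow_pos_of_pos hs g
      have hk0 := tailKernel_nonneg ht.le (norm_nonneg (ζ - p))
      have hi0 : 0 ≤ E.indicator (fun ζ => tailKernel t ‖ζ - p‖) ζ :=
        indicator_nonneg (fun ζ _ => tailKernel_nonneg ht.le (norm_nonneg (ζ - p))) ζ
      have hr0 : 0 ≤ (1 / s ^ g) * (‖ζ - p‖ ^ g * tailKernel t ‖ζ - p‖) := by positivity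
      have hmain : ((ζ ∈ S ∧ ζ ∉ tangentRect p n) ∨ (ζ ∉ S ∧ ζ ∈ tangentRect p n)) →
          ‖k ζ‖ ≤ C * (E.indicator (fun ζ => tailKernel t ‖ζ - p‖) ζ +
            (1 / s ^ g) * (‖ζ - p‖ ^ g * tailKernel t ‖ζ - p‖)) := by
        intro h
        have hk1 := hkb ζ (by rcases h with h | h <;> simp [h]) hζ
        refine hk1.trans (mul_le_mul_of_nonneg_left ?_ hC)
        rcases le_or_gt ‖ζ - p‖ s with h1 | h1
        · have h2 : ζ ∈ E := mem_thinRegion_of_mem_symmDiff hP hflat h1 h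
          rw [indicator_of_mem h2]; linarith
        · have h2 : s ^ g ≤ ‖ζ - p‖ ^ g := by gcongr
          have h3 : 1 ≤ (1 / s ^ g) * ‖ζ - p‖ ^ g := by
            rw [one_div_mul_eq_div, le_div_iff₀ hsg]; linarith
          have := mul_le_mul_of_nonneg_right h3 hk0
          linarith
      by_cases h1 : ζ ∈ S <;> by_cases h2 : ζ ∈ tangentRect p n
      · simp only [h1, h2, indicator_of_mem, sub_self, norm_zero]; positivity
      · simp only [h1, h2, indicator_of_mem, indicator_of_notMem, not_false_eq_true, sub_zero]
        exact hmain (Or.inl ⟨h1, h2⟩)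
      · simp only [h1, h2, indicator_of_mem, indicator_of_notMem, not_false_eq_true, zero_sub,
          norm_neg]
        exact hmain (Or.inr ⟨h1, h2⟩)
      · simp only [h1, h2, indicator_of_notMem, not_false_eq_true, sub_self, norm_zero]; positivity
    · rw [integral_const_mul, integral_add hth3 (hI.const_mul _), integral_const_mul,
        integral_radial ht, integral_indicator hEm]
      calc _ ≤ C * (4 * (4 * A) * radialConst g * t ^ g +
            1 / s ^ g * (2 * Real.pi * radialConst g * t ^ g)) := by gcongr
        _ = _ := by ring
  have e3 : ‖f p * ((∫ ζ in S, k ζ) - ∫ ζ in tangentRect p n, k ζ)‖ ≤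
      N * ((16 * A * radialConst g + 2 * Real.pi * radialConst g / s ^ g) * C * t ^ g) := by
    rw [norm_mul]
    exact mul_le_mul hfp e2 (norm_nonneg _) hN0
  have e4 : (∫ ζ in S, f ζ * k ζ) - f p * ∫ ζ in tangentRect p n, k ζ =
      (∫ ζ in S, (f ζ - f p) * k ζ) +
        f p * ((∫ ζ in S, k ζ) - ∫ ζ in tangentRect p n, k ζ) := by
    rw [hsplit]; ring
  rw [e4]
  refine (norm_add_le _ _).trans ((add_le_add e1 e3).trans (le_of_eq ?_))
  unfold flatConst; ring

/-! ### Estimates off the support -/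

lemma le_norm_sub_of_disjoint {z : ℂ} {h : ℝ} {E : Set ℂ} (hd : Disjoint (Metric.ball z h) E)
    {ζ : ℂ} (hζ : ζ ∈ E) : h ≤ ‖ζ - z‖ := by
  simpa [dist_eq_norm] using disjoint_right.1 hd hζ

/-- A single kernel is not integrable at infinity, but the difference decays like `|ζ|^(-3)`. This
allows unbounded sets such as the complement of `Ω`. The exponent `1/2` is an arbitrary choice in
`(0, 1)`. -/
lemma integrableOn_beurlingKernel_sub {z w : ℂ} {h h' : ℝ} {E : Set ℂ} (hE : MeasurableSet E)
    (hh : 0 < h) (hh' : 0 < h') (hz : Disjoint (Metric.ball z h) E)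
    (hw : Disjoint (Metric.ball w h') E) :
    IntegrableOn (fun ζ => beurlingKernel z ζ - beurlingKernel w ζ) E := by
  rcases eq_or_ne z w with rfl | hne
  · simp
  have hr : 0 < ‖z - w‖ := norm_pos_iff.2 (sub_ne_zero.2 hne)
  have g0 : (0 : ℝ) < 1 / 2 := by norm_num
  have g1 : (1 / 2 : ℝ) < 1 := by norm_num
  have Iz := (integrable_radial g0 g1 hr z).const_mul (4 / h ^ (1 / 2 : ℝ))
  have Iw := (integrable_radial g0 g1 hr w).const_mul (4 / h' ^ (1 / 2 : ℝ))
  refine Integrable.mono' (Iz.add Iw).integrableOn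
    ((measurable_beurlingKernel z).sub (measurable_beurlingKernel w)).aestronglyMeasurable ?_
  filter_upwards [ae_restrict_mem hE] with ζ hζ
  have h1 := le_norm_sub_of_disjoint hz hζ
  have h2 := le_norm_sub_of_disjoint hw hζ
  have key : ∀ (c : ℂ) (a : ℝ), 0 < a → a ≤ ‖ζ - c‖ → 4 * tailKernel ‖z - w‖ ‖ζ - c‖ ≤
      4 / a ^ (1 / 2 : ℝ) * (‖ζ - c‖ ^ (1 / 2 : ℝ) * tailKernel ‖z - w‖ ‖ζ - c‖) := by
    intro c a ha hac
    have t1 := tailKernel_nonneg hr.le (norm_nonneg (ζ - c))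
    have t2 : 0 < a ^ (1 / 2 : ℝ) := Real.rpow_pos_of_pos ha _
    have t3 : a ^ (1 / 2 : ℝ) ≤ ‖ζ - c‖ ^ (1 / 2 : ℝ) := by gcongr
    rw [div_mul_eq_mul_div, le_div_iff₀ t2]
    nlinarith [mul_le_mul_of_nonneg_right t3 t1]
  have h3 := norm_beurlingKernel_sub_le (hh.trans_le h1) (hh'.trans_le h2)
  have k1 := key z h hh h1
  have k2 := key w h' hh' h2
  simp only [Pi.add_apply]
  linarith

/-- `z` can be approached from `p` inside a fixed cone that avoids `S`. -/
def IsNontangential (s : ℝ) (S : Set ℂ) (p z : ℂ) : Prop :=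
  ∃ h, 0 < h ∧ h ≤ s / 4 ∧ Disjoint (Metric.ball z h) S ∧ ‖z - p‖ ≤ 3 * h

/-- Moving from `z` by `h/2` along the inner normal stays outside `S`, so by flatness the normal
coordinate reached is at most `(7h/2)/16`. Subtracting `h/2` leaves less than `-h/4`. -/
lemma re_le_of_nontangential {g A s : ℝ} (hP : FlatParams g A s) {S : Set ℂ} {p n z : ℂ} {h : ℝ}
    (hflat : IsFlatAt g A s S p n) (hh : 0 < h) (hs : h ≤ s / 4)
    (hd : Disjoint (Metric.ball z h) S) (hz : ‖z - p‖ ≤ 3 * h) :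
    (conj n * (z - p)).re ≤ -(h / 4) := by
  have hn := hflat.norm_eq
  set ζ := z + n * (h / 2 : ℝ) with hζ
  have hnn : ‖n * (h / 2 : ℝ)‖ = h / 2 := by
    rw [norm_mul, hn, one_mul, Complex.norm_real, Real.norm_of_nonneg (by linarith)]
  have h1 : ζ ∈ Metric.ball z h := by
    rw [Metric.mem_ball, dist_eq_norm, hζ, add_sub_cancel_left, hnn]; linarith
  have h2 : ‖ζ - p‖ ≤ 7 / 2 * h := by
    have : ζ - p = (z - p) + n * (h / 2 : ℝ) := by rw [hζ]; ring
    rw [this]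
    refine (norm_add_le _ _).trans ?_
    rw [hnn]; linarith
  have h3 : ζ ∉ S := disjoint_left.1 hd h1
  have h4 : ‖ζ - p‖ ≤ s := by linarith
  have h5 : ¬ (A * ‖ζ - p‖ ^ (1 + g) < (conj n * (ζ - p)).re) := fun h6 =>
    h3 (hflat.mem ζ h4 h6)
  have h6 := hP.mul_rpow_le (norm_nonneg _) h4
  have h7 : conj n * (ζ - p) = conj n * (z - p) + (h / 2 : ℝ) := by
    rw [hζ, show z + n * ((h / 2 : ℝ) : ℂ) - p = (z - p) + n * ((h / 2 : ℝ) : ℂ) by ring, mul_add,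
      ← mul_assoc, conj_mul_self_of_norm_one hn, one_mul]
  rw [h7, Complex.add_re, Complex.ofReal_re] at h5
  linarith

/-- Points of a cone see both `S` and the rectangle no closer than a fraction of their distance to
`p`; thus kernels at `z` are bounded by kernels centred at `p`. The constant is `1 + 3 · 4 = 13`. -/
lemma norm_sub_le_of_nontangential {g A s : ℝ} (hP : FlatParams g A s) {S : Set ℂ}
    {p n z ζ : ℂ} {h : ℝ} (hflat : IsFlatAt g A s S p n) (hh : 0 < h) (hs : h ≤ s / 4)
    (hd : Disjoint (Metric.ball z h) S) (hz : ‖z - p‖ ≤ 3 * h)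
    (hζ : ζ ∈ S ∪ tangentRect p n) : h / 4 ≤ ‖ζ - z‖ ∧ ‖ζ - p‖ ≤ 13 * ‖ζ - z‖ := by
  have h0 : h / 4 ≤ ‖ζ - z‖ := by
    rcases hζ with hζ | hζ
    · linarith [le_norm_sub_of_disjoint hd hζ]
    · have h1 := re_le_of_nontangential hP hflat hh hs hd hz
      have h2 := (mem_unitRect.1 hζ).1.1
      rw [← norm_conj_mul hflat.norm_eq]
      refine le_trans ?_ (Complex.re_le_norm _)
      have : conj n * (ζ - z) = conj n * (ζ - p) - conj n * (z - p) := by ring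
      rw [this, Complex.sub_re]; linarith
  refine ⟨h0, ?_⟩
  have : ‖ζ - p‖ ≤ ‖ζ - z‖ + ‖z - p‖ := by
    have := norm_add_le (ζ - z) (z - p); simpa using this
  linarith

/-- The constant in the nontangential Hölder estimate. -/
def coneConst (g A s : ℝ) : ℝ := flatConst g A s * 17576 + 8

lemma coneConst_nonneg {g A s : ℝ} (h : FlatParams g A s) : 0 ≤ coneConst g A s := by
  have := flatConst_nonneg h
  unfold coneConst; positivity

/-- Moving the majorants from `z` and `w` to `p` costs `13³` each, so the kernel difference is
critical at `p` with constant `8 · 13³ = 17576`. The comparison with the tangent rectangle then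
applies, and the rectangle itself contributes a Lipschitz term. -/
lemma norm_setIntegral_kernel_sub_le_of_nontangential {g A s : ℝ} (hP : FlatParams g A s)
    {S : Set ℂ} (hS : MeasurableSet S) {p n : ℂ} (hflat : IsFlatAt g A s S p n) {f : ℂ → ℂ}
    (hf : Measurable f) {N : ℝ} (hN0 : 0 ≤ N) (hN : ∀ x, ‖f x - f p‖ ≤ N * ‖x - p‖ ^ g)
    (hfp : ‖f p‖ ≤ N) {z w : ℂ} (hz : IsNontangential s S p z) (hw : IsNontangential s S p w) :
    ‖∫ ζ in S, f ζ * (beurlingKernel z ζ - beurlingKernel w ζ)‖ ≤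
      coneConst g A s * N * ‖z - w‖ ^ g := by
  rcases eq_or_ne z w with rfl | hne
  · simp [Real.zero_rpow hP.g_pos.ne']
  have hr : 0 < ‖z - w‖ := norm_pos_iff.2 (sub_ne_zero.2 hne)
  obtain ⟨h, hh, hhs, hzd, hzp⟩ := hz
  obtain ⟨h', hh', hhs', hwd, hwp⟩ := hw
  have hn := hflat.norm_eq
  have hs := hP.s_le
  have hRz : Disjoint (Metric.ball z (h / 4)) (tangentRect p n) := disjoint_left.2 fun ζ h1 h2 => by
    have h3 := (norm_sub_le_of_nontangential hP hflat hh hhs hzd hzp (Or.inr h2)).1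
    rw [Metric.mem_ball, dist_eq_norm] at h1; linarith
  have hRw : Disjoint (Metric.ball w (h' / 4)) (tangentRect p n) :=
    disjoint_left.2 fun ζ h1 h2 => by
      have h3 := (norm_sub_le_of_nontangential hP hflat hh' hhs' hwd hwp (Or.inr h2)).1
      rw [Metric.mem_ball, dist_eq_norm] at h1; linarith
  have hRm := measurableSet_tangentRect p n
  have hRb := isBounded_tangentRect hn p
  have main := norm_setIntegral_sub_tangentRect_le hP hS hflat hf
    (k := fun ζ => beurlingKernel z ζ - beurlingKernel w ζ) (C := 17576) (t := ‖z - w‖)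
    ((measurable_beurlingKernel z).sub (measurable_beurlingKernel w)) hN0 (by norm_num) hr hN hfp
    (fun ζ hζ hp => by
      obtain ⟨a1, a2⟩ := norm_sub_le_of_nontangential hP hflat hh hhs hzd hzp hζ
      obtain ⟨b1, b2⟩ := norm_sub_le_of_nontangential hP hflat hh' hhs' hwd hwp hζ
      have hp0 : 0 < ‖ζ - p‖ := norm_pos_iff.2 (sub_ne_zero.2 hp)
      have k1 := tailKernel_le_of_le_mul hr hp0 (by norm_num) a2
      have k2 := tailKernel_le_of_le_mul hr hp0 (by norm_num) b2
      have k3 := norm_beurlingKernel_sub_le (z := z) (w := w) (ζ := ζ) (by linarith) (by linarith)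
      linarith)
    (integrableOn_beurlingKernel_sub hS hh hh' hzd hwd)
    (integrableOn_beurlingKernel_sub hRm (by linarith) (by linarith) hRz hRw)
  have hrect : ‖∫ ζ in tangentRect p n, (beurlingKernel z ζ - beurlingKernel w ζ)‖ ≤
      8 * ‖z - w‖ ^ g := by
    rw [integral_sub (integrableOn_beurlingKernel hRm hRb (by linarith) hRz)
      (integrableOn_beurlingKernel hRm hRb (by linarith) hRw),
      setIntegral_tangentRect_beurlingKernel hn, setIntegral_tangentRect_beurlingKernel hn,
      ← mul_sub, norm_mul, norm_pow, hn, one_pow, one_mul,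
      setIntegral_unitRect_beurlingKernel
        (by linarith [re_le_of_nontangential hP hflat hh hhs hzd hzp]),
      setIntegral_unitRect_beurlingKernel
        (by linarith [re_le_of_nontangential hP hflat hh' hhs' hwd hwp])]
    refine (norm_integral_primitive_sub_le (by rw [norm_conj_mul hn]; linarith)
      (by rw [norm_conj_mul hn]; linarith)).trans ?_
    rw [← mul_sub, norm_conj_mul hn, sub_sub_sub_cancel_right]
    have h1 : ‖z - w‖ ≤ 1 := by
      have := norm_sub_le (z - p) (w - p)
      rw [sub_sub_sub_cancel_right] at this
      linarith
    have h2 := Real.rpow_le_rpow_of_exponent_ge hr h1 hP.g_lt.le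
    rw [Real.rpow_one] at h2
    linarith
  have h3 : ‖f p * ∫ ζ in tangentRect p n, (beurlingKernel z ζ - beurlingKernel w ζ)‖ ≤
      N * (8 * ‖z - w‖ ^ g) := by
    rw [norm_mul]; exact mul_le_mul hfp hrect (norm_nonneg _) hN0
  have h4 := norm_add_le ((∫ ζ in S, f ζ * (beurlingKernel z ζ - beurlingKernel w ζ)) -
    f p * ∫ ζ in tangentRect p n, (beurlingKernel z ζ - beurlingKernel w ζ))
    (f p * ∫ ζ in tangentRect p n, (beurlingKernel z ζ - beurlingKernel w ζ))
  rw [sub_add_cancel] at h4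
  unfold coneConst
  linarith

/-! ### One-sided Hölder estimate, by chaining cones. -/

/-- The Beurling transform of `f` restricted to `S`, at points off `S`. -/
def offTransform (f : ℂ → ℂ) (S : Set ℂ) (z : ℂ) : ℂ := ∫ ζ in S, f ζ * beurlingKernel z ζ

lemma offTransform_sub {f : ℂ → ℂ} {S : Set ℂ}
    (hintg : ∀ z, ∀ ε > 0, IntegrableOn (fun ζ => f ζ * beurlingKernel z ζ) (Metric.ball z ε)ᶜ)
    {z w : ℂ} {h h' : ℝ} (hh : 0 < h) (hh' : 0 < h') (hz : Disjoint (Metric.ball z h) S)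
    (hw : Disjoint (Metric.ball w h') S) :
    offTransform f S z - offTransform f S w =
      ∫ ζ in S, f ζ * (beurlingKernel z ζ - beurlingKernel w ζ) := by
  unfold offTransform
  rw [← integral_sub ((hintg z h hh).mono_set hz.symm.subset_compl_right)
    ((hintg w h' hh').mono_set hw.symm.subset_compl_right)]
  simp only [mul_sub]

lemma disjoint_ball_sub_normal {g A s : ℝ} (hP : FlatParams g A s) {S : Set ℂ} {p n : ℂ}
    (hflat : IsFlatAt g A s S p n) {t : ℝ} (ht : 0 < t) (hts : t ≤ s / 2) :
    Disjoint (Metric.ball (p - t * n) (t / 2)) S := by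
  refine disjoint_left.2 fun ζ hζ => ?_
  have hn := hflat.norm_eq
  rw [Metric.mem_ball, dist_eq_norm] at hζ
  have htn : ‖(t : ℂ) * n‖ = t := by
    rw [norm_mul, hn, mul_one, Complex.norm_real, Real.norm_of_nonneg ht.le]
  have h1 : ζ - p = (ζ - (p - t * n)) - t * n := by ring
  have h2 : ‖ζ - p‖ ≤ 3 / 2 * t := by
    rw [h1]; refine (norm_sub_le _ _).trans ?_; rw [htn]; linarith
  have h3 := hP.mul_rpow_le (norm_nonneg (ζ - p)) (by linarith)
  refine hflat.notMem ζ (by linarith) ?_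
  have h4 : conj n * (ζ - p) = conj n * (ζ - (p - t * n)) - t := by
    have := conj_mul_self_of_norm_one hn
    linear_combination (-(t : ℂ)) * this
  rw [h4, Complex.sub_re, Complex.ofReal_re]
  have h5 := Complex.re_le_norm (conj n * (ζ - (p - t * n)))
  rw [norm_conj_mul hn] at h5
  linarith

lemma isNontangential_sub_normal {g A s : ℝ} (hP : FlatParams g A s) {S : Set ℂ} {p n : ℂ}
    (hflat : IsFlatAt g A s S p n) {t : ℝ} (ht : 0 < t) (hts : t ≤ s / 2) :
    IsNontangential s S p (p - t * n) := by
  refine ⟨t / 2, by linarith, by linarith, disjoint_ball_sub_normal hP hflat ht hts, ?_⟩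
  rw [sub_sub_cancel_left, norm_neg, norm_mul, hflat.norm_eq, mul_one, Complex.norm_real,
    Real.norm_of_nonneg ht.le]
  linarith

lemma norm_sub_normal_sub {p n : ℂ} (hn : ‖n‖ = 1) {t : ℝ} (ht : 0 ≤ t) :
    ‖(p - t * n) - p‖ = t := by
  rw [sub_sub_cancel_left, norm_neg, norm_mul, hn, mul_one, Complex.norm_real,
    Real.norm_of_nonneg ht]

/-- The constant in the one-sided Hölder estimate. -/
def oneSidedConst (g A s : ℝ) : ℝ :=
  50 * coneConst g A s + 41 * (16 * Real.pi * radialConst g / (s / 8) ^ g)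

lemma rpow_le_mul_rpow {g a c r : ℝ} (hg0 : 0 < g) (hg1 : g < 1) (hc : 1 ≤ c) (hr : 0 ≤ r)
    (ha0 : 0 ≤ a) (ha : a ≤ c * r) : a ^ g ≤ c * r ^ g := by
  calc a ^ g ≤ (c * r) ^ g := by gcongr
    _ = c ^ g * r ^ g := Real.mul_rpow (by linarith) hr
    _ ≤ c * r ^ g := by
      gcongr
      exact (Real.rpow_le_rpow_of_exponent_le hc hg1.le).trans (by simp)

/-- One-sided Hölder estimate: the transform of `f` restricted to `S` is Hölder on a domain `G`
disjoint from `S` whose boundary consists of flat points of `S`. -/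
lemma norm_offTransform_sub_le {g A s : ℝ} (hP : FlatParams g A s) {S G Γ : Set ℂ}
    (hS : MeasurableSet S) (hSG : Disjoint G S)
    (hΓ : ∀ p ∈ Γ, ∃ n, IsFlatAt g A s S p n)
    (hG : ∀ z ∈ G, ∃ p ∈ Γ, 0 < ‖z - p‖ ∧ Metric.ball z ‖z - p‖ ⊆ G)
    {f : ℂ → ℂ} (hf : Measurable f)
    (hintg : ∀ z, ∀ ε > 0, IntegrableOn (fun ζ => f ζ * beurlingKernel z ζ) (Metric.ball z ε)ᶜ)
    {N : ℝ} (hN0 : 0 ≤ N) (hN : ∀ x y, ‖f x - f y‖ ≤ N * ‖x - y‖ ^ g) (hfb : ∀ x, ‖f x‖ ≤ N)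
    {z w : ℂ} (hz : z ∈ G) (hw : w ∈ G) :
    ‖offTransform f S z - offTransform f S w‖ ≤ oneSidedConst g A s * N * ‖z - w‖ ^ g := by
  rcases eq_or_ne z w with rfl | hne
  · simp [Real.zero_rpow hP.g_pos.ne']
  have hg0 := hP.g_pos
  have hg1 := hP.g_lt
  have hs := hP.s_pos
  set r := ‖z - w‖ with hrdef
  have hr : 0 < r := norm_pos_iff.2 (sub_ne_zero.2 hne)
  set E := coneConst g A s with hEdef
  have hE := coneConst_nonneg hP
  set P := 16 * Real.pi * radialConst g / (s / 8) ^ g with hPdef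
  have hP0 : 0 ≤ P := by have := radialConst_nonneg g; positivity
  have hrg : 0 < r ^ g := Real.rpow_pos_of_pos hr g
  have hC : oneSidedConst g A s * N * r ^ g = 50 * (E * N * r ^ g) + 41 * (P * N * r ^ g) := by
    unfold oneSidedConst; ring
  have hEN : 0 ≤ E * N * r ^ g := by positivity
  have hPN : 0 ≤ P * N * r ^ g := by positivity
  rw [hC]
  have cone : ∀ p ∈ Γ, ∀ x y, IsNontangential s S p x → IsNontangential s S p y → ∀ c, 1 ≤ c →
      ‖x - y‖ ≤ c * r → ‖offTransform f S x - offTransform f S y‖ ≤ c * (E * N * r ^ g) := by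
    intro p hp x y hx hy c hc hxy
    obtain ⟨n, hn⟩ := hΓ p hp
    obtain ⟨h, hh, -, hxd, -⟩ := id hx
    obtain ⟨h', hh', -, hyd, -⟩ := id hy
    rw [offTransform_sub hintg hh hh' hxd hyd]
    refine (norm_setIntegral_kernel_sub_le_of_nontangential hP hS hn hf hN0 (fun x => hN x p)
      (hfb p) hx hy).trans ?_
    have := rpow_le_mul_rpow hg0 hg1 hc hr.le (norm_nonneg _) hxy
    calc _ ≤ E * N * (c * r ^ g) := by gcongr
      _ = _ := by ring
  have far : ∀ x y, Disjoint (Metric.ball x (s / 8)) S → Disjoint (Metric.ball y (s / 8)) S →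
      ∀ c, 1 ≤ c → ‖x - y‖ ≤ c * r →
      ‖offTransform f S x - offTransform f S y‖ ≤ c * (P * N * r ^ g) := by
    intro x y hx hy c hc hxy
    have hs8 : 0 < s / 8 := by linarith
    rw [offTransform_sub hintg hs8 hs8 hx hy]
    refine (norm_setIntegral_kernel_sub_le_far hS hg0 hg1 hN0 hs8 hfb hx hy).trans ?_
    have := rpow_le_mul_rpow hg0 hg1 hc hr.le (norm_nonneg _) hxy
    calc _ ≤ P * N * (c * r ^ g) := by gcongr
      _ = _ := by ring
  have tri : ∀ a b c : ℂ, ‖a - c‖ ≤ ‖a - b‖ + ‖b - c‖ := norm_sub_le_norm_sub_add_norm_sub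
  have nearest : ∀ x ∈ G, ∃ p ∈ Γ, 0 < ‖x - p‖ ∧ Disjoint (Metric.ball x ‖x - p‖) S := by
    intro x hx
    obtain ⟨p, hp, h1, h2⟩ := hG x hx
    exact ⟨p, hp, h1, hSG.mono_left h2⟩
  -- If `x` has depth `d ≥ 2r`, then `y` has a free ball of radius `d/2` and `|y - p| ≤ 3d/2`. So
  -- both points lie in the cone at `p`, or both are uniformly far from `S`.
  have deep : ∀ x ∈ G, ∀ y ∈ G, ‖x - y‖ = r → (∃ p ∈ Γ, Disjoint (Metric.ball x ‖x - p‖) S ∧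
      2 * r ≤ ‖x - p‖) → ‖offTransform f S x - offTransform f S y‖ ≤
        50 * (E * N * r ^ g) + 41 * (P * N * r ^ g) := by
    rintro x hx y hy hxy ⟨p, hp, hd, h2⟩
    set d := ‖x - p‖ with hddef
    have hyd : Disjoint (Metric.ball y (d / 2)) S := by
      refine hd.mono_left fun ζ hζ => ?_
      rw [Metric.mem_ball, dist_eq_norm] at hζ ⊢
      have := tri ζ y x
      rw [norm_sub_rev y x, hxy] at this
      linarith
    rcases le_or_gt d (s / 4) with h3 | h3
    · have := cone p hp x y ⟨d, by linarith, h3, hd, by linarith⟩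
        ⟨d / 2, by linarith, by linarith, hyd, by
          have := tri y x p
          rw [norm_sub_rev y x, hxy] at this
          linarith⟩ 1 le_rfl (by linarith)
      linarith
    · have := far x y (hd.mono_left (Metric.ball_subset_ball (by linarith)))
        (hyd.mono_left (Metric.ball_subset_ball (by linarith))) 1 le_rfl (by linarith)
      linarith
  obtain ⟨p, hp, hd0, hpd⟩ := nearest z hz
  obtain ⟨q, hq, he0, hqd⟩ := nearest w hw
  obtain ⟨n, hn⟩ := hΓ p hp
  obtain ⟨m, hm⟩ := hΓ q hq
  rcases le_or_gt (2 * r) ‖z - p‖ with hd | hd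
  · exact deep z hz w hw rfl ⟨p, hp, hpd, hd⟩
  rcases le_or_gt (2 * r) ‖w - q‖ with he | he
  · rw [norm_sub_rev]
    exact deep w hw z hz (by rw [norm_sub_rev]) ⟨q, hq, hqd, he⟩
  -- Both points are now within `2r` of the boundary. For small `r` each climbs along the normal of
  -- its boundary point to height `10r`, comparable with `r`. For `r > s/40`, shallow points climb
  -- to the fixed height `s/4 < 10r` and the estimate away from the support applies.
  rcases le_or_gt r (s / 40) with hrs | hrs
  · have ht : 0 < 10 * r := by linarith
    have hts : 10 * r ≤ s / 2 := by linarith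
    have n1 : ‖(p - (10 * r : ℝ) * n) - p‖ = 10 * r := norm_sub_normal_sub hn.norm_eq ht.le
    have n2 : ‖(q - (10 * r : ℝ) * m) - q‖ = 10 * r := norm_sub_normal_sub hm.norm_eq ht.le
    set z' := p - (10 * r : ℝ) * n with hz'
    set w' := q - (10 * r : ℝ) * m with hw'
    have a1 := cone p hp z z' ⟨‖z - p‖, hd0, by linarith, hpd, by linarith⟩
      (isNontangential_sub_normal hP hn ht hts) 12 (by norm_num) (by
        have := tri z p z'
        rw [norm_sub_rev p z', n1] at this
        linarith)
    have a2 := cone q hq w w' ⟨‖w - q‖, he0, by linarith, hqd, by linarith⟩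
      (isNontangential_sub_normal hP hm ht hts) 12 (by norm_num) (by
        have := tri w q w'
        rw [norm_sub_rev q w', n2] at this
        linarith)
    have pq : ‖q - p‖ ≤ 5 * r := by
      have b1 := tri q w p
      have b2 := tri w z p
      rw [norm_sub_rev q w] at b1
      rw [norm_sub_rev w z, ← hrdef] at b2
      linarith
    -- The height `10r` is chosen so that `w'` also lies in the cone at `p`: it has a free ball of
    -- radius `5r`, and `|w' - p| ≤ 10r + 5r = 3 · 5r`.
    have a3 := cone p hp z' w' (isNontangential_sub_normal hP hn ht hts)
      ⟨10 * r / 2, by linarith, by linarith, disjoint_ball_sub_normal hP hm ht hts, by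
        have := tri w' q p
        linarith⟩ 25 (by norm_num) (by
        have b1 := tri z' p w'
        have b2 := tri p q w'
        rw [norm_sub_rev q w', n2, norm_sub_rev p q] at b2
        linarith)
    have c1 := tri (offTransform f S z) (offTransform f S z') (offTransform f S w)
    have c2 := tri (offTransform f S z') (offTransform f S w') (offTransform f S w)
    rw [norm_sub_rev (offTransform f S w') (offTransform f S w)] at c2
    linarith
  · have climb : ∀ x, ∀ p ∈ Γ, 0 < ‖x - p‖ → Disjoint (Metric.ball x ‖x - p‖) S →
        ∃ x', Disjoint (Metric.ball x' (s / 8)) S ∧ ‖x - x'‖ ≤ 20 * r ∧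
          ‖offTransform f S x - offTransform f S x'‖ ≤ 20 * (E * N * r ^ g) := by
      intro x p hp h0 hd
      rcases le_or_gt ‖x - p‖ (s / 4) with h1 | h1
      · obtain ⟨n, hn⟩ := hΓ p hp
        have n1 : ‖(p - (s / 4 : ℝ) * n) - p‖ = s / 4 :=
          norm_sub_normal_sub hn.norm_eq (by linarith)
        have hb := disjoint_ball_sub_normal hP hn (t := s / 4) (by linarith) (by linarith)
        have hnt := isNontangential_sub_normal hP hn (t := s / 4) (by linarith) (by linarith)
        have hxx : ‖x - (p - (s / 4 : ℝ) * n)‖ ≤ 20 * r := by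
          have := tri x p (p - (s / 4 : ℝ) * n)
          rw [norm_sub_rev p (p - (s / 4 : ℝ) * n), n1] at this
          linarith
        refine ⟨p - (s / 4 : ℝ) * n, ?_, hxx, ?_⟩
        · rwa [show s / 4 / 2 = s / 8 by ring] at hb
        · exact cone p hp x _ ⟨‖x - p‖, h0, h1, hd, by linarith⟩ hnt 20 (by norm_num) hxx
      · refine ⟨x, hd.mono_left (Metric.ball_subset_ball (by linarith)), ?_, ?_⟩
        · simp only [sub_self, norm_zero]; linarith
        · simp only [sub_self, norm_zero]; linarith
    obtain ⟨z', z1, z2, z3⟩ := climb z p hp hd0 hpd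
    obtain ⟨w', w1, w2, w3⟩ := climb w q hq he0 hqd
    have a := far z' w' z1 w1 41 (by norm_num) (by
      have b1 := tri z' z w'
      have b2 := tri z w w'
      rw [norm_sub_rev z' z] at b1
      linarith)
    have c1 := tri (offTransform f S z) (offTransform f S z') (offTransform f S w)
    have c2 := tri (offTransform f S z') (offTransform f S w') (offTransform f S w)
    rw [norm_sub_rev (offTransform f S w') (offTransform f S w)] at c2
    linarith

/-! ### The jump -/

lemma indicator_mul_beurlingKernel (f : ℂ → ℂ) (S : Set ℂ) (z ζ : ℂ) :
    S.indicator f ζ * beurlingKernel z ζ =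
      S.indicator (fun ζ => f ζ * beurlingKernel z ζ) ζ := by
  by_cases h : ζ ∈ S <;> simp [h]

lemma ball_add_normal_subset {g A s : ℝ} (hP : FlatParams g A s) {S : Set ℂ} {p n : ℂ}
    (hflat : IsFlatAt g A s S p n) {t : ℝ} (ht : 0 < t) (hts : t ≤ s / 2) :
    Metric.ball (p + t * n) (t / 2) ⊆ S := by
  have h := disjoint_ball_sub_normal hP hflat.compl ht hts
  rw [mul_neg, sub_neg_eq_add] at h
  exact disjoint_compl_right_iff_subset.1 h

lemma beurling_indicator_eq_of_ball_subset {f : ℂ → ℂ} {S : Set ℂ} {z : ℂ} {N ρ g : ℝ}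
    (hf : Measurable f) (hS : MeasurableSet S)
    (hintg : ∀ ε > 0, IntegrableOn (fun ζ => f ζ * beurlingKernel z ζ) (Metric.ball z ε)ᶜ)
    (hg0 : 0 < g) (hg1 : g < 1) (hρ : 0 < ρ) (hN0 : 0 ≤ N)
    (hN : ∀ x y, ‖f x - f y‖ ≤ N * ‖x - y‖ ^ g) (hd : Metric.ball z ρ ⊆ S) :
    BeurlingExists (S.indicator f) z ∧ beurling (S.indicator f) z =
      (∫ ζ in Metric.ball z ρ, (f ζ - f z) * beurlingKernel z ζ) +
        ∫ ζ in (Metric.ball z ρ)ᶜ, S.indicator f ζ * beurlingKernel z ζ := by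
  have hz := indicator_of_mem (hd (Metric.mem_ball_self hρ)) f
  obtain ⟨h1, h2⟩ := beurling_eq_of_holder (u := S.indicator f) (z := z) (hf.indicator hS)
    (fun ε hε => by
      simp only [indicator_mul_beurlingKernel]
      exact (hintg ε hε).indicator hS) hg0 hg1 hρ hN0
    (fun ζ hζ => by rw [indicator_of_mem (hd hζ), hz]; exact hN ζ z)
  refine ⟨h1, ?_⟩
  rw [h2]
  congr 1
  refine setIntegral_congr_fun measurableSet_ball fun ζ hζ => ?_
  simp only [hz, indicator_of_mem (hd hζ)]

lemma setIntegral_tangentRect_jump {n : ℂ} (hn : ‖n‖ = 1) (p : ℂ) (t : ℝ) :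
    ∫ ζ in tangentRect p n, ((Metric.ball (p + t * n) (t / 2))ᶜ.indicator
      (beurlingKernel (p + t * n)) ζ - beurlingKernel (p - t * n) ζ) =
      n ^ 2 * ∫ ξ in unitRect, ((Metric.ball (t : ℂ) (t / 2))ᶜ.indicator (beurlingKernel t) ξ -
        beurlingKernel (-t) ξ) := by
  rw [setIntegral_tangentRect hn, ← integral_const_mul]
  congr 1; ext ξ
  have h1 := beurlingKernel_rigid p hn t ξ
  have h2 := beurlingKernel_rigid p hn (-t) ξ
  rw [mul_neg, ← sub_eq_add_neg, mul_comm n] at h2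
  rw [mul_comm n (t : ℂ)] at h1
  have h3 : (p + n * ξ ∈ (Metric.ball (p + t * n) (t / 2))ᶜ) ↔
      ξ ∈ (Metric.ball (t : ℂ) (t / 2))ᶜ := by
    have : p + n * ξ - (p + t * n) = n * (ξ - t) := by ring
    simp only [mem_compl_iff, Metric.mem_ball, dist_eq_norm, this, norm_mul, hn, one_mul]
  rw [h2, mul_sub]
  congr 1
  by_cases h4 : ξ ∈ (Metric.ball (t : ℂ) (t / 2))ᶜ
  · rw [indicator_of_mem h4, indicator_of_mem (h3.2 h4), h1]
  · rw [indicator_of_notMem h4, indicator_of_notMem (fun h5 => h4 (h3.1 h5)), mul_zero]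

/-- The constant in the jump estimate. -/
def jumpConst (g A s : ℝ) : ℝ := 4 * Real.pi * radialConst g + 35152 * flatConst g A s + 16

/-- Quantitative jump relation along the normal at a flat boundary point. -/
lemma norm_beurling_jump_le {g A s : ℝ} (hP : FlatParams g A s) {S : Set ℂ}
    (hS : MeasurableSet S) (hSb : Bornology.IsBounded S) {p n : ℂ}
    (hflat : IsFlatAt g A s S p n) {f : ℂ → ℂ} (hf : Measurable f)
    (hintg : ∀ z, ∀ ε > 0, IntegrableOn (fun ζ => f ζ * beurlingKernel z ζ) (Metric.ball z ε)ᶜ)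
    {N : ℝ} (hN0 : 0 ≤ N) (hN : ∀ x y, ‖f x - f y‖ ≤ N * ‖x - y‖ ^ g) (hfb : ∀ x, ‖f x‖ ≤ N)
    {t : ℝ} (ht : 0 < t) (hts : t ≤ s / 2) :
    ‖beurling (S.indicator f) (p + t * n) - beurling (S.indicator f) (p - t * n) +
      n ^ 2 * Real.pi * f p‖ ≤ jumpConst g A s * N * t ^ g := by
  have hg0 := hP.g_pos
  have hg1 := hP.g_lt
  have hs := hP.s_le
  have hn := hflat.norm_eq
  have ht2 : 0 < t / 2 := by linarith
  have hzS := ball_add_normal_subset hP hflat ht hts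
  have hwS := disjoint_ball_sub_normal hP hflat ht hts
  have hwp : ‖(p - t * n) - p‖ = t := norm_sub_normal_sub hn ht.le
  have hzp : ‖(p + t * n) - p‖ = t := by
    rw [add_sub_cancel_left, norm_mul, hn, mul_one, Complex.norm_real, Real.norm_of_nonneg ht.le]
  have hzw : ‖(p + t * n) - (p - t * n)‖ = 2 * t := by
    rw [show (p + t * n) - (p - t * n) = ((2 * t : ℝ) : ℂ) * n by push_cast; ring, norm_mul, hn,
      mul_one, Complex.norm_real, Real.norm_of_nonneg (by linarith)]
  have hrect := setIntegral_tangentRect_jump hn p t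
  set z := p + t * n with hz
  set w := p - t * n with hw
  set B := Metric.ball z (t / 2) with hB
  have hBm : MeasurableSet B := measurableSet_ball
  -- After the increment integral over `B` is split off, the jump is the integral of `f k` over `S`.
  -- This `k` is dominated at `p` at scale `2t = |z - w|`, so the comparison with the tangent
  -- rectangle applies.
  set k : ℂ → ℂ := fun ζ => Bᶜ.indicator (beurlingKernel z) ζ - beurlingKernel w ζ with hk
  have hkm : Measurable k :=
    ((measurable_beurlingKernel z).indicator hBm.compl).sub (measurable_beurlingKernel w)
  obtain ⟨-, ez⟩ := beurling_indicator_eq_of_ball_subset hf hS (hintg z) hg0 hg1 ht2 hN0 hN hzS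
  obtain ⟨-, ew⟩ := beurling_indicator_eq_of_disjoint hf hS (hintg w) ht2 hwS
  have hnear := norm_setIntegral_sub_mul_beurlingKernel_le (u := f) (z := z) hg0 hg1 ht2 hN0
    (fun ζ _ => hN ζ z)
  have iz : IntegrableOn (fun ζ => f ζ * Bᶜ.indicator (beurlingKernel z) ζ) S := by
    have : ∀ ζ, f ζ * Bᶜ.indicator (beurlingKernel z) ζ =
        Bᶜ.indicator (fun ζ => f ζ * beurlingKernel z ζ) ζ := fun ζ => by
      by_cases h : ζ ∈ Bᶜ <;> simp [indicator, h]
    simp only [this]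
    exact ((hintg z _ ht2).integrable_indicator hBm.compl).integrableOn
  have iw : IntegrableOn (fun ζ => f ζ * beurlingKernel w ζ) S :=
    (hintg w _ ht2).mono_set hwS.symm.subset_compl_right
  have hfar : (∫ ζ in Bᶜ, S.indicator f ζ * beurlingKernel z ζ) -
      (∫ ζ in S, f ζ * beurlingKernel w ζ) = ∫ ζ in S, f ζ * k ζ := by
    have h1 : ∫ ζ in Bᶜ, S.indicator f ζ * beurlingKernel z ζ =
        ∫ ζ in S, f ζ * Bᶜ.indicator (beurlingKernel z) ζ := by
      rw [← integral_indicator hS, ← integral_indicator hBm.compl]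
      congr 1; ext ζ
      simp only [indicator]
      split_ifs <;> simp
    rw [h1, ← integral_sub iz iw]
    simp only [hk, mul_sub]
  have hintk : ∀ E : Set ℂ, MeasurableSet E → Bornology.IsBounded E → ∀ h, 0 < h →
      Disjoint (Metric.ball w h) E → IntegrableOn k E := by
    intro E hE hEb h hh hd
    refine Integrable.sub ?_ (integrableOn_beurlingKernel hE hEb hh hd)
    rw [← IntegrableOn, integrableOn_indicator_iff hBm.compl]
    exact integrableOn_beurlingKernel (hBm.compl.inter hE) (hEb.subset inter_subset_right) ht2
      (disjoint_left.2 fun ζ h1 h2 => h2.1 h1)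
  have hnt : ∀ ζ ∈ S ∪ tangentRect p n, t / 2 / 4 ≤ ‖ζ - w‖ ∧ ‖ζ - p‖ ≤ 13 * ‖ζ - w‖ :=
    fun ζ hζ => norm_sub_le_of_nontangential hP hflat ht2 (by linarith) hwS (by linarith) hζ
  have hwR : Disjoint (Metric.ball w (t / 8)) (tangentRect p n) := disjoint_left.2 fun ζ h1 h2 => by
    have h3 := (hnt ζ (Or.inr h2)).1
    rw [Metric.mem_ball, dist_eq_norm] at h1; linarith
  have main := norm_setIntegral_sub_tangentRect_le hP hS hflat hf (k := k) (C := 17576)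
    (t := 2 * t) hkm hN0 (by norm_num) (by linarith) (fun x => hN x p) (hfb p)
    (fun ζ hζ hp => by
      have hp0 : 0 < ‖ζ - p‖ := norm_pos_iff.2 (sub_ne_zero.2 hp)
      obtain ⟨b1, b2⟩ := hnt ζ hζ
      have k2 := tailKernel_le_of_le_mul (t := 2 * t) (by linarith) hp0 (by norm_num) b2
      have t0 := tailKernel_nonneg (t := 2 * t) (by linarith) hp0.le
      -- Inside `B` only the kernel at `w` is present, at a distance comparable to `t`. Outside `B`
      -- both distances dominate `|ζ - p|` up to the factor `13`.
      by_cases h : ζ ∈ B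
      · have h1 : ‖ζ - z‖ < t / 2 := by simpa [hB, dist_eq_norm] using h
        have h2 : ‖ζ - w‖ ≤ ‖ζ - z‖ + ‖z - w‖ := norm_sub_le_norm_sub_add_norm_sub ζ z w
        have k3 := inv_sq_le_tailKernel (c := 2) (t := 2 * t) (a := ‖ζ - w‖) (by linarith)
          (by linarith) (by linarith)
        simp only [hk, mem_compl_iff, h, not_true_eq_false, not_false_eq_true,
          indicator_of_notMem, zero_sub, norm_neg, norm_beurlingKernel]
        linarith
      · have h1 : t / 2 ≤ ‖ζ - z‖ := by simpa [hB, dist_eq_norm] using h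
        have h2 : ‖ζ - p‖ ≤ ‖ζ - z‖ + ‖z - p‖ := norm_sub_le_norm_sub_add_norm_sub ζ z p
        have k1 := tailKernel_le_of_le_mul (t := 2 * t) (c := 13) (a := ‖ζ - z‖) (by linarith) hp0
          (by norm_num) (by linarith)
        have k3 := norm_beurlingKernel_sub_le (z := z) (w := w) (ζ := ζ) (by linarith) (by linarith)
        rw [hzw] at k3
        simp only [hk, mem_compl_iff, h, not_false_eq_true, indicator_of_mem]
        linarith)
    (hintk S hS hSb _ ht2 hwS)
    (hintk _ (measurableSet_tangentRect p n) (isBounded_tangentRect hn p) _ (by linarith) hwR)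
  have hJ := norm_setIntegral_unitRect_jump ht (by linarith)
  rw [hrect] at main
  set J := ∫ ξ in unitRect, ((Metric.ball (t : ℂ) (t / 2))ᶜ.indicator (beurlingKernel t) ξ -
        beurlingKernel (-t) ξ) with hJdef
  have hJ2 : ‖f p * (n ^ 2 * (J + Real.pi))‖ ≤ N * (16 * t) := by
    rw [norm_mul, norm_mul, norm_pow, hn, one_pow, one_mul]
    exact mul_le_mul (hfb p) hJ (norm_nonneg _) hN0
  have htg : t ≤ t ^ g := by
    have := Real.rpow_le_rpow_of_exponent_ge ht (by linarith) hg1.le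
    rwa [Real.rpow_one] at this
  have htg2 : (t / 2) ^ g ≤ t ^ g := by gcongr; linarith
  have htg3 : (2 * t) ^ g ≤ 2 * t ^ g := two_mul_rpow_le hg1 ht.le
  have hdec : beurling (S.indicator f) z - beurling (S.indicator f) w + n ^ 2 * Real.pi * f p =
      (∫ ζ in B, (f ζ - f z) * beurlingKernel z ζ) +
        ((∫ ζ in S, f ζ * k ζ) - f p * (n ^ 2 * J)) + f p * (n ^ 2 * (J + Real.pi)) := by
    rw [ez, ew, ← hfar]; ring
  rw [hdec]
  refine (norm_add₃_le).trans ?_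
  have hR := radialConst_nonneg g
  have hF := flatConst_nonneg hP
  calc _ ≤ 4 * Real.pi * radialConst g * N * (t / 2) ^ g +
        flatConst g A s * 17576 * N * (2 * t) ^ g + N * (16 * t) :=
        add_le_add (add_le_add hnear main) hJ2
    _ ≤ 4 * Real.pi * radialConst g * N * t ^ g +
        flatConst g A s * 17576 * N * (2 * t ^ g) + N * (16 * t ^ g) := by gcongr
    _ = _ := by unfold jumpConst; ring

/-! ### Flatness of `C^{1,γ}` boundaries -/

/-- Every boundary point of `Ω` is uniformly flat, for `Ω` and for its closure. -/
def HasFlatBoundary (g A s : ℝ) (Ω : Set ℂ) : Prop :=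
  ∀ p ∈ frontier Ω, ∃ n : ℂ, ‖n‖ = 1 ∧ ∀ ζ, ‖ζ - p‖ ≤ s →
    (A * ‖ζ - p‖ ^ (1 + g) < (conj n * (ζ - p)).re → ζ ∈ Ω) ∧
    (A * ‖ζ - p‖ ^ (1 + g) < -(conj n * (ζ - p)).re → ζ ∉ closure Ω)

lemma exists_gradient (D : ℂ →L[ℝ] ℝ) : ∃ a : ℂ, (∀ v, D v = (conj a * v).re) ∧ ‖D‖ ≤ ‖a‖ := by
  set a : ℂ := ⟨D 1, D Complex.I⟩ with ha
  have h : ∀ v, D v = (conj a * v).re := by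
    intro v
    have h1 : v = v.re • (1 : ℂ) + v.im • Complex.I := by
      apply Complex.ext <;> simp
    conv_lhs => rw [h1]
    rw [map_add, map_smul, map_smul]
    simp [ha, Complex.mul_re]
    ring
  refine ⟨a, h, D.opNorm_le_bound (norm_nonneg _) fun v => ?_⟩
  rw [h, Real.norm_eq_abs]
  refine (Complex.abs_re_le_norm _).trans ?_
  rw [norm_mul, RCLike.norm_conj]

lemma HasC1HolderBoundary.exists_hasFlatBoundary {γ : ℝ≥0} (hγ0 : 0 < γ) (hγ1 : γ < 1)
    {Ω : Set ℂ} (hΩo : IsOpen Ω) (hΩb : Bornology.IsBounded Ω) (hΩ : HasC1HolderBoundary γ Ω) :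
    ∃ A s : ℝ, FlatParams γ A s ∧ HasFlatBoundary γ A s Ω := by
  obtain ⟨ρ, U, hU, hfU, hρ, ⟨C, hC⟩, hΩU, hgrad⟩ := hΩ
  have hg0 : (0 : ℝ) < γ := hγ0
  have hg1 : (γ : ℝ) < 1 := hγ1
  have hcomp : IsCompact (frontier Ω) :=
    Metric.isCompact_of_isClosed_isBounded isClosed_frontier
      (hΩb.closure.subset frontier_subset_closure)
  obtain ⟨δ, hδ, hδU⟩ := hcomp.exists_cthickening_subset_open hU hfU
  have hcont : ContinuousOn (fun z => ‖fderiv ℝ ρ z‖) (frontier Ω) :=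
    ((hC.continuousOn hγ0).mono hfU).norm
  obtain ⟨m, hm, hmle⟩ := hcomp.exists_forall_le' hcont (a := 0)
    (fun b hb => norm_pos_iff.2 (hgrad b hb))
  have hdiff : ∀ z ∈ U, DifferentiableAt ℝ ρ z := fun z hz =>
    (hρ.differentiableOn (by norm_num)).differentiableAt (hU.mem_nhds hz)
  have hpos : ∀ ζ ∈ U, 0 < ρ ζ → ζ ∉ closure Ω := by
    intro ζ hζ h0 hcl
    have h1 : ∀ᶠ x in 𝓝 ζ, 0 < ρ x ∧ x ∈ U :=
      ((hdiff ζ hζ).continuousAt.eventually (lt_mem_nhds h0)).and (hU.mem_nhds hζ)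
    obtain ⟨x, ⟨hx1, hx2⟩, hx3⟩ := mem_closure_iff_nhds.1 hcl _ h1
    have : x ∈ {z ∈ U | ρ z < 0} := hΩU ▸ ⟨hx3, hx2⟩
    linarith [this.2]
  have hneg : ∀ ζ ∈ U, ρ ζ < 0 → ζ ∈ Ω := by
    intro ζ hζ h0
    have : ζ ∈ Ω ∩ U := by rw [hΩU]; exact ⟨hζ, h0⟩
    exact this.1
  have hzero : ∀ p ∈ frontier Ω, ρ p = 0 := by
    intro p hp
    have hpU := hfU hp
    refine le_antisymm (not_lt.1 fun h => hpos p hpU h (frontier_subset_closure hp))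
      (not_lt.1 fun h => ?_)
    have := hneg p hpU h
    rw [hΩo.frontier_eq] at hp
    exact hp.2 this
  -- Taylor's remainder at `p` is at most `C|ζ - p|^(1+γ)`. Dividing by a lower bound `m` for the
  -- gradient on the compact boundary converts it into a deviation from the tangent line.
  set A : ℝ := C / m with hA
  have hA0 : 0 ≤ A := by positivity
  -- The three terms keep balls about boundary points inside `U`, give `s ≤ 1/2`, and give `A s^γ ≤
  -- 1/16`; `A + 1` avoids division by zero.
  set s : ℝ := min (min δ (1 / 2)) ((1 / (16 * (A + 1))) ^ (1 / (γ : ℝ))) with hs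
  have hs0 : 0 < s := by
    have : 0 < (1 / (16 * (A + 1))) ^ (1 / (γ : ℝ)) := Real.rpow_pos_of_pos (by positivity) _
    positivity
  have hsδ : s ≤ δ := (min_le_left _ _).trans (min_le_left _ _)
  have hs2 : s ≤ 1 / 2 := (min_le_left _ _).trans (min_le_right _ _)
  have hsg : s ^ (γ : ℝ) ≤ 1 / (16 * (A + 1)) := by
    have h1 : s ≤ (1 / (16 * (A + 1))) ^ (1 / (γ : ℝ)) := min_le_right _ _
    calc s ^ (γ : ℝ) ≤ ((1 / (16 * (A + 1))) ^ (1 / (γ : ℝ))) ^ (γ : ℝ) := by gcongr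
      _ = 1 / (16 * (A + 1)) := by
        rw [← Real.rpow_mul (by positivity), one_div_mul_cancel hg0.ne', Real.rpow_one]
  refine ⟨A, s, ⟨hg0, hg1, hA0, hs0, hs2, ?_⟩, ?_⟩
  · calc A * s ^ (γ : ℝ) ≤ A * (1 / (16 * (A + 1))) := by gcongr
      _ ≤ 1 / 16 := by
        rw [mul_one_div, div_le_div_iff₀ (by positivity) (by norm_num)]; linarith
  intro p hp
  have hpU := hfU hp
  obtain ⟨a, ha, haD⟩ := exists_gradient (fderiv ℝ ρ p)
  have hma : m ≤ ‖a‖ := (hmle p hp).trans haD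
  have ha0 : 0 < ‖a‖ := hm.trans_le hma
  -- `Ω` is where `ρ < 0`, so the inner normal is minus the normalized gradient.
  refine ⟨-a / ‖a‖, ?_, fun ζ hζ => ?_⟩
  · rw [norm_div, norm_neg, Complex.norm_real, norm_norm, div_self ha0.ne']
  have hball : Metric.closedBall p ‖ζ - p‖ ⊆ U := by
    refine fun x hx => hδU (Metric.mem_cthickening_of_dist_le x p δ _ hp ?_)
    rw [Metric.mem_closedBall] at hx
    linarith
  have hζU : ζ ∈ U := hball (by rw [Metric.mem_closedBall, dist_eq_norm])
  have hmv : ‖ρ ζ - ρ p - fderiv ℝ ρ p (ζ - p)‖ ≤ (C * ‖ζ - p‖ ^ (γ : ℝ)) * ‖ζ - p‖ := by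
    refine (convex_closedBall p ‖ζ - p‖).norm_image_sub_le_of_norm_hasFDerivWithin_le'
      (f' := fderiv ℝ ρ) (fun x hx => (hdiff x (hball hx)).hasFDerivAt.hasFDerivWithinAt)
      (fun x hx => ?_) (Metric.mem_closedBall_self (norm_nonneg _))
      (by rw [Metric.mem_closedBall, dist_eq_norm])
    have h1 := hC.dist_le (hball hx) hpU
    rw [dist_eq_norm, dist_eq_norm] at h1
    rw [Metric.mem_closedBall, dist_eq_norm] at hx
    refine h1.trans ?_
    gcongr
  have hpw : (C * ‖ζ - p‖ ^ (γ : ℝ)) * ‖ζ - p‖ = m * (A * ‖ζ - p‖ ^ (1 + (γ : ℝ))) := by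
    rcases (norm_nonneg (ζ - p)).eq_or_lt with h0 | h0
    · rw [← h0, Real.zero_rpow (by positivity : 1 + (γ : ℝ) ≠ 0)]; simp
    · rw [Real.rpow_add h0, Real.rpow_one, hA]; field_simp
  rw [hzero p hp, sub_zero, hpw, Real.norm_eq_abs, abs_le] at hmv
  have hre : (conj (-a / (‖a‖ : ℂ)) * (ζ - p)).re = -(fderiv ℝ ρ p (ζ - p)) / ‖a‖ := by
    rw [ha, map_div₀, map_neg, Complex.conj_ofReal,
      show -conj a / (‖a‖ : ℂ) * (ζ - p) = (-(conj a * (ζ - p))) / (‖a‖ : ℂ) by ring,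
      Complex.div_ofReal_re, Complex.neg_re]
  rw [hre]
  set q := A * ‖ζ - p‖ ^ (1 + (γ : ℝ)) with hq
  have hq0 : 0 ≤ q := by positivity
  have hmq : m * q ≤ ‖a‖ * q := by gcongr
  refine ⟨fun h => hneg ζ hζU ?_, fun h => hpos ζ hζU ?_⟩
  · rw [lt_div_iff₀ ha0] at h
    linarith [hmv.2]
  · rw [neg_div, neg_neg, lt_div_iff₀ ha0] at h
    linarith [hmv.1]

/-! ### Extension of Hölder functions -/

lemma norm_sub_rpow_le {g : ℝ} (hg0 : 0 < g) (hg1 : g < 1) (x y z : ℂ) :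
    ‖x - z‖ ^ g ≤ ‖x - y‖ ^ g + ‖y - z‖ ^ g := by
  refine le_trans ?_ (Real.rpow_add_le_add_rpow (norm_nonneg _) (norm_nonneg _) hg0.le hg1.le)
  have := norm_sub_le_norm_sub_add_norm_sub x y z
  gcongr

/-- McShane's inf-convolution. For `g ≤ 1` the power `‖x - y‖^g` is itself a metric, so Hölder
functions are Lipschitz functions for it and extend with the same constant. -/
lemma exists_holder_extension_real {g : ℝ} (hg0 : 0 < g) (hg1 : g < 1) {S : Set ℂ}
    (hS : S.Nonempty) {u : ℂ → ℝ} {K : ℝ} (hK : 0 ≤ K)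
    (hu : ∀ x ∈ S, ∀ y ∈ S, |u x - u y| ≤ K * ‖x - y‖ ^ g) :
    ∃ v : ℂ → ℝ, EqOn v u S ∧ ∀ x y, |v x - v y| ≤ K * ‖x - y‖ ^ g := by
  have : Nonempty S := hS.to_subtype
  set v : ℂ → ℝ := fun x => ⨅ a : S, (u a + K * ‖x - a‖ ^ g) with hv
  obtain ⟨b, hb⟩ := hS
  have hlow : ∀ y ∈ S, ∀ x, ∀ a : S, u y - K * ‖x - y‖ ^ g ≤ u a + K * ‖x - a‖ ^ g := by
    intro y hy x a
    have h1 := (abs_le.1 (hu y hy a a.2)).2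
    have h2 := mul_le_mul_of_nonneg_left (norm_sub_rpow_le hg0 hg1 y x a) hK
    rw [norm_sub_rev y x] at h2
    linarith
  have hbdd : ∀ x, BddBelow (range fun a : S => u a + K * ‖x - (a : ℂ)‖ ^ g) := fun x =>
    ⟨u b - K * ‖x - b‖ ^ g, by rintro _ ⟨a, rfl⟩; exact hlow b hb x a⟩
  have hle : ∀ x y, v x - v y ≤ K * ‖x - y‖ ^ g := by
    intro x y
    have : v x - K * ‖x - y‖ ^ g ≤ v y := by
      refine le_ciInf fun a => ?_
      have h1 : v x ≤ u a + K * ‖x - a‖ ^ g := ciInf_le (hbdd x) a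
      have h2 := mul_le_mul_of_nonneg_left (norm_sub_rpow_le hg0 hg1 x y a) hK
      linarith
    linarith
  refine ⟨v, fun x hx => le_antisymm ?_ ?_, fun x y => abs_le.2 ⟨?_, hle x y⟩⟩
  · have h1 : v x ≤ u x + K * ‖x - x‖ ^ g := ciInf_le (hbdd x) ⟨x, hx⟩
    simpa [Real.zero_rpow hg0.ne'] using h1
  · refine le_ciInf fun a => ?_
    have := hlow x hx x a
    simpa [Real.zero_rpow hg0.ne'] using this
  · have := hle y x
    rw [norm_sub_rev] at this
    linarith

lemma exists_holder_extension {g : ℝ} (hg0 : 0 < g) (hg1 : g < 1) {S : Set ℂ}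
    (hS : S.Nonempty) {f : ℂ → ℂ} {K : ℝ} (hK : 0 ≤ K)
    (hf : ∀ x ∈ S, ∀ y ∈ S, ‖f x - f y‖ ≤ K * ‖x - y‖ ^ g) :
    ∃ F : ℂ → ℂ, EqOn F f S ∧ ∀ x y, ‖F x - F y‖ ≤ 2 * K * ‖x - y‖ ^ g := by
  obtain ⟨v, hv1, hv2⟩ := exists_holder_extension_real hg0 hg1 hS (u := fun x => (f x).re) hK
    (fun x hx y hy => by
      rw [← Complex.sub_re]; exact (Complex.abs_re_le_norm _).trans (hf x hx y hy))
  obtain ⟨w, hw1, hw2⟩ := exists_holder_extension_real hg0 hg1 hS (u := fun x => (f x).im) hK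
    (fun x hx y hy => by
      rw [← Complex.sub_im]; exact (Complex.abs_im_le_norm _).trans (hf x hx y hy))
  refine ⟨fun x => ⟨v x, w x⟩, fun x hx => Complex.ext (hv1 hx) (hw1 hx), fun x y => ?_⟩
  refine (Complex.norm_le_abs_re_add_abs_im _).trans ?_
  have h1 := hv2 x y
  have h2 := hw2 x y
  simp only [Complex.sub_re, Complex.sub_im]
  linarith

/-- Extension from a set with cutoff away from it. -/
lemma exists_holder_extension_cutoff {g : ℝ} (hg0 : 0 < g) (hg1 : g < 1) {S : Set ℂ}
    (hS : S.Nonempty) {f : ℂ → ℂ} {K : ℝ} (hK : 0 ≤ K)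
    (hf : ∀ x ∈ S, ∀ y ∈ S, ‖f x - f y‖ ≤ K * ‖x - y‖ ^ g) (hfb : ∀ x ∈ S, ‖f x‖ ≤ K) :
    ∃ F : ℂ → ℂ, EqOn F f S ∧ (∀ x y, ‖F x - F y‖ ≤ 5 * K * ‖x - y‖ ^ g) ∧
      (∀ x, ‖F x‖ ≤ 5 * K) ∧ ∀ x, 1 ≤ Metric.infDist x S → F x = 0 := by
  obtain ⟨E, hE1, hE2⟩ := exists_holder_extension hg0 hg1 hS hK hf
  set η : ℂ → ℝ := fun x => max 0 (1 - Metric.infDist x S) with hη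
  have η0 : ∀ x, 0 ≤ η x := fun x => le_max_left _ _
  have η1 : ∀ x, η x ≤ 1 := fun x => max_le zero_le_one (by
    have := Metric.infDist_nonneg (x := x) (s := S); linarith)
  have hηH : ∀ x y, |η x - η y| ≤ ‖x - y‖ ^ g := by
    intro x y
    have h1 : |η x - η y| ≤ ‖x - y‖ := by
      refine (abs_max_sub_max_le_max _ _ _ _).trans ?_
      rw [sub_self, abs_zero, sub_sub_sub_cancel_left]
      refine max_le (norm_nonneg _) (abs_le.2 ⟨?_, ?_⟩)
      · have := Metric.infDist_le_infDist_add_dist (s := S) (x := x) (y := y)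
        rw [dist_eq_norm] at this; linarith
      · have := Metric.infDist_le_infDist_add_dist (s := S) (x := y) (y := x)
        rw [dist_eq_norm, norm_sub_rev] at this; linarith
    have h2 : |η x - η y| ≤ 1 := abs_le.2 ⟨by linarith [η0 x, η1 y], by linarith [η1 x, η0 y]⟩
    rcases le_or_gt ‖x - y‖ 1 with h | h
    · rcases (norm_nonneg (x - y)).eq_or_lt with h0 | h0
      · rw [← h0] at h1 ⊢; rwa [Real.zero_rpow hg0.ne']
      · have := Real.rpow_le_rpow_of_exponent_ge h0 h hg1.le
        rw [Real.rpow_one] at this; linarith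
    · exact h2.trans (Real.one_le_rpow h.le hg0.le)
  -- The cutoff lives within distance `1` of `S`, where the extension exceeds the bound `K` on `S`
  -- by at most `2K`. In the product rule this gives `2K + 3K = 5K`.
  have hEb : ∀ x, η x ≠ 0 → ‖E x‖ ≤ 3 * K := by
    intro x hx
    have h1 : Metric.infDist x S < 1 := by
      by_contra h
      exact hx (max_eq_left (by linarith))
    obtain ⟨y, hy, hxy⟩ := (Metric.infDist_lt_iff hS).1 h1
    rw [dist_eq_norm] at hxy
    have h2 : ‖x - y‖ ^ g ≤ 1 := Real.rpow_le_one (norm_nonneg _) hxy.le hg0.le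
    have h3 := hE2 x y
    have h4 : ‖E y‖ ≤ K := by rw [hE1 hy]; exact hfb y hy
    have h5 := norm_le_norm_add_norm_sub (E y) (E x)
    rw [norm_sub_rev] at h5
    nlinarith
  have half : ∀ x y, η x ≠ 0 → ‖η x * E x - η y * E y‖ ≤ 5 * K * ‖x - y‖ ^ g := by
    intro x y hx
    have h1 : (η x : ℂ) * E x - η y * E y = η y * (E x - E y) + ((η x - η y : ℝ) : ℂ) * E x := by
      push_cast; ring
    rw [h1]
    refine (norm_add_le _ _).trans ?_
    rw [norm_mul, norm_mul, Complex.norm_real, Complex.norm_real, Real.norm_of_nonneg (η0 y),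
      Real.norm_eq_abs]
    have h0 : 0 ≤ ‖x - y‖ ^ g := by positivity
    calc _ ≤ 1 * (2 * K * ‖x - y‖ ^ g) + ‖x - y‖ ^ g * (3 * K) :=
          add_le_add (mul_le_mul (η1 y) (hE2 x y) (norm_nonneg _) zero_le_one)
            (mul_le_mul (hηH x y) (hEb x hx) (norm_nonneg _) h0)
      _ = _ := by ring
  refine ⟨fun x => η x * E x, fun x hx => ?_, fun x y => ?_, fun x => ?_, fun x hx => ?_⟩
  · have : η x = 1 := by simp [hη, Metric.infDist_zero_of_mem hx]
    simp [this, hE1 hx]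
  · by_cases hx : η x = 0
    · by_cases hy : η y = 0
      · simp only [hx, hy, Complex.ofReal_zero, zero_mul, sub_self, norm_zero]; positivity
      · rw [norm_sub_rev, norm_sub_rev x y]; exact half y x hy
    · exact half x y hx
  · by_cases hx : η x = 0
    · simp only [hx, Complex.ofReal_zero, zero_mul, norm_zero]; positivity
    · rw [norm_mul, Complex.norm_real, Real.norm_of_nonneg (η0 x)]
      have h1 := hEb x hx
      nlinarith [η1 x, η0 x, norm_nonneg (E x)]
  · have : η x = 0 := max_eq_left (by linarith)
    simp [this]

/-- Quadratic decay makes the truncated Beurling integrals absolutely convergent. -/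
lemma integrableOn_mul_beurlingKernel_of_decay {f : ℂ → ℂ} (hf : Measurable f) {N C L : ℝ}
    (hfb : ∀ x, ‖f x‖ ≤ N) (hdec : ∀ x, L ≤ ‖x‖ → ‖f x‖ ≤ C / ‖x‖ ^ 2) (z : ℂ) {ε : ℝ}
    (hε : 0 < ε) :
    IntegrableOn (fun ζ => f ζ * beurlingKernel z ζ) (Metric.ball z ε)ᶜ := by
  set R := max 1 (max L (2 * ‖z‖)) with hR
  have hR1 : 1 ≤ R := le_max_left _ _
  have hN0 : 0 ≤ N := (norm_nonneg _).trans (hfb 0)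
  have hintg : Integrable (fun ζ : ℂ => (1 + ‖ζ‖) ^ (-(4 : ℝ))) :=
    integrable_one_add_norm (by rw [Complex.finrank_real_complex]; norm_num)
  have hpw : ∀ ζ : ℂ, (1 + ‖ζ‖) ^ (-(4 : ℝ)) = ((1 + ‖ζ‖) ^ 4)⁻¹ := fun ζ => by
    rw [Real.rpow_neg (by positivity)]; norm_cast
  refine Integrable.mono' ((hintg.const_mul (N / ε ^ 2 * (1 + R) ^ 4 + 64 * |C|)).integrableOn)
    (hf.mul (measurable_beurlingKernel z)).aestronglyMeasurable ?_
  filter_upwards [ae_restrict_mem measurableSet_ball.compl] with ζ hζ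
  have hζε : ε ≤ ‖ζ - z‖ := by simpa [dist_eq_norm] using hζ
  rw [hpw, norm_mul, norm_beurlingKernel, ← div_eq_mul_inv, le_div_iff₀ (by positivity)]
  rcases le_or_gt ‖ζ‖ R with h | h
  · calc _ ≤ (N * (1 / ε ^ 2)) * (1 + R) ^ 4 := by gcongr; exact hfb ζ
      _ = N / ε ^ 2 * (1 + R) ^ 4 := by ring
      _ ≤ _ := by linarith [abs_nonneg C]
  · have h1 : 1 < ‖ζ‖ := hR1.trans_lt h
    have h2 : L ≤ ‖ζ‖ := ((le_max_left L _).trans (le_max_right 1 _)).trans h.le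
    have h3 : 2 * ‖z‖ ≤ ‖ζ‖ := ((le_max_right L _).trans (le_max_right 1 _)).trans h.le
    have h4 : ‖ζ‖ / 2 ≤ ‖ζ - z‖ := by
      have := norm_sub_norm_le ζ z; linarith
    have h5 : ‖f ζ‖ ≤ |C| / ‖ζ‖ ^ 2 := (hdec ζ h2).trans (by gcongr; exact le_abs_self C)
    have h6 : (0 : ℝ) < ‖ζ‖ := by linarith
    calc _ ≤ (|C| / ‖ζ‖ ^ 2 * (1 / (‖ζ‖ / 2) ^ 2)) * (‖ζ‖ + ‖ζ‖) ^ 4 := by gcongr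
      _ = 64 * |C| := by field_simp; ring
      _ ≤ _ := by
        have : 0 ≤ N / ε ^ 2 * (1 + R) ^ 4 := by positivity
        linarith

/-! ### Extension to the closure and the jump relation -/

lemma holderOnWith_of_norm_sub_le {γ C : ℝ≥0} {s : Set ℂ} {f : ℂ → ℂ}
    (h : ∀ x ∈ s, ∀ y ∈ s, ‖f x - f y‖ ≤ C * ‖x - y‖ ^ (γ : ℝ)) : HolderOnWith C γ f s := by
  intro x hx y hy
  have h1 : nndist (f x) (f y) ≤ C * nndist x y ^ (γ : ℝ) := by
    rw [← NNReal.coe_le_coe]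
    push_cast
    rw [dist_eq_norm, dist_eq_norm]
    exact h x hx y hy
  rw [edist_nndist, edist_nndist, ← ENNReal.coe_rpow_of_nonneg _ γ.coe_nonneg]
  exact_mod_cast h1

lemma HolderOnWith.norm_sub_le {γ C : ℝ≥0} {s : Set ℂ} {f : ℂ → ℂ} (h : HolderOnWith C γ f s)
    {x y : ℂ} (hx : x ∈ s) (hy : y ∈ s) : ‖f x - f y‖ ≤ C * ‖x - y‖ ^ (γ : ℝ) := by
  have := h.dist_le hx hy
  rwa [dist_eq_norm, dist_eq_norm] at this

/-- A Hölder function is uniformly continuous, so its values are Cauchy along approaches to boundary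
points; the inequality passes to the limit with the same constant. -/
lemma HolderOnWith.exists_extension_closure {γ M : ℝ≥0} (hγ : 0 < γ) {G : Set ℂ} {F : ℂ → ℂ}
    (hF : HolderOnWith M γ F G) :
    ∃ F' : ℂ → ℂ, EqOn F' F G ∧ HolderOnWith M γ F' (closure G) := by
  have hlim : ∀ x ∈ closure G, Tendsto F (𝓝[G] x) (𝓝 (extendFrom G F x)) := by
    intro x hx
    have : (𝓝[G] x).NeBot := mem_closure_iff_nhdsWithin_neBot.1 hx
    have hc : Cauchy (map F (𝓝[G] x)) :=
      (cauchy_nhds.mono nhdsWithin_le_nhds).map_of_le (hF.uniformContinuousOn hγ)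
        inf_le_right
    obtain ⟨y, hy⟩ := CompleteSpace.complete hc
    exact tendsto_extendFrom ⟨y, hy⟩
  refine ⟨extendFrom G F, fun x hx => ?_, holderOnWith_of_norm_sub_le fun x hx y hy => ?_⟩
  · exact extendFrom_eq (subset_closure hx) ((hF.continuousOn hγ) x hx)
  · have : (𝓝[G] x).NeBot := mem_closure_iff_nhdsWithin_neBot.1 hx
    have : (𝓝[G] y).NeBot := mem_closure_iff_nhdsWithin_neBot.1 hy
    have h1 : Tendsto (fun q : ℂ × ℂ => ‖F q.1 - F q.2‖) (𝓝[G] x ×ˢ 𝓝[G] y)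
        (𝓝 ‖extendFrom G F x - extendFrom G F y‖) :=
      (((hlim x hx).comp tendsto_fst).sub ((hlim y hy).comp tendsto_snd)).norm
    have h2 : Tendsto (fun q : ℂ × ℂ => (M : ℝ) * ‖q.1 - q.2‖ ^ (γ : ℝ)) (𝓝[G] x ×ˢ 𝓝[G] y)
        (𝓝 (M * ‖x - y‖ ^ (γ : ℝ))) := by
      have hfst : Tendsto Prod.fst (𝓝[G] x ×ˢ 𝓝[G] y) (𝓝 x) :=
        tendsto_fst.mono_right nhdsWithin_le_nhds
      have hsnd : Tendsto Prod.snd (𝓝[G] x ×ˢ 𝓝[G] y) (𝓝 y) :=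
        tendsto_snd.mono_right nhdsWithin_le_nhds
      exact ((hfst.sub hsnd).norm.rpow_const (Or.inr γ.2)).const_mul _
    refine le_of_tendsto_of_tendsto h1 h2 ?_
    have hx' : ∀ᶠ a in 𝓝[G] x, a ∈ G := eventually_mem_nhdsWithin
    have hy' : ∀ᶠ b in 𝓝[G] y, b ∈ G := eventually_mem_nhdsWithin
    filter_upwards [hx'.prod_mk hy'] with q hq
    exact hF.norm_sub_le hq.1 hq.2

lemma exists_nearest_frontier {G : Set ℂ} (hG : IsOpen G) (hne : Gᶜ.Nonempty) {z : ℂ}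
    (hz : z ∈ G) : ∃ p ∈ frontier G, 0 < ‖z - p‖ ∧ Metric.ball z ‖z - p‖ ⊆ G := by
  obtain ⟨p, hp, hd⟩ := hG.isClosed_compl.exists_infDist_eq_dist hne z
  have hpos : 0 < ‖z - p‖ := norm_pos_iff.2 (sub_ne_zero.2 fun h => hp (h ▸ hz))
  have hb : Metric.ball z ‖z - p‖ ⊆ G := by
    rw [← dist_eq_norm, ← hd]
    exact Metric.ball_infDist_compl_subset
  refine ⟨p, ?_, hpos, hb⟩
  rw [hG.frontier_eq]
  refine ⟨closure_mono hb ?_, hp⟩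
  rw [closure_ball z hpos.ne', Metric.mem_closedBall, dist_comm, dist_eq_norm]

lemma tendsto_add_normal (p n : ℂ) :
    Tendsto (fun t : ℝ => p + t * n) (𝓝[>] 0) (𝓝 p) := by
  have h : Continuous (fun t : ℝ => p + t * n) := by fun_prop
  have := h.tendsto 0
  simp only [Complex.ofReal_zero, zero_mul, add_zero] at this
  exact this.mono_left nhdsWithin_le_nhds

/-- Assembling the two-sided property from Hölder estimates on both sides and a quantitative jump
relation along normals. -/
lemma twoSidedHolder_of_jump {γ M : ℝ≥0} (hγ : 0 < γ) {Ω S : Set ℂ} (hΩo : IsOpen Ω) {f : ℂ → ℂ}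
    (hex : ∀ z ∉ frontier Ω, BeurlingExists (S.indicator f) z)
    (hi : HolderOnWith M γ (beurling (S.indicator f)) Ω)
    (he : HolderOnWith M γ (beurling (S.indicator f)) (closure Ω)ᶜ)
    (hjump : ∀ p ∈ frontier Ω, ∃ (n c : ℂ) (C s : ℝ), ‖c‖ = Real.pi * ‖f p‖ ∧ 0 < s ∧
      ∀ t : ℝ, 0 < t → t ≤ s → p + t * n ∈ Ω ∧ p - t * n ∈ (closure Ω)ᶜ ∧
        ‖beurling (S.indicator f) (p + t * n) - beurling (S.indicator f) (p - t * n) - c‖ ≤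
          C * t ^ (γ : ℝ)) :
    TwoSidedHolder γ Ω S f M := by
  obtain ⟨Fi, hFi1, hFi2⟩ := hi.exists_extension_closure hγ
  obtain ⟨Fe, hFe1, hFe2⟩ := he.exists_extension_closure hγ
  have hm : ∀ p n : ℂ, Tendsto (fun t : ℝ => p - t * n) (𝓝[>] 0) (𝓝 p) := fun p n => by
    have := tendsto_add_normal p (-n)
    simpa only [mul_neg, ← sub_eq_add_neg] using this
  -- Every boundary point is a limit of exterior points along its normal, so extending from the
  -- exterior reaches all of `Ωᶜ`.
  have hcl : Ωᶜ ⊆ closure (closure Ω)ᶜ := by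
    intro x hx
    by_cases h : x ∈ closure Ω
    · obtain ⟨n, c, C, s, -, hs, hall⟩ := hjump x (by rw [hΩo.frontier_eq]; exact ⟨h, hx⟩)
      refine mem_closure_of_tendsto (hm x n) ?_
      filter_upwards [Ioc_mem_nhdsGT hs] with t ht
      exact (hall t ht.1 ht.2).2.1
    · exact subset_closure h
  refine ⟨hex, hi, he, Fi, Fe, hFi1, hFi2, hFe1, hFe2.mono hcl, fun p hp => ?_⟩
  obtain ⟨n, c, C, s, hc, hs, hall⟩ := hjump p hp
  have hp' := hp
  rw [hΩo.frontier_eq] at hp'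
  have hmem := Ioc_mem_nhdsGT hs
  have h1 : Tendsto (fun t : ℝ => beurling (S.indicator f) (p + t * n)) (𝓝[>] 0) (𝓝 (Fi p)) := by
    have hc1 := (hFi2.continuousOn hγ) p hp'.1
    have h2 : Tendsto (fun t : ℝ => p + t * n) (𝓝[>] 0) (𝓝[closure Ω] p) :=
      tendsto_nhdsWithin_iff.2 ⟨tendsto_add_normal p n, by
        filter_upwards [hmem] with t ht
        exact subset_closure (hall t ht.1 ht.2).1⟩
    refine (hc1.tendsto.comp h2).congr' ?_
    filter_upwards [hmem] with t ht
    exact hFi1 (hall t ht.1 ht.2).1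
  have h2 : Tendsto (fun t : ℝ => beurling (S.indicator f) (p - t * n)) (𝓝[>] 0) (𝓝 (Fe p)) := by
    have hc1 := (hFe2.continuousOn hγ) p (hcl hp'.2)
    have h2 : Tendsto (fun t : ℝ => p - t * n) (𝓝[>] 0) (𝓝[closure (closure Ω)ᶜ] p) :=
      tendsto_nhdsWithin_iff.2 ⟨hm p n, by
        filter_upwards [hmem] with t ht
        exact subset_closure (hall t ht.1 ht.2).2.1⟩
    refine (hc1.tendsto.comp h2).congr' ?_
    filter_upwards [hmem] with t ht
    exact hFe1 (hall t ht.1 ht.2).2.1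
  have h3 : Tendsto (fun t : ℝ => C * t ^ (γ : ℝ)) (𝓝[>] 0) (𝓝 0) := by
    have hγ' : (0 : ℝ) < γ := hγ
    have : Tendsto (fun t : ℝ => C * t ^ (γ : ℝ)) (𝓝 0) (𝓝 (C * 0 ^ (γ : ℝ))) :=
      ((Real.continuous_rpow_const hγ'.le).const_mul _).tendsto 0
    rw [Real.zero_rpow hγ'.ne', mul_zero] at this
    exact this.mono_left nhdsWithin_le_nhds
  have h4 : ‖Fi p - Fe p - c‖ ≤ 0 := by
    refine le_of_tendsto_of_tendsto ((h1.sub h2).sub_const c).norm h3 ?_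
    filter_upwards [hmem] with t ht
    exact (hall t ht.1 ht.2).2.2
  have h5 : Fi p - Fe p = c := sub_eq_zero.1 (norm_le_zero_iff.1 h4)
  rw [h5, hc]

/-! ### Splitting the plane transform between the two sides. -/

/-- The two-sided Hölder property for the restrictions of a Hölder function on the plane to `S`
and to its complement. -/
lemma twoSidedHolder_of_plane {γ M : ℝ≥0} (hγ0 : 0 < γ) {Ω S : Set ℂ} (hΩo : IsOpen Ω)
    (hΩne : Ω.Nonempty) (hΩb : Bornology.IsBounded Ω) {A s : ℝ} (hP : FlatParams γ A s)
    (hflat : HasFlatBoundary γ A s Ω) (hS : MeasurableSet S) (hS1 : Ω ⊆ S) (hS2 : S ⊆ closure Ω)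
    {f : ℂ → ℂ} (hf : Measurable f)
    (hintg : ∀ z, ∀ ε > 0, IntegrableOn (fun ζ => f ζ * beurlingKernel z ζ) (Metric.ball z ε)ᶜ)
    {N : ℝ} (hN0 : 0 ≤ N) (hN : ∀ x y, ‖f x - f y‖ ≤ N * ‖x - y‖ ^ (γ : ℝ))
    (hfb : ∀ x, ‖f x‖ ≤ N) (hM : (planeConst γ + oneSidedConst γ A s) * N ≤ M) :
    TwoSidedHolder γ Ω S f M ∧ TwoSidedHolder γ Ω Sᶜ f M := by
  have hg0 := hP.g_pos
  have hg1 := hP.g_lt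
  have hs := hP.s_pos
  have hSflat : ∀ p ∈ frontier Ω, ∃ n, IsFlatAt γ A s S p n ∧ IsFlatAt γ A s Ω p n ∧
      IsFlatAt γ A s (closure Ω) p n := by
    intro p hp
    obtain ⟨n, hn, h⟩ := hflat p hp
    exact ⟨n, ⟨hn, fun ζ h1 h2 => hS1 ((h ζ h1).1 h2), fun ζ h1 h2 h3 => (h ζ h1).2 h2 (hS2 h3)⟩,
      ⟨hn, fun ζ h1 h2 => (h ζ h1).1 h2, fun ζ h1 h2 h3 => (h ζ h1).2 h2 (subset_closure h3)⟩,
      ⟨hn, fun ζ h1 h2 => subset_closure ((h ζ h1).1 h2), fun ζ h1 h2 => (h ζ h1).2 h2⟩⟩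
  have hnear1 : ∀ z ∈ Ω, ∃ p ∈ frontier Ω, 0 < ‖z - p‖ ∧ Metric.ball z ‖z - p‖ ⊆ Ω := by
    refine fun z hz => exists_nearest_frontier hΩo ?_ hz
    rw [nonempty_compl]
    rintro rfl
    exact NoncompactSpace.noncompact_univ (X := ℂ) (Metric.isCompact_of_isClosed_isBounded
      isClosed_univ hΩb)
  have hnear2 : ∀ z ∈ (closure Ω)ᶜ, ∃ p ∈ frontier Ω, 0 < ‖z - p‖ ∧
      Metric.ball z ‖z - p‖ ⊆ (closure Ω)ᶜ := by
    intro z hz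
    obtain ⟨p, hp, h⟩ := exists_nearest_frontier isClosed_closure.isOpen_compl
      (by rw [compl_compl]; exact hΩne.closure) hz
    rw [frontier_compl] at hp
    exact ⟨p, frontier_closure_subset hp, h⟩
  have hd1 : Disjoint Ω Sᶜ := disjoint_compl_right_iff_subset.2 hS1
  have hd2 : Disjoint (closure Ω)ᶜ S := disjoint_compl_left_iff_subset.2 hS2
  have hplane : ∀ z, BeurlingExists f z := fun z =>
    (beurling_eq_of_holder hf (hintg z) hg0 hg1 one_pos hN0 (fun ζ _ => hN ζ z)).1
  have hadd : ∀ z, BeurlingExists (S.indicator f) z → BeurlingExists (Sᶜ.indicator f) z →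
      beurling f z = beurling (S.indicator f) z + beurling (Sᶜ.indicator f) z := by
    intro z h1 h2
    refine tendsto_nhds_unique (hplane z).2 ((h1.2.add h2.2).congr' ?_)
    filter_upwards [self_mem_nhdsWithin] with ε hε
    have hε0 : 0 < ε := hε
    unfold truncBeurling
    rw [← integral_add (h1.1 ε hε0) (h2.1 ε hε0)]
    congr 1; ext ζ
    simp only [beurlingIntegrand_eq]
    rw [← add_mul, indicator_self_add_compl_apply]
  have in1 : ∀ z ∈ Ω, BeurlingExists (S.indicator f) z := by
    intro z hz
    obtain ⟨p, -, h1, h2⟩ := hnear1 z hz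
    exact (beurling_indicator_eq_of_ball_subset hf hS (hintg z) hg0 hg1 h1 hN0 hN
      (h2.trans hS1)).1
  have in2 : ∀ z ∈ Ω, BeurlingExists (Sᶜ.indicator f) z ∧
      beurling (Sᶜ.indicator f) z = offTransform f Sᶜ z := by
    intro z hz
    obtain ⟨p, -, h1, h2⟩ := hnear1 z hz
    exact beurling_indicator_eq_of_disjoint hf hS.compl (hintg z) h1 (hd1.mono_left h2)
  have ex1 : ∀ z ∈ (closure Ω)ᶜ, BeurlingExists (S.indicator f) z ∧
      beurling (S.indicator f) z = offTransform f S z := by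
    intro z hz
    obtain ⟨p, -, h1, h2⟩ := hnear2 z hz
    exact beurling_indicator_eq_of_disjoint hf hS (hintg z) h1 (hd2.mono_left h2)
  have ex2 : ∀ z ∈ (closure Ω)ᶜ, BeurlingExists (Sᶜ.indicator f) z := by
    intro z hz
    obtain ⟨p, -, h1, h2⟩ := hnear2 z hz
    exact (beurling_indicator_eq_of_ball_subset hf hS.compl (hintg z) hg0 hg1 h1 hN0 hN
      (h2.trans (compl_subset_compl.2 hS2))).1
  have hsum : ∀ z, z ∈ Ω ∨ z ∈ (closure Ω)ᶜ →
      beurling f z = beurling (S.indicator f) z + beurling (Sᶜ.indicator f) z := by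
    rintro z (hz | hz)
    · exact hadd z (in1 z hz) (in2 z hz).1
    · exact hadd z (ex1 z hz).1 (ex2 z hz)
  have hoff : ∀ z ∉ frontier Ω, z ∈ Ω ∨ z ∈ (closure Ω)ᶜ := by
    intro z hz
    by_contra hcon
    push Not at hcon
    rw [hΩo.frontier_eq] at hz
    exact hz ⟨not_not.1 hcon.2, hcon.1⟩
  have bplane := norm_beurling_sub_le hf hintg hg0 hg1 hN0 hN
  have bin : ∀ z ∈ Ω, ∀ w ∈ Ω, ‖beurling (Sᶜ.indicator f) z - beurling (Sᶜ.indicator f) w‖ ≤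
      oneSidedConst γ A s * N * ‖z - w‖ ^ (γ : ℝ) := by
    intro z hz w hw
    rw [(in2 z hz).2, (in2 w hw).2]
    exact norm_offTransform_sub_le hP hS.compl hd1
      (fun p hp => by obtain ⟨n, hn, -⟩ := hSflat p hp; exact ⟨-n, hn.compl⟩)
      hnear1 hf hintg hN0 hN hfb hz hw
  have bex : ∀ z ∈ (closure Ω)ᶜ, ∀ w ∈ (closure Ω)ᶜ,
      ‖beurling (S.indicator f) z - beurling (S.indicator f) w‖ ≤
        oneSidedConst γ A s * N * ‖z - w‖ ^ (γ : ℝ) := by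
    intro z hz w hw
    rw [(ex1 z hz).2, (ex1 w hw).2]
    exact norm_offTransform_sub_le hP hS hd2
      (fun p hp => by obtain ⟨n, hn, -⟩ := hSflat p hp; exact ⟨n, hn⟩)
      hnear2 hf hintg hN0 hN hfb hz hw
  have hpc : 0 ≤ planeConst γ := by
    have := radialConst_nonneg γ; unfold planeConst; positivity
  have one : ∀ {x : ℂ} {z w : ℂ}, ‖x‖ ≤ oneSidedConst γ A s * N * ‖z - w‖ ^ (γ : ℝ) →
      ‖x‖ ≤ M * ‖z - w‖ ^ (γ : ℝ) := by
    intro x z w h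
    have h0 : 0 ≤ ‖z - w‖ ^ (γ : ℝ) := by positivity
    have h1 := mul_le_mul_of_nonneg_right hM h0
    have h2 : 0 ≤ planeConst γ * N * ‖z - w‖ ^ (γ : ℝ) := by positivity
    linarith
  have two : ∀ {x y z w : ℂ}, ‖x‖ ≤ planeConst γ * N * ‖z - w‖ ^ (γ : ℝ) →
      ‖y‖ ≤ oneSidedConst γ A s * N * ‖z - w‖ ^ (γ : ℝ) →
      ‖x - y‖ ≤ M * ‖z - w‖ ^ (γ : ℝ) := by
    intro x y z w h h'
    have h0 : 0 ≤ ‖z - w‖ ^ (γ : ℝ) := by positivity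
    have h1 := mul_le_mul_of_nonneg_right hM h0
    have h2 := norm_sub_le x y
    linarith
  have hSb : Bornology.IsBounded S := hΩb.closure.subset hS2
  have hsides : ∀ p n, IsFlatAt γ A s Ω p n → IsFlatAt γ A s (closure Ω) p n →
      ∀ t : ℝ, 0 < t → t ≤ s / 2 → p + t * n ∈ Ω ∧ p - t * n ∈ (closure Ω)ᶜ := by
    intro p n h1 h2 t ht hts
    exact ⟨ball_add_normal_subset hP h1 ht hts (Metric.mem_ball_self (by linarith)),
      disjoint_left.1 (disjoint_ball_sub_normal hP h2 ht hts)
        (Metric.mem_ball_self (by linarith))⟩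
  constructor
  · refine twoSidedHolder_of_jump hγ0 hΩo ?_ ?_ ?_ ?_
    · intro z hz
      rcases hoff z hz with h | h
      · exact in1 z h
      · exact (ex1 z h).1
    · refine holderOnWith_of_norm_sub_le fun z hz w hw => ?_
      have h1 := hsum z (Or.inl hz)
      have h2 := hsum w (Or.inl hw)
      -- On the side carrying the density, the singular integral is the plane transform minus the
      -- transform of the complementary piece, which is evaluated off its support.
      have h3 : beurling (S.indicator f) z - beurling (S.indicator f) w =
          (beurling f z - beurling f w) -
            (beurling (Sᶜ.indicator f) z - beurling (Sᶜ.indicator f) w) := by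
        rw [h1, h2]; ring
      rw [h3]
      exact two (bplane z w) (bin z hz w hw)
    · exact holderOnWith_of_norm_sub_le fun z hz w hw => one (bex z hz w hw)
    · intro p hp
      obtain ⟨n, hn, hn1, hn2⟩ := hSflat p hp
      refine ⟨n, -(n ^ 2 * Real.pi * f p), jumpConst γ A s * N, s / 2, ?_, by linarith,
        fun t ht hts => ?_⟩
      · rw [norm_neg, norm_mul, norm_mul, norm_pow, hn.norm_eq, Complex.norm_real,
          Real.norm_of_nonneg Real.pi_pos.le]
        ring
      · obtain ⟨h1, h2⟩ := hsides p n hn1 hn2 t ht hts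
        refine ⟨h1, h2, ?_⟩
        rw [sub_neg_eq_add]
        exact norm_beurling_jump_le hP hS hSb hn hf hintg hN0 hN hfb ht hts
  · refine twoSidedHolder_of_jump hγ0 hΩo ?_ ?_ ?_ ?_
    · intro z hz
      rcases hoff z hz with h | h
      · exact (in2 z h).1
      · exact ex2 z h
    · exact holderOnWith_of_norm_sub_le fun z hz w hw => one (bin z hz w hw)
    · refine holderOnWith_of_norm_sub_le fun z hz w hw => ?_
      have h1 := hsum z (Or.inr hz)
      have h2 := hsum w (Or.inr hw)
      have h3 : beurling (Sᶜ.indicator f) z - beurling (Sᶜ.indicator f) w =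
          (beurling f z - beurling f w) -
            (beurling (S.indicator f) z - beurling (S.indicator f) w) := by
        rw [h1, h2]; ring
      rw [h3]
      exact two (bplane z w) (bex z hz w hw)
    · intro p hp
      obtain ⟨n, hn, hn1, hn2⟩ := hSflat p hp
      -- The jump estimate needs a bounded set, so it is not applied to `Sᶜ`. The plane transform
      -- has no jump: it varies by at most `planeConst γ * N * (2t)^γ` between `p ± t n`, so the
      -- complementary piece jumps by the opposite amount.
      refine ⟨n, n ^ 2 * Real.pi * f p, jumpConst γ A s * N + planeConst γ * N * 2, s / 2, ?_,
        by linarith, fun t ht hts => ?_⟩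
      · rw [norm_mul, norm_mul, norm_pow, hn.norm_eq, Complex.norm_real,
          Real.norm_of_nonneg Real.pi_pos.le]
        ring
      · obtain ⟨h1, h2⟩ := hsides p n hn1 hn2 t ht hts
        refine ⟨h1, h2, ?_⟩
        have h3 := hsum _ (Or.inl h1)
        have h4 := hsum _ (Or.inr h2)
        have h5 := norm_beurling_jump_le hP hS hSb hn hf hintg hN0 hN hfb ht hts
        have h6 := bplane (p + t * n) (p - t * n)
        have h7 : ‖(p + t * n) - (p - t * n)‖ ^ (γ : ℝ) ≤ 2 * t ^ (γ : ℝ) := by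
          rw [show (p + t * n) - (p - t * n) = ((2 * t : ℝ) : ℂ) * n by push_cast; ring, norm_mul,
            hn.norm_eq, mul_one, Complex.norm_real, Real.norm_of_nonneg (by linarith)]
          exact two_mul_rpow_le hg1 ht.le
        have h8 : beurling (Sᶜ.indicator f) (p + t * n) - beurling (Sᶜ.indicator f) (p - t * n) -
            n ^ 2 * Real.pi * f p = (beurling f (p + t * n) - beurling f (p - t * n)) -
            (beurling (S.indicator f) (p + t * n) - beurling (S.indicator f) (p - t * n) +
              n ^ 2 * Real.pi * f p) := by
          rw [h3, h4]; ring
        rw [h8]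
        refine (norm_sub_le _ _).trans ?_
        have h9 := mul_le_mul_of_nonneg_left h7 (by positivity : 0 ≤ planeConst γ * N)
        linarith

end

/-! ### Hölder norms, decay, and the main theorem. -/

lemma oneSidedConst_nonneg {g A s : ℝ} (h : FlatParams g A s) : 0 ≤ oneSidedConst g A s := by
  have h1 := coneConst_nonneg h
  have h2 := radialConst_nonneg g
  have h3 := h.s_pos
  unfold oneSidedConst; positivity

lemma planeConst_nonneg (g : ℝ) : 0 ≤ planeConst g := by
  have := radialConst_nonneg g
  unfold planeConst; positivity

lemma TwoSidedHolder.congr {γ M : ℝ≥0} {Ω S : Set ℂ} {f φ : ℂ → ℂ}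
    (h : TwoSidedHolder γ Ω S f M) (heq : EqOn f φ S) (hfr : frontier Ω ⊆ S) :
    TwoSidedHolder γ Ω S φ M := by
  have hind : S.indicator f = S.indicator φ := indicator_congr heq
  unfold TwoSidedHolder at h ⊢
  rw [hind] at h
  obtain ⟨h1, h2, h3, Fi, Fe, h4, h5, h6, h7, h8⟩ := h
  exact ⟨h1, h2, h3, Fi, Fe, h4, h5, h6, h7, fun z hz => by rw [h8 z hz, heq (hfr hz)]⟩

lemma norm_le_holderNorm {γ : ℝ≥0} {S : Set ℂ} {f : ℂ → ℂ} {B : ℝ} (hB : ∀ x ∈ S, ‖f x‖ ≤ B)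
    {x : ℂ} (hx : x ∈ S) : ‖f x‖ ≤ holderNorm γ S f := by
  have hbdd : BddAbove (range fun z : S => ‖f z‖₊) := by
    refine ⟨B.toNNReal, ?_⟩
    rintro _ ⟨z, rfl⟩
    exact NNReal.le_toNNReal_of_coe_le (by simpa using hB z z.2)
  have h1 : ‖f x‖₊ ≤ ⨆ z : S, ‖f z‖₊ := le_ciSup hbdd ⟨x, hx⟩
  have h2 : ‖f x‖₊ ≤ holderNorm γ S f := h1.trans le_self_add
  exact_mod_cast h2

lemma norm_sub_le_holderNorm {γ C : ℝ≥0} {S : Set ℂ} {f : ℂ → ℂ} (hf : HolderOnWith C γ f S)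
    {x y : ℂ} (hx : x ∈ S) (hy : y ∈ S) :
    ‖f x - f y‖ ≤ holderNorm γ S f * ‖x - y‖ ^ (γ : ℝ) := by
  have h1 : MemHolder γ (S.domRestrict f) := ⟨C, HolderWith.restrict_iff.2 hf⟩
  have h2 := (HolderWith.restrict_iff.1 h1.holderWith).norm_sub_le hx hy
  refine h2.trans ?_
  gcongr
  exact le_add_self

/-- For `|x| ≥ 2(R + R₀)` the distance to `∂Ω` is at least `|x| - R ≥ |x|/2`, so `x` lies outside `Ω
∪ U_{R₀}` and `δ(x)` may be replaced by `|x|/2`. -/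
lemma exists_decay_bound {Ω : Set ℂ} {R R₀ : ℝ} (hR : 0 < R) (hR₀ : 0 < R₀)
    (hΩR : Ω ⊆ Metric.ball 0 R) (hfr : (frontier Ω).Nonempty) {ψ : ℂ → ℂ} {C : ℝ}
    (hψ : DecaysOutside Ω R₀ ψ C) (x : ℂ) (hx : 2 * (R + R₀) ≤ ‖x‖) :
    ‖ψ x‖ ≤ 4 * |C| / ‖x‖ ^ 2 := by
  have hfrR : ∀ p ∈ frontier Ω, ‖p‖ ≤ R := by
    intro p hp
    have := closure_mono hΩR (frontier_subset_closure hp)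
    have := Metric.closure_ball_subset_closedBall this
    simpa using this
  have hdist : ∀ p ∈ frontier Ω, ‖x‖ - R ≤ dist x p := by
    intro p hp
    rw [dist_eq_norm]
    linarith [norm_sub_norm_le x p, hfrR p hp]
  have hx0 : 0 < ‖x‖ := by linarith
  have hmem : x ∈ (Ω ∪ ⋃ ζ ∈ frontier Ω, Metric.ball ζ R₀)ᶜ := by
    rintro (h | h)
    · have := hΩR h
      rw [mem_ball_zero_iff] at this
      linarith
    · simp only [mem_iUnion, Metric.mem_ball, exists_prop] at h
      obtain ⟨p, hp, h⟩ := h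
      linarith [hdist p hp]
  have hδ : ‖x‖ / 2 ≤ bdryDelta Ω R₀ x := by
    refine le_trans ?_ (le_max_left _ _)
    refine (Metric.le_infDist hfr).2 fun p hp => ?_
    linarith [hdist p hp]
  calc ‖ψ x‖ ≤ C / bdryDelta Ω R₀ x ^ 2 := hψ x hmem
    _ ≤ |C| / (‖x‖ / 2) ^ 2 := by
      gcongr
      exact le_abs_self C
    _ = _ := by field_simp; ring

theorem mainTheorem2 (γ : ℝ≥0) (hγ0 : 0 < γ) (hγ1 : γ < 1)
    (Ω : Set ℂ) (hΩo : IsOpen Ω) (hΩc : IsConnected Ω) (hΩb : Bornology.IsBounded Ω)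
    (hΩ : HasC1HolderBoundary γ Ω) (R₀ : ℝ) (hR₀ : 0 < R₀) :
    ∃ K : ℝ≥0,
      (∀ φ : ℂ → ℂ, (∃ C : ℝ≥0, HolderOnWith C γ φ (closure Ω)) →
        TwoSidedHolder γ Ω (closure Ω) φ (K * holderNorm γ (closure Ω) φ)) ∧
      (∀ ψ : ℂ → ℂ, (∃ C : ℝ≥0, HolderOnWith C γ ψ Ωᶜ) →
        (∃ Cψ : ℝ, DecaysOutside Ω R₀ ψ Cψ) →
        TwoSidedHolder γ Ω Ωᶜ ψ (K * holderNorm γ Ωᶜ ψ)) := by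
  obtain ⟨A, s, hP, hflat⟩ := hΩ.exists_hasFlatBoundary hγ0 hγ1 hΩo hΩb
  have hg0 := hP.g_pos
  have hg1 := hP.g_lt
  have hne := hΩc.nonempty
  obtain ⟨R, hR, hΩR⟩ : ∃ R, 0 < R ∧ Ω ⊆ Metric.ball 0 R := by
    obtain ⟨R, hR, h⟩ := hΩb.subset_ball_lt 0 0
    exact ⟨R, hR, h⟩
  have hRΩ : (R : ℂ) ∈ Ωᶜ := fun h => by
    have := hΩR h
    rw [mem_ball_zero_iff, Complex.norm_real, Real.norm_of_nonneg hR.le] at this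
    exact lt_irrefl _ this
  have hfrne : (frontier Ω).Nonempty := by
    obtain ⟨z, hz⟩ := hne
    obtain ⟨p, hp, -⟩ := exists_nearest_frontier hΩo ⟨_, hRΩ⟩ hz
    exact ⟨p, hp⟩
  have hcont : ∀ {f : ℂ → ℂ} {N : ℝ}, 0 ≤ N → (∀ x y, ‖f x - f y‖ ≤ N * ‖x - y‖ ^ (γ : ℝ)) →
      Measurable f := by
    intro f N hN0 hN
    have : HolderOnWith N.toNNReal γ f univ := holderOnWith_of_norm_sub_le fun x _ y _ => by
      rw [Real.coe_toNNReal N hN0]; exact hN x y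
    exact ((holderOnWith_univ.1 this).continuous hγ0).measurable
  -- One factor for both extensions: `5` covers the cutoff extension of `φ`, and `2 (2R)^γ` the
  -- growth of the extension of `ψ` inside `Ω`.
  set c : ℝ := 5 + 2 * (2 * R) ^ (γ : ℝ) with hc
  have hRg : 0 ≤ (2 * R) ^ (γ : ℝ) := by positivity
  set P : ℝ := planeConst γ + oneSidedConst γ A s with hPdef
  have hP0 : 0 ≤ P := add_nonneg (planeConst_nonneg _) (oneSidedConst_nonneg hP)
  have hM : ∀ H : ℝ≥0, ∀ N : ℝ, N ≤ c * H → P * N ≤ (((P * c).toNNReal * H : ℝ≥0) : ℝ) := by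
    intro H N h
    rw [NNReal.coe_mul, Real.coe_toNNReal _ (by positivity), mul_assoc]
    gcongr
  refine ⟨(P * c).toNNReal, ?_, ?_⟩
  · rintro φ ⟨C, hφ⟩
    obtain ⟨B, hB⟩ := hΩb.isCompact_closure.exists_bound_of_continuousOn (hφ.continuousOn hγ0)
    set H := holderNorm γ (closure Ω) φ with hH
    obtain ⟨f, hf1, hf2, hf3, hf4⟩ := exists_holder_extension_cutoff hg0 hg1 hne.closure H.2
      (fun x hx y hy => norm_sub_le_holderNorm hφ hx hy) (fun x hx => norm_le_holderNorm hB hx)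
    have hN0 : (0 : ℝ) ≤ 5 * H := by positivity
    have hfm := hcont hN0 hf2
    have hdec : ∀ x, R + 1 ≤ ‖x‖ → ‖f x‖ ≤ 0 / ‖x‖ ^ 2 := by
      intro x hx
      rw [hf4 x ?_]
      · simp
      · refine (Metric.le_infDist hne.closure).2 fun p hp => ?_
        have h1 := Metric.closure_ball_subset_closedBall (closure_mono hΩR hp)
        rw [mem_closedBall_zero_iff] at h1
        rw [dist_eq_norm]
        linarith [norm_sub_norm_le x p]
    exact (twoSidedHolder_of_plane hγ0 hΩo hne hΩb hP hflat isClosed_closure.measurableSet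
      subset_closure subset_rfl hfm
      (fun z ε hε => integrableOn_mul_beurlingKernel_of_decay hfm hf3 hdec z hε) hN0 hf2 hf3
      (hM H _ (mul_le_mul_of_nonneg_right (by linarith) H.2))).1.congr hf1 frontier_subset_closure
  · rintro ψ ⟨C, hψ⟩ ⟨Cψ, hdecψ⟩
    have hdec := exists_decay_bound hR hR₀ hΩR hfrne hdecψ
    -- This bound depends on `Cψ`, but serves only to show that the supremum in the Hölder norm is
    -- finite; afterwards `ψ` is bounded by its norm.
    have hB : ∀ x ∈ Ωᶜ, ‖ψ x‖ ≤ 4 * |Cψ| / (2 * (R + R₀)) ^ 2 +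
        (‖ψ R‖ + C * (2 * (R + R₀) + R) ^ (γ : ℝ)) := by
      intro x hx
      rcases le_or_gt (2 * (R + R₀)) ‖x‖ with h | h
      · have h1 : 4 * |Cψ| / ‖x‖ ^ 2 ≤ 4 * |Cψ| / (2 * (R + R₀)) ^ 2 := by gcongr
        have h2 : 0 ≤ ‖ψ R‖ + C * (2 * (R + R₀) + R) ^ (γ : ℝ) := by positivity
        linarith [hdec x h]
      · have h1 := hψ.norm_sub_le hx hRΩ
        have h2 : ‖x - R‖ ≤ 2 * (R + R₀) + R := by
          refine (norm_sub_le _ _).trans ?_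
          rw [Complex.norm_real, Real.norm_of_nonneg hR.le]; linarith
        have h3 : C * ‖x - R‖ ^ (γ : ℝ) ≤ C * (2 * (R + R₀) + R) ^ (γ : ℝ) := by gcongr
        have h4 := norm_le_norm_add_norm_sub' (ψ x) (ψ R)
        have h5 : 0 ≤ 4 * |Cψ| / (2 * (R + R₀)) ^ 2 := by positivity
        linarith
    set H := holderNorm γ Ωᶜ ψ with hH
    have hHb : ∀ x ∈ Ωᶜ, ‖ψ x‖ ≤ H := fun x hx => norm_le_holderNorm hB hx
    -- No cutoff is needed here: only values on the bounded set `Ω` are added, so the decay at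
    -- infinity is unchanged.
    obtain ⟨f, hf1, hf2⟩ := exists_holder_extension hg0 hg1 ⟨_, hRΩ⟩ H.2
      (fun x hx y hy => norm_sub_le_holderNorm hψ hx hy)
    have hN0 : (0 : ℝ) ≤ c * H := by positivity
    have hf2' : ∀ x y, ‖f x - f y‖ ≤ (c * H) * ‖x - y‖ ^ (γ : ℝ) := by
      intro x y
      refine (hf2 x y).trans (mul_le_mul_of_nonneg_right ?_ (by positivity))
      exact mul_le_mul_of_nonneg_right (by linarith) H.2
    have hf3 : ∀ x, ‖f x‖ ≤ c * H := by
      intro x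
      by_cases hx : x ∈ Ω
      · have h1 := hf2 x R
        have h2 : ‖x - R‖ ≤ 2 * R := by
          have h3 := hΩR hx
          rw [mem_ball_zero_iff] at h3
          refine (norm_sub_le _ _).trans ?_
          rw [Complex.norm_real, Real.norm_of_nonneg hR.le]; linarith
        have h3 : 2 * (H : ℝ) * ‖x - R‖ ^ (γ : ℝ) ≤ 2 * H * (2 * R) ^ (γ : ℝ) := by gcongr
        have h4 := norm_le_norm_add_norm_sub' (f x) (f R)
        have h5 : ‖f R‖ ≤ H := by rw [hf1 hRΩ]; exact hHb _ hRΩ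
        have h6 : c * H = 5 * H + 2 * H * (2 * R) ^ (γ : ℝ) := by rw [hc]; ring
        have h7 : (0 : ℝ) ≤ H := H.2
        linarith [h1.trans h3]
      · rw [hf1 hx]
        have h1 := hHb x hx
        have h2 : (0 : ℝ) ≤ H := H.2
        nlinarith
    have hfm := hcont hN0 hf2'
    have hdecf : ∀ x, 2 * (R + R₀) ≤ ‖x‖ → ‖f x‖ ≤ 4 * |Cψ| / ‖x‖ ^ 2 := by
      intro x hx
      have hxΩ : x ∈ Ωᶜ := fun h => by
        have := hΩR h
        rw [mem_ball_zero_iff] at this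
        linarith
      rw [hf1 hxΩ]
      exact hdec x hx
    exact (twoSidedHolder_of_plane hγ0 hΩo hne hΩb hP hflat hΩo.measurableSet subset_rfl
      subset_closure hfm
      (fun z ε hε => integrableOn_mul_beurlingKernel_of_decay hfm hf3 hdecf z hε) hN0 hf2' hf3
      (hM H _ le_rfl)).2.congr hf1 (fun x hx => by
        rw [hΩo.frontier_eq] at hx; exact hx.2)
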